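/- **Setting.** Let $(x_j,T_j,Y_{1j},Y_{0j})$, $j=1,2,\dots$, be i.i.d. copies of $(x,T,Y_1,Y_0)$, where $x\in\mathbb R^d$ are covariates, $T\in\{0,1\}$ is the treatment indicator and $Y_1,Y_0$ are the potential outcomes; $\mu_1=E(Y_1)$. Put $\mathcal S_i=\{j\le n: T_j=i\}$, $\tilde x=(1,x^\top)^\top$ and $\tau(x;\alpha)=\exp(\tilde x^\top\alpha)/\{1+\exp(\tilde x^\top\alpha)\}$. Let $\hat\alpha$ maximize the likelihood $\prod_{j\le n}\tau(x_j;\alpha)^{T_j}\{1-\tau(x_j;\alpha)\}^{1-T_j}$ (whenever a maximizer exists), $\hat\tau_j=\tau(x_j;\hat\alpha)$, and $$\tilde a_{1j}=\frac{\hat\tau_j^{-1}}{\sum_{l\in\mathcal S_1}\hat\tau_l^{-1}},\qquad \tilde a_{0j}=\frac{(1-\hat\tau_j)^{-1}}{\sum_{l\in\mathcal S_0}(1-\hat\tau_l)^{-1}} .$$ For $i=0,1$ let $m_i(x;\beta_i)$ be an outcome regression model for $Y_i$, let $\hat\beta_i$ be an estimator with $\hat\beta_i-\beta_i^*=O_p(n^{-1/2})$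 for some $\beta_i^*$, and put $\hat m_{ij}=m_i(x_j;\hat\beta_i)$, $\bar{\hat m}_i=n^{-1}\sum_{j=1}^n\hat m_{ij}$, $\hat u_{1j}=\hat m_{1j}-\bar{\hat m}_1$. Let $(\hat p_1,\hat p_0)$ maximize (whenever a maximizer exists) $$n\Big\{\tfrac12\sum_{j\in\mathcal S_1}\tilde a_{1j}\log p_{1j}+\tfrac12\sum_{j\in\mathcal S_0}\tilde a_{0j}\log p_{0j}\Big\}$$ over positive $p_{1j}$ ($j\in\mathcal S_1$) and $p_{0j}$ ($j\in\mathcal S_0$) with $\sum_{j\in\mathcal S_i}p_{ij}=1$ and $\sum_{j\in\mathcal S_i}p_{ij}\hat m_{ij}=\bar{\hat m}_i$, $i=0,1$. The model-calibrated maximum PEL estimator of $\mu_1$ is $\hat\mu_{1\mathrm{MCP}}=\sum_{j\in\mathcal S_1}\hat p_{1j}Y_{1j}$. **Standing assumptions.** $T$ and $(Y_1,Y_0)$ are conditionally independent given $x$; $0<P(T=1\mid x)<1$ almost surely; $E(Y_1^2)<\infty$, $E\|x\|^2<\infty$; and for $i=0,1$: $E\{m_i(x;\beta_i^*)^2\}<\infty$,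 $\operatorname{Var}\{m_i(x;\beta_i^*)\}>0$, and there are a neighbourhood $U_i$ of $\beta_i^*$ and a function $h_i$ with $E\{h_i(x)\}<\infty$ such that for each $x$ the map $m_i(x;\cdot)$ is continuously differentiable on $U_i$ with $\|\partial m_i(x;\beta)/\partial\beta\|\le h_i(x)$ for $\beta\in U_i$. **Theorem.** (a) *Propensity score model correct.* Suppose $P(T=1\mid x)=\tau(x;\alpha^0)$ almost surely for some $\alpha^0$, and $0<c_1\le\tau(x;\alpha^0)\le c_2<1$ almost surely for constants $c_1,c_2$. Then $\hat\mu_{1\mathrm{MCP}}\to\mu_1$ in probability, and $$\hat\mu_{1\mathrm{MCP}}=\sum_{j\in\mathcal S_1}\tilde a_{1j}Y_{1j}+\hat B\Big\{\bar{\hat m}_1-\sum_{j\in\mathcal S_1}\tilde a_{1j}\hat m_{1j}\Big\}+o_p(n^{-1/2}),\qquad \hat B=\Big\{\sum_{j\in\mathcal S_1}\tilde a_{1j}\hat u_{1j}Y_{1j}\Big\}\Big\{\sum_{j\in\mathcal S_1}\tilde a_{1j}\hat u_{1j}^2\Big\}^{-1}.$$ (b) *Outcome regression model correct.* Suppose $E(Y_1\mid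 x)=m_1(x;\beta_1^*)$ almost surely (the propensity score model may be misspecified). Let $\alpha^*$ maximize the expected log-likelihood $E[T\log\tau(x;\alpha)+(1-T)\log\{1-\tau(x;\alpha)\}]$, put $u(x)=m_1(x;\beta_1^*)-E\{m_1(x;\beta_1^*)\}$, and suppose that $0<c_1\le\tau(x;\alpha^*)\le c_2<1$ almost surely for constants $c_1,c_2$, that the gradient bound for $m_1$ holds with some $h_1$ with $E\{h_1(x)^2\}<\infty$, and that one of the following holds: (i) there are $\lambda^*\in\mathbb R$ and $\delta>0$ with $1+\lambda^*u(x)\ge\delta$ almost surely and $E\big[T\,u(x)\big/\{\tau(x;\alpha^*)(1+\lambda^*u(x))\}\big]=0$; (ii) with $c=E\{T\,u(x)/\tau(x;\alpha^*)\}$ and $v=-u$ if $c>0$, $v=u$ if $c<0$ (no condition if $c=0$): for each $\varepsilon>0$ there is $\eta\in(0,1)$ such that, with probability tending to one, every $j\in\mathcal S_1$ with $v(x_j)\ge(1-\eta)\max_{k\in\mathcal S_1}v(x_k)$ satisfies $|Y_{1j}-m_1(x_j;\beta_1^*)|\le\varepsilon\,v(x_j)$. Then $\hat\mu_{1\mathrm{MCP}}\to\mu_1$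 in probability. -/

import Mathlib

open MeasureTheory ProbabilityTheory Filter Topology

namespace PELCausal

noncomputable section

/-! ### Units, propensity scores and the sampling model -/

/-- The full data `(x, T, Y₁, Y₀)` of one subject: covariates `x ∈ ℝᵈ`, treatment indicator,
and the two potential outcomes. -/
abbrev Obs (d : ℕ) : Type := EuclideanSpace ℝ (Fin d) × Bool × ℝ × ℝ

/-- The covariate vector `x`. -/
def cov {d : ℕ} (z : Obs d) : EuclideanSpace ℝ (Fin d) := z.1

/-- The treatment indicator (`true` is treatment, `false` is control). -/
def trt {d : ℕ} (z : Obs d) : Bool := z.2.1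

/-- The treatment indicator `T` as a real number in `{0, 1}`. -/
def trtInd {d : ℕ} (z : Obs d) : ℝ := if trt z then 1 else 0

/-- The potential outcome under treatment, `Y₁`. -/
def y1 {d : ℕ} (z : Obs d) : ℝ := z.2.2.1

/-- The potential outcome under control, `Y₀`. -/
def y0 {d : ℕ} (z : Obs d) : ℝ := z.2.2.2

theorem measurable_cov {d : ℕ} : Measurable (cov : Obs d → EuclideanSpace ℝ (Fin d)) :=
  measurable_fst

/-- The sigma-algebra on the population generated by the covariates. -/
abbrev covSigma (d : ℕ) : MeasurableSpace (Obs d) := MeasurableSpace.comap cov inferInstance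

theorem covSigma_le (d : ℕ) : covSigma d ≤ (inferInstance : MeasurableSpace (Obs d)) :=
  measurable_cov.comap_le

/-- `x̃ = (1, xᵀ)ᵀ`. -/
def augment {d : ℕ} (x : EuclideanSpace ℝ (Fin d)) : EuclideanSpace ℝ (Fin (d + 1)) :=
  WithLp.toLp 2 (Fin.cons 1 (fun i => x i))

/-- The logistic propensity score model `τ(x; α) = expit(x̃ᵀ α)`. -/
def tau {d : ℕ} (x : EuclideanSpace ℝ (Fin d)) (α : EuclideanSpace ℝ (Fin (d + 1))) : ℝ :=
  Real.exp (inner ℝ (augment x) α) / (1 + Real.exp (inner ℝ (augment x) α))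

/-- The true propensity score `P(T = 1 ∣ x)` in the population with law `P`. -/
def trueScore {d : ℕ} (P : Measure (Obs d)) : Obs d → ℝ := P[trtInd | covSigma d]

/-- Strongly ignorable treatment assignment: `T` and `(Y₁, Y₀)` are independent given `x`. -/
def SITA {d : ℕ} (P : Measure (Obs d)) [IsFiniteMeasure P] : Prop :=
  CondIndepFun (covSigma d) (covSigma_le d) trt (fun z : Obs d => (y1 z, y0 z)) P

/-- Positivity: `0 < P(T = 1 ∣ x) < 1`. -/
def Positivity {d : ℕ} (P : Measure (Obs d)) : Prop :=
  ∀ᵐ z ∂P, 0 < trueScore P z ∧ trueScore P z < 1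

/-- The logistic model is correct with true parameter value `α₀`. -/
def PSCorrect {d : ℕ} (P : Measure (Obs d)) (α₀ : EuclideanSpace ℝ (Fin (d + 1))) : Prop :=
  trueScore P =ᵐ[P] fun z => tau (cov z) α₀

/-- The model propensity scores at `α` are bounded away from zero and one. -/
def Overlap {d : ℕ} (P : Measure (Obs d)) (α : EuclideanSpace ℝ (Fin (d + 1))) : Prop :=
  ∃ c₁ c₂ : ℝ, 0 < c₁ ∧ c₂ < 1 ∧ ∀ᵐ z ∂P, c₁ ≤ tau (cov z) α ∧ tau (cov z) α ≤ c₂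

/-- The likelihood factor `τ(x; α)^T {1 - τ(x; α)}^(1 - T)` of one subject. -/
def likTerm {d : ℕ} (α : EuclideanSpace ℝ (Fin (d + 1))) (z : Obs d) : ℝ :=
  if trt z then tau (cov z) α else 1 - tau (cov z) α

/-- `α` maximizes the likelihood of the propensity score model over the first `n` subjects. -/
def IsMLE {d : ℕ} (z : ℕ → Obs d) (n : ℕ) (α : EuclideanSpace ℝ (Fin (d + 1))) : Prop :=
  ∀ a, ∏ j ∈ Finset.range n, likTerm a (z j) ≤ ∏ j ∈ Finset.range n, likTerm α (z j)

/-- `α` maximizes the expected log-likelihood of the (possibly misspecified) propensity score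
model. -/
def IsPseudoTrue {d : ℕ} (P : Measure (Obs d)) (α : EuclideanSpace ℝ (Fin (d + 1))) : Prop :=
  ∀ a, ∫ z, Real.log (likTerm a z) ∂P ≤ ∫ z, Real.log (likTerm α z) ∂P

/-! ### Outcome regression models -/

/-- The fitted value `m(x; β)`, with the value of the parameter plugged in, as a function of
the subject. -/
def fit {d q : ℕ} (m : EuclideanSpace ℝ (Fin d) → EuclideanSpace ℝ (Fin q) → ℝ)
    (β : EuclideanSpace ℝ (Fin q)) (z : Obs d) : ℝ := m (cov z) β

/-- The outcome regression model for `Y₁` is correct, with parameter value `β`: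
`E(Y₁ ∣ x) = m(x; β)`. -/
def ORCorrect {d q : ℕ} (P : Measure (Obs d))
    (m : EuclideanSpace ℝ (Fin d) → EuclideanSpace ℝ (Fin q) → ℝ)
    (β : EuclideanSpace ℝ (Fin q)) : Prop :=
  P[y1 | covSigma d] =ᵐ[P] fit m β

/-- On a neighbourhood of `β`, and for each `x`, the mean function is continuously differentiable
in the parameter, and its gradient is dominated by `h(x)` with `E{h(x)^r} < ∞`. -/
def GradientDominated {d q : ℕ} (P : Measure (Obs d))
    (m : EuclideanSpace ℝ (Fin d) → EuclideanSpace ℝ (Fin q) → ℝ)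
    (β : EuclideanSpace ℝ (Fin q)) (r : ENNReal) : Prop :=
  ∃ U ∈ 𝓝 β, ∃ h : EuclideanSpace ℝ (Fin d) → ℝ, MemLp (fun z => h (cov z)) r P ∧
    ∀ x, (∀ b ∈ U, DifferentiableAt ℝ (m x) b ∧ ‖fderiv ℝ (m x) b‖ ≤ h x) ∧
      ContinuousOn (fderiv ℝ (m x)) U

/-- The population mean-centred regression value `u(x) = m(x; β) - E{m(x; β)}`. -/
def popU {d q : ℕ} (P : Measure (Obs d))
    (m : EuclideanSpace ℝ (Fin d) → EuclideanSpace ℝ (Fin q) → ℝ)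
    (β : EuclideanSpace ℝ (Fin q)) (z : Obs d) : ℝ := fit m β z - ∫ z', fit m β z' ∂P

/-- `lam` is the Lagrange multiplier of the population calibration equation
`E[T u / {τ(x; α) (1 + lam u)}] = 0`, and it is interior: `1 + lam u` is bounded away from
zero. -/
def PopMultiplier {d q : ℕ} (P : Measure (Obs d))
    (m : EuclideanSpace ℝ (Fin d) → EuclideanSpace ℝ (Fin q) → ℝ)
    (α : EuclideanSpace ℝ (Fin (d + 1))) (β : EuclideanSpace ℝ (Fin q)) (lam : ℝ) : Prop :=
  (∃ δ : ℝ, 0 < δ ∧ ∀ᵐ z ∂P, δ ≤ 1 + lam * popU P m β z) ∧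
    ∫ z, trtInd z * popU P m β z / (tau (cov z) α * (1 + lam * popU P m β z)) ∂P = 0

/-! ### The estimators, computed from the first `n` subjects -/

/-- `𝒮₁`, the treated subjects among the first `n`. -/
def S1 {d : ℕ} (z : ℕ → Obs d) (n : ℕ) : Finset ℕ :=
  {j ∈ Finset.range n | trt (z j) = true}

/-- `𝒮₀`, the control subjects among the first `n`. -/
def S0 {d : ℕ} (z : ℕ → Obs d) (n : ℕ) : Finset ℕ :=
  {j ∈ Finset.range n | trt (z j) = false}

/-- The weights `ã₁ⱼ`. -/
def a1 {d : ℕ} (z : ℕ → Obs d) (n : ℕ) (α : EuclideanSpace ℝ (Fin (d + 1))) (j : ℕ) : ℝ :=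
  (tau (cov (z j)) α)⁻¹ / ∑ l ∈ S1 z n, (tau (cov (z l)) α)⁻¹

/-- The weights `ã₀ⱼ`. -/
def a0 {d : ℕ} (z : ℕ → Obs d) (n : ℕ) (α : EuclideanSpace ℝ (Fin (d + 1))) (j : ℕ) : ℝ :=
  (1 - tau (cov (z j)) α)⁻¹ / ∑ l ∈ S0 z n, (1 - tau (cov (z l)) α)⁻¹

/-- The average of the fitted values over the whole sample. -/
def fitMean {d q : ℕ} (m : EuclideanSpace ℝ (Fin d) → EuclideanSpace ℝ (Fin q) → ℝ)
    (z : ℕ → Obs d) (n : ℕ) (β : EuclideanSpace ℝ (Fin q)) : ℝ :=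
  (∑ j ∈ Finset.range n, fit m β (z j)) / n

/-- The joint pseudo-empirical log-likelihood
`n {w₁ ∑_{𝒮₁} ã₁ⱼ log p₁ⱼ + w₀ ∑_{𝒮₀} ã₀ⱼ log p₀ⱼ}` with `w₁ = w₀ = 1/2`. -/
def pel {d : ℕ} (z : ℕ → Obs d) (n : ℕ) (α : EuclideanSpace ℝ (Fin (d + 1)))
    (p₁ p₀ : ℕ → ℝ) : ℝ :=
  n * ((1 / 2) * ∑ j ∈ S1 z n, a1 z n α j * Real.log (p₁ j) +
    (1 / 2) * ∑ j ∈ S0 z n, a0 z n α j * Real.log (p₀ j))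

/-- `p₁` and `p₀` are (positive) probabilities on `𝒮₁` and `𝒮₀` that satisfy the
model-calibration constraints. -/
structure Feasible {d q₁ q₀ : ℕ}
    (m₁ : EuclideanSpace ℝ (Fin d) → EuclideanSpace ℝ (Fin q₁) → ℝ)
    (m₀ : EuclideanSpace ℝ (Fin d) → EuclideanSpace ℝ (Fin q₀) → ℝ)
    (z : ℕ → Obs d) (n : ℕ)
    (β₁ : EuclideanSpace ℝ (Fin q₁)) (β₀ : EuclideanSpace ℝ (Fin q₀))
    (p₁ p₀ : ℕ → ℝ) : Prop where
  pos_one : ∀ j ∈ S1 z n, 0 < p₁ j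
  pos_zero : ∀ j ∈ S0 z n, 0 < p₀ j
  sum_one : ∑ j ∈ S1 z n, p₁ j = 1
  sum_zero : ∑ j ∈ S0 z n, p₀ j = 1
  calib_one : ∑ j ∈ S1 z n, p₁ j * fit m₁ β₁ (z j) = fitMean m₁ z n β₁
  calib_zero : ∑ j ∈ S0 z n, p₀ j * fit m₀ β₀ (z j) = fitMean m₀ z n β₀

/-- `(p₁, p₀)` maximizes the pseudo-empirical likelihood under the normalization and
model-calibration constraints. -/
def IsMaxPEL {d q₁ q₀ : ℕ}
    (m₁ : EuclideanSpace ℝ (Fin d) → EuclideanSpace ℝ (Fin q₁) → ℝ)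
    (m₀ : EuclideanSpace ℝ (Fin d) → EuclideanSpace ℝ (Fin q₀) → ℝ)
    (z : ℕ → Obs d) (n : ℕ) (α : EuclideanSpace ℝ (Fin (d + 1)))
    (β₁ : EuclideanSpace ℝ (Fin q₁)) (β₀ : EuclideanSpace ℝ (Fin q₀))
    (p₁ p₀ : ℕ → ℝ) : Prop :=
  Feasible m₁ m₀ z n β₁ β₀ p₁ p₀ ∧
    ∀ r₁ r₀, Feasible m₁ m₀ z n β₁ β₀ r₁ r₀ → pel z n α r₁ r₀ ≤ pel z n α p₁ p₀

/-- The weighted mean `∑_{𝒮₁} p₁ⱼ Y₁ⱼ`. -/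
def muHat {d : ℕ} (z : ℕ → Obs d) (n : ℕ) (p₁ : ℕ → ℝ) : ℝ :=
  ∑ j ∈ S1 z n, p₁ j * y1 (z j)

/-- `û₁ⱼ = m̂₁ⱼ - m̄̂₁`. -/
def uHat {d q : ℕ} (m : EuclideanSpace ℝ (Fin d) → EuclideanSpace ℝ (Fin q) → ℝ)
    (z : ℕ → Obs d) (n : ℕ) (β : EuclideanSpace ℝ (Fin q)) (j : ℕ) : ℝ :=
  fit m β (z j) - fitMean m z n β

/-- The weighted regression coefficient `B̂`. -/
def BHat {d q : ℕ} (m : EuclideanSpace ℝ (Fin d) → EuclideanSpace ℝ (Fin q) → ℝ)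
    (z : ℕ → Obs d) (n : ℕ) (α : EuclideanSpace ℝ (Fin (d + 1)))
    (β : EuclideanSpace ℝ (Fin q)) : ℝ :=
  (∑ j ∈ S1 z n, a1 z n α j * uHat m z n β j * y1 (z j)) *
    (∑ j ∈ S1 z n, a1 z n α j * uHat m z n β j ^ 2)⁻¹

/-- The leading term `∑_{𝒮₁} ã₁ⱼ Y₁ⱼ + B̂ {m̄̂₁ - ∑_{𝒮₁} ã₁ⱼ m̂₁ⱼ}`. -/
def leadingTerm {d q : ℕ} (m : EuclideanSpace ℝ (Fin d) → EuclideanSpace ℝ (Fin q) → ℝ)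
    (z : ℕ → Obs d) (n : ℕ) (α : EuclideanSpace ℝ (Fin (d + 1)))
    (β : EuclideanSpace ℝ (Fin q)) : ℝ :=
  ∑ j ∈ S1 z n, a1 z n α j * y1 (z j) +
    BHat m z n α β * (fitMean m z n β - ∑ j ∈ S1 z n, a1 z n α j * fit m β (z j))

/-! ### Calibration under a misspecified propensity score model -/

/-- The population calibration discrepancy `E{T u / τ(x; α)}` of the inverse probability
weights; it vanishes if `τ(x; α)` is the true propensity score. -/
def calibGap {d q : ℕ} (P : Measure (Obs d))
    (m : EuclideanSpace ℝ (Fin d) → EuclideanSpace ℝ (Fin q) → ℝ)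
    (α : EuclideanSpace ℝ (Fin (d + 1))) (β : EuclideanSpace ℝ (Fin q)) : ℝ :=
  ∫ z, trtInd z * popU P m β z / tau (cov z) α ∂P

/-- With `v = s u(x)`: for each `ε > 0` there is `η ∈ (0, 1)` such that, with probability tending
to one, no treated subject `j` whose `vⱼ` is within the factor `1 - η` of the largest value of `v`
in `𝒮₁` has a residual `|Y₁ⱼ - m(xⱼ; β)|` above `ε vⱼ`. -/
def SmallExtremeResiduals {Ω : Type*} [MeasurableSpace Ω] {d q : ℕ} (μ : Measure Ω)
    (P : Measure (Obs d)) (Z : ℕ → Ω → Obs d)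
    (m : EuclideanSpace ℝ (Fin d) → EuclideanSpace ℝ (Fin q) → ℝ)
    (β : EuclideanSpace ℝ (Fin q)) (s : ℝ) : Prop :=
  ∀ ε : ℝ, 0 < ε → ∃ η : ℝ, 0 < η ∧ η < 1 ∧
    Tendsto (fun n : ℕ => μ {ω | ∃ j ∈ S1 (fun i => Z i ω) n,
        (∀ k ∈ S1 (fun i => Z i ω) n,
          (1 - η) * (s * popU P m β (Z k ω)) ≤ s * popU P m β (Z j ω)) ∧
        ε * (s * popU P m β (Z j ω)) < |y1 (Z j ω) - fit m β (Z j ω)|}) atTop (𝓝 0)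

/-- Regularity of the calibration at the limits `α` and `β`: the population multiplier exists in
the interior of its domain, or the residuals are small at the extreme regression values
towards which the calibration has to move the weights. -/
def CalibrationRegular {Ω : Type*} [MeasurableSpace Ω] {d q : ℕ} (μ : Measure Ω)
    (P : Measure (Obs d)) (Z : ℕ → Ω → Obs d)
    (m : EuclideanSpace ℝ (Fin d) → EuclideanSpace ℝ (Fin q) → ℝ)
    (α : EuclideanSpace ℝ (Fin (d + 1))) (β : EuclideanSpace ℝ (Fin q)) : Prop :=
  (∃ lam : ℝ, PopMultiplier P m α β lam) ∨
    ((0 < calibGap P m α β → SmallExtremeResiduals μ P Z m β (-1)) ∧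
      (calibGap P m α β < 0 → SmallExtremeResiduals μ P Z m β 1))

/-! ### Stochastic orders -/

/-- `Vₙ - v = O_p(n^{-1/2})`. -/
def RootNConsistent {Ω E : Type*} [MeasurableSpace Ω] [SeminormedAddCommGroup E]
    (μ : Measure Ω) (V : ℕ → Ω → E) (v : E) : Prop :=
  ∀ ε : ENNReal, 0 < ε → ∃ C : ℝ, ∀ᶠ n : ℕ in atTop, μ {ω | C < √(n : ℝ) * ‖V n ω - v‖} ≤ ε

/-- `Rₙ = o_p(n^{-1/2})`. -/
def SmallOpRootN {Ω : Type*} [MeasurableSpace Ω] (μ : Measure Ω) (R : ℕ → Ω → ℝ) : Prop :=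
  TendstoInMeasure μ (fun (n : ℕ) ω => √(n : ℝ) * R n ω) atTop (fun _ => 0)

end

end PELCausal

open PELCausal

set_option linter.unusedSectionVars false

/-! Lagrangian form. Calibrating the fitted values to their overall mean means calibrating the
centred values `û` to zero. If `û` takes both signs in each arm, the inequality `log x ≤ x - 1`
shows that the maximizer exists and has treated weights `ãⱼ / (1 + λ ûⱼ)`, where `λ` solves `∑ ãⱼ ûⱼ
/ (1 + λ ûⱼ) = 0` (`isMaxPEL_form`). The arms do not interact, so the controls matter only for
existence. Ignorability and positivity put treated and control units on both sides of zero with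
probability tending to one (`exists_isCalibrated`).

Propensity score. In both parts the expected score vanishes at the limit `α`. The log-likelihood is
strictly concave along the span of the design, so the linear predictors of the maximizer are those
of a parameter at distance `O(n^{-1/2})` from `α`, even if the covariates are collinear
(`exists_isMLE_and_bound`, `exists_mle_rate`). As `max ‖xⱼ‖ = o(√n)`, the estimated inverse scores
are uniformly close to the limiting ones, and weighted means obey a law of large numbers.

No calibration gap. If `E{T u / τ} = 0`, which always holds in part (a), then `∑ ãⱼ ûⱼ =
O(n^{-1/2})` and `max |ûⱼ| = o(√n)`. Hence `λ = O(n^{-1/2})` and `max |λ ûⱼ| = o(1)`, and a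
second-order expansion in `λ` gives the regression estimator (`calibration_expansion`,
`expansion_of_calibrated`). Its limit is `E{T Y₁ / τ} / E{T / τ}`, which equals `μ₁` if either model
is correct.

Nonzero gap, in part (b). Now `λ` does not tend to zero. Calibration makes the error equal to `∑ p̂ⱼ
(Y₁ⱼ - mⱼ) + o(1)` (`IsCalibrated.abs_muHat_sub_le`). For a fixed tilt with denominators bounded
below, the residual sum tends to zero because `E(Y₁ - m ∣ x) = 0`, and this is uniform over a
compact range of tilts (`tilted_resid_uniform`). It remains to control the denominators
(`TiltControl`). Under (i) the calibration function is monotone in the multiplier, so the sample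
root stays below a tilt slightly beyond the population root. Under (ii), let `v` be `±u`, with the
sign for which the weights must move towards large `v`. Below a level `K` the denominators are
bounded. Above `K`, a unit not within a factor `1 - η` of the maximum still has a bounded
denominator, because positivity at the maximum bounds the tilt, and such residuals are negligible
for a suitable `K`. A unit near the maximum may have a large weight, but its residual is at most `ε
v`, and `∑ p̂ⱼ vⱼ⁺ ≤ ∑ ãⱼ |vⱼ|` since the positive and negative parts balance under `p̂` and `p̂ ≤
ã` where `v ≤ 0`.

Bookkeeping. "With probability tending to one" is a filter on `ℕ × Ω`, so stochastic orders become
ordinary limits and eventual bounds. Events are measured by outer measure, as the estimators need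
not be measurable. An `O_p` bound becomes an eventual bound on passing to finer filters
(`tendsto_whp_of_tight`). -/

namespace PELCausal

/-! ### Convergence with probability tending to one -/

/-- The filter of the events `S ⊆ ℕ × Ω` whose sections have (outer) probability tending to
one. -/
def whp {Ω : Type*} [MeasurableSpace Ω] (μ : Measure Ω) : Filter (ℕ × Ω) where
  sets := {S | Tendsto (fun n => μ {ω | (n, ω) ∉ S}) atTop (𝓝 0)}
  univ_sets := by simp
  sets_of_superset := by
    intro S T hS hST
    refine tendsto_of_tendsto_of_tendsto_of_le_of_le tendsto_const_nhds hS
      (fun _ => zero_le) fun n => measure_mono fun ω h h' => h (hST h')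
  inter_sets := by
    intro S T hS hT
    have h := Tendsto.add hS hT
    rw [add_zero] at h
    refine tendsto_of_tendsto_of_tendsto_of_le_of_le tendsto_const_nhds h
      (fun _ => zero_le) fun n => ?_
    refine (measure_mono ?_).trans (measure_union_le _ _)
    intro ω h
    by_contra h'
    simp only [Set.mem_union, Set.mem_ofPred_eq, not_or, not_not] at h'
    exact h ⟨h'.1, h'.2⟩

section Filter

variable {Ω : Type*} [MeasurableSpace Ω] {μ : Measure Ω}

theorem eventually_whp {Q : ℕ → Ω → Prop} :
    (∀ᶠ p in whp μ, Q p.1 p.2) ↔ Tendsto (fun n => μ {ω | ¬ Q n ω}) atTop (𝓝 0) :=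
  Iff.rfl

/-- Convergence in probability becomes an ordinary limit along `whp`, so the algebra of limits and
`filter_upwards` apply to it. -/
theorem tendsto_whp_iff {f : ℕ → Ω → ℝ} {c : ℝ} :
    Tendsto (fun p : ℕ × Ω => f p.1 p.2) (whp μ) (𝓝 c) ↔
      TendstoInMeasure μ f atTop (fun _ => c) := by
  rw [tendstoInMeasure_iff_norm, Metric.tendsto_nhds]
  refine forall_congr' fun ε => forall_congr' fun _ => ?_
  rw [eventually_whp (Q := fun n ω => dist (f n ω) c < ε)]
  simp only [not_lt, Real.dist_eq, Real.norm_eq_abs]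

theorem tendsto_fst_whp : Tendsto Prod.fst (whp μ) atTop := by
  rw [tendsto_atTop]
  intro b
  rw [eventually_whp (Q := fun n _ => b ≤ n)]
  refine tendsto_const_nhds.congr' ?_
  filter_upwards [eventually_ge_atTop b] with n hn
  simp [hn]

theorem eventually_whp_of_ae {Q : ℕ → Ω → Prop} (h : ∀ n, ∀ᵐ ω ∂μ, Q n ω) :
    ∀ᶠ p in whp μ, Q p.1 p.2 := by
  rw [eventually_whp]
  refine tendsto_const_nhds.congr fun n => ?_
  exact (ae_iff.1 (h n)).symm

/-- `f` is bounded in probability. -/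
def Tight (μ : Measure Ω) (f : ℕ → Ω → ℝ) : Prop :=
  ∀ ε : ENNReal, 0 < ε → ∃ C : ℝ, ∀ᶠ n : ℕ in atTop, μ {ω | C < f n ω} ≤ ε

theorem Tight.add {f g : ℕ → Ω → ℝ} (hf : Tight μ f) (hg : Tight μ g) :
    Tight μ fun n ω => f n ω + g n ω := by
  intro ε hε
  obtain ⟨C, hC⟩ := hf (ε / 2) (ENNReal.half_pos hε.ne')
  obtain ⟨D, hD⟩ := hg (ε / 2) (ENNReal.half_pos hε.ne')
  refine ⟨C + D, ?_⟩
  filter_upwards [hC, hD] with n h1 h2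
  calc μ {ω | C + D < f n ω + g n ω} ≤ μ ({ω | C < f n ω} ∪ {ω | D < g n ω}) := by
        refine measure_mono fun ω h => ?_
        by_contra h'
        simp only [Set.mem_union, Set.mem_ofPred_eq, not_or, not_lt] at h h'
        linarith
    _ ≤ ε / 2 + ε / 2 := (measure_union_le _ _).trans (add_le_add h1 h2)
    _ = ε := ENNReal.add_halves ε

theorem tight_zero : Tight μ fun _ _ => 0 := fun ε _ => ⟨0, by simp⟩

theorem Tight.sum {ι : Type*} {s : Finset ι} {f : ι → ℕ → Ω → ℝ} (h : ∀ i ∈ s, Tight μ (f i)) :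
    Tight μ fun n ω => ∑ i ∈ s, f i n ω := by
  classical
  induction s using Finset.induction_on with
  | empty => simpa using tight_zero
  | insert a s ha ih =>
    simp only [Finset.sum_insert ha]
    exact (h a (by simp)).add (ih fun i hi => h i (by simp [hi]))

/-- To prove a limit in probability it is enough to prove the limit along every finer filter along
which a given tight sequence is bounded. -/
theorem tendsto_whp_of_tight {f : ℕ → Ω → ℝ} (hf : Tight μ f) {R : ℕ × Ω → ℝ} {c : ℝ}
    (h : ∀ l ≤ whp μ, (∃ C, ∀ᶠ p in l, f p.1 p.2 ≤ C) → Tendsto R l (𝓝 c)) :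
    Tendsto R (whp μ) (𝓝 c) := by
  intro U hU
  rw [mem_map]
  change Tendsto (fun n => μ {ω | (n, ω) ∉ R ⁻¹' U}) atTop (𝓝 0)
  rw [ENNReal.tendsto_nhds_zero]
  intro ε hε
  obtain ⟨C, hC⟩ := hf (ε / 2) (ENNReal.half_pos hε.ne')
  -- The finer filter is `whp` restricted to the event `f ≤ C`. What holds eventually along it holds
  -- with probability tending to one on that event, and the complement of the event has probability
  -- at most `ε / 2`.
  have h1 := h (whp μ ⊓ 𝓟 {p | f p.1 p.2 ≤ C}) inf_le_left
    ⟨C, mem_inf_of_right (mem_principal_self _)⟩ hU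
  rw [mem_map, mem_inf_principal] at h1
  have h2 : Tendsto (fun n => μ {ω | ¬ (f n ω ≤ C → R (n, ω) ∈ U)}) atTop (𝓝 0) := h1
  rw [ENNReal.tendsto_nhds_zero] at h2
  filter_upwards [hC, h2 (ε / 2) (ENNReal.half_pos hε.ne')] with n h3 h4
  calc μ {ω | (n, ω) ∉ R ⁻¹' U}
      ≤ μ ({ω | C < f n ω} ∪ {ω | ¬ (f n ω ≤ C → R (n, ω) ∈ U)}) := by
        refine measure_mono fun ω h => ?_
        by_contra h'
        simp only [Set.mem_union, Set.mem_ofPred_eq, not_or, not_lt, not_not] at h h'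
        exact h (h'.2 h'.1)
    _ ≤ ε / 2 + ε / 2 := (measure_union_le _ _).trans (add_le_add h3 h4)
    _ = ε := ENNReal.add_halves ε

end Filter

/-! ### Independent samples -/

/-- The average of the first `n` terms. -/
noncomputable def avg (n : ℕ) (f : ℕ → ℝ) : ℝ := (∑ j ∈ Finset.range n, f j) / n

theorem avg_mono {n : ℕ} {f g : ℕ → ℝ} (h : ∀ j < n, f j ≤ g j) : avg n f ≤ avg n g := by
  unfold avg
  gcongr with j hj
  exact h j (Finset.mem_range.1 hj)

theorem avg_nonneg {n : ℕ} {f : ℕ → ℝ} (h : ∀ j < n, 0 ≤ f j) : 0 ≤ avg n f :=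
  div_nonneg (Finset.sum_nonneg fun j hj => h j (Finset.mem_range.1 hj)) (Nat.cast_nonneg n)

theorem abs_avg_le (n : ℕ) (f : ℕ → ℝ) : |avg n f| ≤ avg n fun j => |f j| := by
  unfold avg
  rw [abs_div, Nat.abs_cast]
  gcongr
  exact Finset.abs_sum_le_sum_abs _ _

theorem avg_add (n : ℕ) (f g : ℕ → ℝ) : avg n (fun j => f j + g j) = avg n f + avg n g := by
  simp only [avg, Finset.sum_add_distrib, add_div]

theorem avg_sub (n : ℕ) (f g : ℕ → ℝ) : avg n (fun j => f j - g j) = avg n f - avg n g := by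
  simp only [avg, Finset.sum_sub_distrib, sub_div]

theorem avg_const_mul (n : ℕ) (c : ℝ) (f : ℕ → ℝ) : avg n (fun j => c * f j) = c * avg n f := by
  simp only [avg, ← Finset.mul_sum, mul_div_assoc]

theorem avg_const {n : ℕ} (hn : n ≠ 0) (c : ℝ) : avg n (fun _ => c) = c := by
  have : (n : ℝ) ≠ 0 := Nat.cast_ne_zero.2 hn
  simp only [avg, Finset.sum_const, Finset.card_range, nsmul_eq_mul]
  field_simp

theorem exists_integral_tail_lt {X : Type*} [MeasurableSpace X] {P : Measure X} {h : X → ℝ}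
    (hh : Integrable h P) {ε : ℝ}
    (hε : 0 < ε) : ∃ K : ℕ, ∫ x, (if (K : ℝ) < |h x| then |h x| else 0) ∂P < ε := by
  have hmeas : ∀ K : ℕ, Measurable fun x : ℝ => if (K : ℝ) < |x| then |x| else 0 := fun K =>
    Measurable.ite (measurableSet_lt measurable_const measurable_norm) measurable_norm
      measurable_const
  have h1 : Tendsto (fun K : ℕ => ∫ x, (if (K : ℝ) < |h x| then |h x| else 0) ∂P) atTop
      (𝓝 (∫ _, (0 : ℝ) ∂P)) := by
    refine tendsto_integral_of_dominated_convergence (fun x => |h x|) ?_ hh.abs ?_ ?_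
    · exact fun K => ((hmeas K).comp_aemeasurable hh.1.aemeasurable).aestronglyMeasurable
    · intro K
      refine ae_of_all _ fun x => ?_
      split_ifs <;> simp
    · refine ae_of_all _ fun x => ?_
      refine tendsto_const_nhds.congr' ?_
      filter_upwards [eventually_ge_atTop ⌈|h x|⌉₊] with K hK
      rw [if_neg]
      exact not_lt.2 ((Nat.le_ceil _).trans (Nat.cast_le.2 hK))
  rw [integral_zero] at h1
  exact (h1.eventually (gt_mem_nhds hε)).exists

theorem integrable_tail {X : Type*} [MeasurableSpace X] {P : Measure X} {h : X → ℝ}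
    (hh : Integrable h P) (K : ℝ) :
    Integrable (fun x => if K < |h x| then |h x| else 0) P := by
  have hmeas : Measurable fun x : ℝ => if K < |x| then |x| else 0 :=
    Measurable.ite (measurableSet_lt measurable_const measurable_norm) measurable_norm
      measurable_const
  refine hh.mono (hmeas.comp_aemeasurable hh.1.aemeasurable).aestronglyMeasurable ?_
  refine ae_of_all _ fun x => ?_
  split_ifs <;> simp

/-- An i.i.d. sequence with common law `P`. -/
structure IsIIDSample {Ω X : Type*} [MeasurableSpace Ω] [MeasurableSpace X] (μ : Measure Ω)
    (P : Measure X) (Z : ℕ → Ω → X) : Prop where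
  meas : ∀ j, Measurable (Z j)
  law : ∀ j, μ.map (Z j) = P
  indep : iIndepFun Z μ

section Sample

variable {Ω X : Type*} [MeasurableSpace Ω] [MeasurableSpace X] {μ : Measure Ω}
  {P : Measure X} {Z : ℕ → Ω → X}

theorem IsIIDSample.ae (h : IsIIDSample μ P Z) {Q : X → Prop} (hQ : ∀ᵐ x ∂P, Q x) :
    ∀ᵐ ω ∂μ, ∀ j, Q (Z j ω) := by
  rw [ae_all_iff]
  intro j
  have h1 := hQ
  rw [← h.law j] at h1
  exact ae_of_ae_map (h.meas j).aemeasurable h1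

theorem IsIIDSample.eventually (h : IsIIDSample μ P Z) {Q : X → Prop} (hQ : ∀ᵐ x ∂P, Q x) :
    ∀ᶠ p in whp μ, ∀ j, Q (Z j p.2) :=
  eventually_whp_of_ae (Q := fun _ ω => ∀ j, Q (Z j ω)) fun _ => h.ae hQ

theorem IsIIDSample.identDistrib (h : IsIIDSample μ P Z) {g : X → ℝ} (hg : Measurable g)
    (i j : ℕ) : IdentDistrib (fun ω => g (Z i ω)) (fun ω => g (Z j ω)) μ μ :=
  IdentDistrib.comp (u := g) ⟨(h.meas i).aemeasurable, (h.meas j).aemeasurable,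
    (h.law i).trans (h.law j).symm⟩ hg

theorem IsIIDSample.indepFun (h : IsIIDSample μ P Z) {g : X → ℝ} (hg : Measurable g)
    {i j : ℕ} (hij : i ≠ j) : IndepFun (fun ω => g (Z i ω)) (fun ω => g (Z j ω)) μ :=
  (h.indep.indepFun hij).comp hg hg

theorem IsIIDSample.integral_eq (h : IsIIDSample μ P Z) {g : X → ℝ} (hg : Measurable g) (j : ℕ) :
    ∫ ω, g (Z j ω) ∂μ = ∫ x, g x ∂P := by
  rw [← h.law j, integral_map (h.meas j).aemeasurable hg.aestronglyMeasurable]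

variable [IsProbabilityMeasure μ]

theorem IsIIDSample.lln (h : IsIIDSample μ P Z) {g : X → ℝ} (hg : Integrable g P) :
    Tendsto (fun p : ℕ × Ω => avg p.1 fun j => g (Z j p.2)) (whp μ) (𝓝 (∫ x, g x ∂P)) := by
  rw [tendsto_whp_iff (f := fun n ω => avg n fun j => g (Z j ω))]
  -- Composition with the sample preserves independence and identity of laws for measurable
  -- functions, so `g` is replaced by a measurable version; the two agree at all sample points
  -- almost surely.
  have hmk := hg.1.stronglyMeasurable_mk.measurable
  have hint : ∀ j, Integrable (fun ω => hg.1.mk g (Z j ω)) μ := by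
    intro j
    refine Integrable.comp_measurable (f := Z j) (g := hg.1.mk g) ?_ (h.meas j)
    rw [h.law j]
    exact hg.congr hg.1.ae_eq_mk
  refine tendstoInMeasure_of_tendsto_ae ?_ ?_
  · intro n
    refine AEMeasurable.aestronglyMeasurable ?_
    simp only [avg]
    refine AEMeasurable.div_const ?_ _
    refine Finset.aemeasurable_fun_sum _ fun j _ => ?_
    refine AEMeasurable.comp_aemeasurable (g := g) ?_ (h.meas j).aemeasurable
    rw [h.law j]
    exact hg.1.aemeasurable
  · have h1 := strong_law_ae_real (μ := μ) (fun j ω => hg.1.mk g (Z j ω)) (hint 0)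
      (fun i j hij => h.indepFun hmk hij) (fun i => h.identDistrib hmk i 0)
    have h2 : ∫ ω, hg.1.mk g (Z 0 ω) ∂μ = ∫ x, g x ∂P := by
      rw [integral_congr_ae hg.1.ae_eq_mk, h.integral_eq hmk]
    filter_upwards [h1, h.ae hg.1.ae_eq_mk] with ω h3 h4
    simp only [avg, h4, ← h2]
    exact h3

theorem IsIIDSample.exists_mem (h : IsIIDSample μ P Z) [IsFiniteMeasure P] {A : Set X}
    (hA : MeasurableSet A) (hpos : P A ≠ 0) : ∀ᶠ p in whp μ, ∃ j < p.1, Z j p.2 ∈ A := by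
  have hi : Integrable (A.indicator fun _ => (1 : ℝ)) P := (integrable_const 1).indicator hA
  have h1 := h.lln hi
  rw [integral_indicator_const _ hA] at h1
  have h2 : 0 < P.real A • (1 : ℝ) := by
    simp only [smul_eq_mul, mul_one]
    exact ENNReal.toReal_pos hpos (measure_ne_top _ _)
  filter_upwards [h1.eventually (lt_mem_nhds h2)] with p hp
  by_contra hcon
  push Not at hcon
  rw [avg, Finset.sum_eq_zero] at hp
  · simp at hp
  · intro j hj
    exact Set.indicator_of_notMem (hcon j (Finset.mem_range.1 hj)) _

/-- The maximum of `n` copies of an integrable variable is `o(n)`. -/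
theorem IsIIDSample.max_le (h : IsIIDSample μ P Z) {g : X → ℝ} (hg : Integrable g P) {ε : ℝ}
    (hε : 0 < ε) : ∀ᶠ p in whp μ, ∀ j < p.1, |g (Z j p.2)| ≤ ε * p.1 := by
  -- A value below the truncation level `K` is at most `(ε / 2) n` for large `n`. A value above it
  -- is one term of the sum of the tails, which is below `(ε / 2) n` by the law of large numbers.
  obtain ⟨K, hK⟩ := exists_integral_tail_lt hg (half_pos hε)
  have hn : Tendsto (fun p : ℕ × Ω => (p.1 : ℝ)) (whp μ) atTop :=
    tendsto_natCast_atTop_atTop.comp tendsto_fst_whp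
  filter_upwards [(h.lln (integrable_tail hg K)).eventually (gt_mem_nhds hK),
    hn.eventually_ge_atTop (K / (ε / 2)), hn.eventually_gt_atTop 0] with p h1 h2 h3 j hj
  rw [div_le_iff₀ (half_pos hε)] at h2
  rw [avg, div_lt_iff₀ h3] at h1
  by_cases hc : (K : ℝ) < |g (Z j p.2)|
  · have h4 := Finset.single_le_sum
      (f := fun j => if (K : ℝ) < |g (Z j p.2)| then |g (Z j p.2)| else 0)
      (fun i _ => by split_ifs <;> simp) (Finset.mem_range.2 hj)
    simp only [if_pos hc] at h4
    nlinarith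
  · push Not at hc
    nlinarith

/-- The maximum of `n` copies of a square-integrable variable is `o(√n)`. -/
theorem IsIIDSample.max_le_sqrt (h : IsIIDSample μ P Z) {g : X → ℝ} (hg : MemLp g 2 P) {ε : ℝ}
    (hε : 0 < ε) : ∀ᶠ p in whp μ, ∀ j < p.1, |g (Z j p.2)| ≤ ε * √(p.1 : ℝ) := by
  filter_upwards [h.max_le hg.integrable_sq (sq_pos_of_pos hε)] with p hp j hj
  have h1 := hp j hj
  rw [abs_of_nonneg (sq_nonneg _)] at h1
  refine abs_le_of_sq_le_sq ?_ (by positivity)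
  rw [mul_pow, Real.sq_sqrt (Nat.cast_nonneg _)]
  exact h1

/-- Chebyshev's inequality: the variance of the sum is `n` times that of one term. -/
theorem IsIIDSample.tight_sum (h : IsIIDSample μ P Z) {g : X → ℝ} (hg : MemLp g 2 P)
    (h0 : ∫ x, g x ∂P = 0) :
    Tight μ fun n ω => |∑ j ∈ Finset.range n, g (Z j ω)| / √(n : ℝ) := by
  have hmk := hg.1.stronglyMeasurable_mk.measurable
  set G := hg.1.mk g with hG
  have hGL : MemLp G 2 P := hg.ae_eq hg.1.ae_eq_mk
  have hL : ∀ j, MemLp (fun ω => G (Z j ω)) 2 μ := by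
    intro j
    refine MemLp.comp_measurePreserving hGL ⟨h.meas j, h.law j⟩
  have hint : ∀ j, ∫ ω, G (Z j ω) ∂μ = 0 := by
    intro j
    rw [← h0, integral_congr_ae hg.1.ae_eq_mk, h.integral_eq hmk]
  have hvar : ∀ n : ℕ, variance (∑ j ∈ Finset.range n, fun ω => G (Z j ω)) μ =
      n * variance (fun ω => G (Z 0 ω)) μ := by
    intro n
    rw [IndepFun.variance_sum (fun i _ => hL i) fun i _ j _ hij => h.indepFun hmk hij]
    rw [Finset.sum_congr rfl fun j _ => (h.identDistrib hmk j 0).variance_eq]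
    simp
  set V := variance (fun ω => G (Z 0 ω)) μ
  have hV : 0 ≤ V := variance_nonneg _ _
  intro ε hε
  obtain ⟨δ, hδ0, hδ⟩ : ∃ δ : ℝ, 0 < δ ∧ ENNReal.ofReal δ ≤ ε := by
    rcases eq_or_ne ε ⊤ with rfl | htop
    · exact ⟨1, one_pos, le_top⟩
    · exact ⟨ε.toReal, ENNReal.toReal_pos hε.ne' htop, ENNReal.ofReal_toReal_le⟩
  -- Chebyshev needs `V / C ^ 2 ≤ δ`; the added `1` keeps the threshold positive when `V = 0`.
  refine ⟨√(V / δ) + 1, ?_⟩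
  filter_upwards [eventually_gt_atTop 0] with n hn
  have hn' : (0 : ℝ) < n := Nat.cast_pos.2 hn
  have hc : 0 < (√(V / δ) + 1) * √(n : ℝ) := by positivity
  have hch := meas_ge_le_variance_div_sq (μ := μ)
    (memLp_finsetSum' (Finset.range n) fun j _ => hL j) hc
  have hE : ∫ ω, (∑ j ∈ Finset.range n, fun ω => G (Z j ω)) ω ∂μ = 0 := by
    simp only [Finset.sum_apply]
    rw [integral_finsetSum _ fun j _ => (hL j).integrable (by norm_num)]
    exact Finset.sum_eq_zero fun j _ => hint j
  rw [hE, hvar] at hch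
  refine (measure_mono_ae ?_).trans (hch.trans ((ENNReal.ofReal_le_ofReal ?_).trans hδ))
  · filter_upwards [h.ae hg.1.ae_eq_mk] with ω hω hlt
    change _ < _ at hlt
    change _ ≤ _
    rw [lt_div_iff₀ (by positivity)] at hlt
    simp only [Finset.sum_apply, sub_zero]
    rw [Finset.sum_congr rfl fun j _ => hω j] at hlt
    exact hlt.le
  · rw [mul_pow, Real.sq_sqrt hn'.le, mul_comm, mul_div_mul_right _ _ hn'.ne', div_le_iff₀
      (by positivity)]
    have h1 : V / δ ≤ (√(V / δ) + 1) ^ 2 := by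
      have h2 := Real.sq_sqrt (div_nonneg hV hδ0.le)
      have h3 := Real.sqrt_nonneg (V / δ)
      nlinarith
    rw [div_le_iff₀ hδ0] at h1
    linarith

end Sample

end PELCausal

namespace PELCausal

/-! ### Ignorable treatment assignment -/

section Population

variable {d q : ℕ}

theorem measurable_trt : Measurable (trt : Obs d → Bool) := measurable_snd.fst

theorem measurable_y1 : Measurable (y1 : Obs d → ℝ) := measurable_snd.snd.fst

theorem measurable_y0 : Measurable (y0 : Obs d → ℝ) := measurable_snd.snd.snd

theorem measurable_trtInd : Measurable (trtInd : Obs d → ℝ) :=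
  Measurable.ite (measurable_trt (measurableSet_singleton true)) measurable_const measurable_const

theorem trtInd_nonneg (z : Obs d) : 0 ≤ trtInd z := by
  unfold trtInd; split_ifs <;> simp

theorem trtInd_le_one (z : Obs d) : trtInd z ≤ 1 := by
  unfold trtInd; split_ifs <;> simp

theorem abs_trtInd_le_one (z : Obs d) : |trtInd z| ≤ 1 := by
  rw [abs_of_nonneg (trtInd_nonneg z)]
  exact trtInd_le_one z

theorem integrable_trtInd_mul {P : Measure (Obs d)} {f : Obs d → ℝ} (hf : Integrable f P) :
    Integrable (fun z => trtInd z * f z) P :=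
  hf.bdd_mul measurable_trtInd.aestronglyMeasurable (ae_of_all _ fun z => abs_trtInd_le_one z)

/-- The covariates and the potential outcomes. -/
def covOut (z : Obs d) : EuclideanSpace ℝ (Fin d) × ℝ × ℝ := (cov z, y1 z, y0 z)

theorem measurable_covOut : Measurable (covOut : Obs d → _) :=
  measurable_cov.prodMk (measurable_y1.prodMk measurable_y0)

variable {P : Measure (Obs d)} [IsProbabilityMeasure P]

theorem integrable_trtInd : Integrable (trtInd : Obs d → ℝ) P :=
  Integrable.of_bound measurable_trtInd.aestronglyMeasurable 1
    (ae_of_all _ fun z => abs_trtInd_le_one z)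

/-- Ignorability in terms of conditional laws: the law of `T` given the covariates and the outcomes
does not depend on the outcomes. -/
theorem SITA.condExp_trtInd (h : SITA P) :
    P[trtInd | MeasurableSpace.comap covOut inferInstance] =ᵐ[P] trueScore P := by
  have h1 := (condIndepFun_iff_condDistrib_prod_ae_eq_prodMkRight (μ := P)
    (f := (trt : Obs d → Bool)) (g := fun z : Obs d => (y1 z, y0 z)) measurable_trt
    (measurable_y1.prodMk measurable_y0) measurable_cov).1 (CondIndepFun.symm h)
  set φ : Bool → ℝ := fun b => if b then 1 else 0 with hφ
  have hφm : StronglyMeasurable φ := (measurable_of_countable φ).stronglyMeasurable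
  have h2 := condExp_ae_eq_integral_condDistrib (μ := P) measurable_covOut
    (measurable_trt (d := d)).aemeasurable hφm integrable_trtInd
  have h3 := condExp_ae_eq_integral_condDistrib (μ := P) measurable_cov
    (measurable_trt (d := d)).aemeasurable hφm integrable_trtInd
  have h4 := ae_of_ae_map measurable_covOut.aemeasurable h1
  refine h2.trans (EventuallyEq.trans ?_ h3.symm)
  filter_upwards [h4] with z hz
  change ∫ y, φ y ∂(condDistrib trt (fun z : Obs d => (cov z, y1 z, y0 z)) P) (covOut z) = _
  rw [hz]
  rfl

/-- Conditioning on covariates and outcomes pulls `f` out of the conditional expectation. This is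
how ignorability is used: under an integral, `T` may be exchanged for its score. -/
theorem SITA.integral_trtInd_mul (h : SITA P) {f : EuclideanSpace ℝ (Fin d) × ℝ × ℝ → ℝ}
    (hf : Measurable f) (hi : Integrable (fun z => f (covOut z)) P) :
    ∫ z, trtInd z * f (covOut z) ∂P = ∫ z, trueScore P z * f (covOut z) ∂P := by
  have hm : MeasurableSpace.comap (covOut : Obs d → _) inferInstance ≤
      (inferInstance : MeasurableSpace (Obs d)) := measurable_covOut.comap_le
  have hsm : StronglyMeasurable[MeasurableSpace.comap (covOut : Obs d → _) inferInstance]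
      fun z => f (covOut z) :=
    (hf.comp (comap_measurable covOut)).stronglyMeasurable
  have h1 := condExp_mul_of_stronglyMeasurable_right hsm (integrable_trtInd_mul hi)
    (integrable_trtInd (P := P))
  rw [← integral_condExp hm]
  refine integral_congr_ae (h1.trans ?_)
  filter_upwards [h.condExp_trtInd] with z hz
  simp only [Pi.mul_apply, hz]

theorem SITA.integral_trtInd_mul_cov (h : SITA P) {f : EuclideanSpace ℝ (Fin d) → ℝ}
    (hf : Measurable f) (hi : Integrable (fun z => f (cov z)) P) :
    ∫ z, trtInd z * f (cov z) ∂P = ∫ z, trueScore P z * f (cov z) ∂P :=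
  h.integral_trtInd_mul (f := fun w => f w.1) (hf.comp measurable_fst) hi

theorem trueScore_mem_Icc : ∀ᵐ z ∂P, 0 ≤ trueScore P z ∧ trueScore P z ≤ 1 := by
  have h0 : 0 ≤ᵐ[P] trueScore P := condExp_nonneg (ae_of_all _ trtInd_nonneg)
  have h1 : trueScore P ≤ᵐ[P] P[fun _ => (1 : ℝ) | covSigma d] :=
    condExp_mono integrable_trtInd (integrable_const 1) (ae_of_all _ trtInd_le_one)
  rw [condExp_const (covSigma_le d)] at h1
  filter_upwards [h0, h1] with z hz0 hz1 using ⟨hz0, hz1⟩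

theorem integrable_trueScore_mul {f : Obs d → ℝ} (hf : Integrable f P) :
    Integrable (fun z => trueScore P z * f z) P := by
  refine hf.bdd_mul integrable_condExp.1 (c := 1) ?_
  filter_upwards [trueScore_mem_Icc (P := P)] with z hz
  rw [Real.norm_eq_abs, abs_of_nonneg hz.1]
  exact hz.2

/-- If `T` vanished on `B`, the integral over `B` of the score, which is positive, would be zero.
With its analogue for the controls, this makes the calibration constraints solvable in both arms. -/
theorem SITA.measure_treated_ne_zero (h : SITA P) (hpos : Positivity P)
    {B : Set (EuclideanSpace ℝ (Fin d))} (hB : MeasurableSet B) (h0 : P (cov ⁻¹' B) ≠ 0) :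
    P {z | trt z = true ∧ cov z ∈ B} ≠ 0 := by
  intro hcon
  apply h0
  have hfm : Measurable (B.indicator fun _ => (1 : ℝ)) := measurable_const.indicator hB
  have hi : Integrable (fun z : Obs d => B.indicator (fun _ => (1 : ℝ)) (cov z)) P :=
    (integrable_const (1 : ℝ)).indicator (measurable_cov hB)
  have h1 := h.integral_trtInd_mul_cov hfm hi
  rw [integral_eq_zero_of_ae] at h1
  · have h2 := (integral_eq_zero_iff_of_nonneg_ae ?_ (integrable_trueScore_mul hi)).1 h1.symm
    · have h3 : ∀ᵐ z ∂P, cov z ∉ B := by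
        filter_upwards [h2, hpos] with z hz1 hz2 hzB
        rw [Pi.zero_apply, Set.indicator_of_mem hzB, mul_one] at hz1
        exact hz2.1.ne' hz1
      exact measure_eq_zero_iff_ae_notMem.2 h3
    · filter_upwards [hpos] with z hz
      exact mul_nonneg hz.1.le (Set.indicator_nonneg (fun _ _ => zero_le_one) _)
  · have h3 : ∀ᵐ z ∂P, ¬ (trt z = true ∧ cov z ∈ B) := by
      rw [ae_iff]
      simpa using hcon
    filter_upwards [h3] with z hz
    by_cases hzB : cov z ∈ B
    · have : trtInd z = 0 := by
        unfold trtInd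
        rw [if_neg fun hc => hz ⟨hc, hzB⟩]
      simp [this]
    · simp [Set.indicator_of_notMem hzB]

theorem SITA.measure_control_ne_zero (h : SITA P) (hpos : Positivity P)
    {B : Set (EuclideanSpace ℝ (Fin d))} (hB : MeasurableSet B) (h0 : P (cov ⁻¹' B) ≠ 0) :
    P {z | trt z = false ∧ cov z ∈ B} ≠ 0 := by
  intro hcon
  apply h0
  have hfm : Measurable (B.indicator fun _ => (1 : ℝ)) := measurable_const.indicator hB
  have hi : Integrable (fun z : Obs d => B.indicator (fun _ => (1 : ℝ)) (cov z)) P :=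
    (integrable_const (1 : ℝ)).indicator (measurable_cov hB)
  have h1 := h.integral_trtInd_mul_cov hfm hi
  have h3 : ∀ᵐ z ∂P, ¬ (trt z = false ∧ cov z ∈ B) := by
    rw [ae_iff]
    simpa using hcon
  have h5 : ∫ z, (1 - trueScore P z) * B.indicator (fun _ => (1 : ℝ)) (cov z) ∂P = 0 := by
    have h6 : ∀ z, (1 - trueScore P z) * B.indicator (fun _ => (1 : ℝ)) (cov z) =
      B.indicator (fun _ => (1 : ℝ)) (cov z) -
        trueScore P z * B.indicator (fun _ => (1 : ℝ)) (cov z) := fun z => by ring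
    simp only [h6]
    rw [integral_sub hi (integrable_trueScore_mul hi), ← h1, sub_eq_zero]
    refine integral_congr_ae ?_
    filter_upwards [h3] with z hz
    by_cases hzB : cov z ∈ B
    · have : trtInd z = 1 := by
        unfold trtInd
        rw [if_pos]
        by_contra hc
        exact hz ⟨by simpa using hc, hzB⟩
      simp [this]
    · simp [Set.indicator_of_notMem hzB]
  have h2 := (integral_eq_zero_iff_of_nonneg_ae ?_ ?_).1 h5
  · have h7 : ∀ᵐ z ∂P, cov z ∉ B := by
      filter_upwards [h2, hpos] with z hz1 hz2 hzB
      rw [Pi.zero_apply, Set.indicator_of_mem hzB, mul_one] at hz1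
      linarith [hz2.2]
    exact measure_eq_zero_iff_ae_notMem.2 h7
  · filter_upwards [hpos] with z hz
    exact mul_nonneg (by linarith [hz.2]) (Set.indicator_nonneg (fun _ _ => zero_le_one) _)
  · refine (hi.sub (integrable_trueScore_mul hi)).congr (ae_of_all _ fun z => ?_)
    simp only [Pi.sub_apply]
    ring

theorem measurable_fit {m : EuclideanSpace ℝ (Fin d) → EuclideanSpace ℝ (Fin q) → ℝ}
    {β : EuclideanSpace ℝ (Fin q)} (hm : Measurable fun x => m x β) :
    Measurable (fit m β : Obs d → ℝ) :=
  hm.comp measurable_cov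

/-- Under a correct outcome regression model, the residuals of the treated are uncorrelated with
the functions of the covariates. -/
theorem SITA.integral_trtInd_mul_resid (h : SITA P)
    {m : EuclideanSpace ℝ (Fin d) → EuclideanSpace ℝ (Fin q) → ℝ}
    {β : EuclideanSpace ℝ (Fin q)} (hm : Measurable fun x => m x β) (hOR : ORCorrect P m β)
    (hy : Integrable (y1 : Obs d → ℝ) P) (hfit : Integrable (fit m β : Obs d → ℝ) P)
    {g : EuclideanSpace ℝ (Fin d) → ℝ} (hg : Measurable g)
    (hi : Integrable (fun z => (y1 z - fit m β z) * g (cov z)) P) :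
    ∫ z, trtInd z * ((y1 z - fit m β z) * g (cov z)) ∂P = 0 := by
  have h1 := h.integral_trtInd_mul (f := fun w => (w.2.1 - m w.1 β) * g w.1)
    ((measurable_snd.fst.sub (hm.comp measurable_fst)).mul (hg.comp measurable_fst)) hi
  refine h1.trans ?_
  have hgm : StronglyMeasurable[covSigma d] fun z : Obs d => g (cov z) :=
    (hg.comp (comap_measurable cov)).stronglyMeasurable
  -- Score times `g` is a function of the covariates, so it comes out of the conditional expectation
  -- and multiplies that of the residual, which is zero.
  have hk : StronglyMeasurable[covSigma d] fun z => trueScore P z * g (cov z) :=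
    stronglyMeasurable_condExp.mul hgm
  have hi2 : Integrable ((fun z => trueScore P z * g (cov z)) * fun z => y1 z - fit m β z) P := by
    refine (integrable_trueScore_mul hi).congr (ae_of_all _ fun z => ?_)
    simp only [Pi.mul_apply]
    ring
  have h2 := condExp_mul_of_stronglyMeasurable_left hk hi2 (hy.sub hfit)
  have h3 : P[fun z => y1 z - fit m β z | covSigma d] =ᵐ[P] 0 := by
    have hfm : StronglyMeasurable[covSigma d] (fit m β : Obs d → ℝ) :=
      (hm.comp (comap_measurable cov)).stronglyMeasurable
    refine (condExp_sub hy hfit _).trans ?_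
    rw [condExp_of_stronglyMeasurable (covSigma_le d) hfm hfit]
    filter_upwards [hOR] with z hz
    simp [hz]
  calc ∫ z, trueScore P z * ((y1 z - fit m β z) * g (cov z)) ∂P
      = ∫ z, ((fun z => trueScore P z * g (cov z)) * fun z => y1 z - fit m β z) z ∂P := by
        refine integral_congr_ae (ae_of_all _ fun z => ?_)
        simp only [Pi.mul_apply]
        ring
    _ = 0 := by
        rw [← integral_condExp (covSigma_le d)]
        refine integral_eq_zero_of_ae (h2.trans ?_)
        filter_upwards [h3] with z hz
        simp only [Pi.mul_apply, hz, Pi.zero_apply, mul_zero]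

end Population

end PELCausal

namespace PELCausal

/-! ### The logistic log-likelihood -/

theorem hasDerivAt_softplus (t s : ℝ) :
    HasDerivAt (fun s => Real.log (1 + Real.exp (t + s)))
      (Real.exp (t + s) / (1 + Real.exp (t + s))) s := by
  have h1 : HasDerivAt (fun s => 1 + Real.exp (t + s)) (Real.exp (t + s)) s := by
    have := ((hasDerivAt_id s).const_add t).exp.const_add 1
    simpa using this
  exact h1.log (by positivity)

/-- Second-order bounds for `log (1 + exp)`, proved by comparing derivatives in `s`. The lower bound
is quadratic near zero but only linear far away, which is what holds without any bound on the
increment of the linear predictor. -/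
theorem softplus_bounds_of_nonneg (t : ℝ) {s : ℝ} (hs : 0 ≤ s) :
    Real.exp t / (1 + Real.exp t) * (1 - Real.exp t / (1 + Real.exp t)) / 2 *
        (s ^ 2 / (1 + s)) ≤
      Real.log (1 + Real.exp (t + s)) - Real.log (1 + Real.exp t) -
        Real.exp t / (1 + Real.exp t) * s ∧
    Real.log (1 + Real.exp (t + s)) - Real.log (1 + Real.exp t) -
        Real.exp t / (1 + Real.exp t) * s ≤ s ^ 2 / 2 := by
  set σ := Real.exp t / (1 + Real.exp t) with hσ
  have hE := Real.exp_pos t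
  have hdiff : ∀ s : ℝ, Real.exp (t + s) / (1 + Real.exp (t + s)) - σ =
      Real.exp t * (Real.exp s - 1) / ((1 + Real.exp t * Real.exp s) * (1 + Real.exp t)) := by
    intro s
    have he := Real.exp_pos s
    rw [Real.exp_add, hσ]
    field_simp
    ring
  have hG : ∀ s : ℝ, HasDerivAt (fun s => Real.log (1 + Real.exp (t + s)) -
      Real.log (1 + Real.exp t) - σ * s) (Real.exp (t + s) / (1 + Real.exp (t + s)) - σ) s := by
    intro s
    have := ((hasDerivAt_softplus t s).sub_const (Real.log (1 + Real.exp t))).fun_sub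
      ((hasDerivAt_id s).const_mul σ)
    simpa using this
  constructor
  · have hk : ∀ s : ℝ, 0 < 1 + s → HasDerivAt (fun s => σ * (1 - σ) / 2 * (s ^ 2 / (1 + s)))
        (σ * (1 - σ) / 2 * ((2 * s * (1 + s) - s ^ 2 * 1) / (1 + s) ^ 2)) s := by
      intro s hs
      refine HasDerivAt.const_mul _ (HasDerivAt.div ?_ ?_ hs.ne')
      · simpa using hasDerivAt_pow 2 s
      · exact (hasDerivAt_id s).const_add 1
    have hmono : MonotoneOn (fun s => Real.log (1 + Real.exp (t + s)) -
        Real.log (1 + Real.exp t) - σ * s - σ * (1 - σ) / 2 * (s ^ 2 / (1 + s))) (Set.Ici 0) := by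
      refine monotoneOn_of_hasDerivWithinAt_nonneg (convex_Ici 0)
        (f' := fun s => Real.exp (t + s) / (1 + Real.exp (t + s)) - σ -
          σ * (1 - σ) / 2 * ((2 * s * (1 + s) - s ^ 2 * 1) / (1 + s) ^ 2)) ?_ ?_ ?_
      · intro s hs
        have hs' : 0 < 1 + s := by have : (0 : ℝ) ≤ s := hs; linarith
        exact ((hG s).sub (hk s hs')).continuousAt.continuousWithinAt
      · intro s hs
        rw [interior_Ici] at hs
        have hs' : 0 < 1 + s := by have : (0 : ℝ) < s := hs; linarith
        exact ((hG s).sub (hk s hs')).hasDerivWithinAt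
      · intro s hs
        rw [interior_Ici] at hs
        have hs' : (0 : ℝ) < s := hs
        have he : s + 1 ≤ Real.exp s := Real.add_one_le_exp s
        rw [hdiff, sub_nonneg]
        set e := Real.exp s
        set E := Real.exp t
        have h1 : σ * (1 - σ) = E / (1 + E) ^ 2 := by
          rw [hσ]; field_simp; ring
        rw [h1]
        -- The derivative of `s ^ 2 / (1 + s)` is at most `2 s / (1 + s)`, and `exp s ≥ 1 + s` then
        -- compares with the increment of the logistic function.
        calc E / (1 + E) ^ 2 / 2 * ((2 * s * (1 + s) - s ^ 2 * 1) / (1 + s) ^ 2)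
            ≤ E / (1 + E) ^ 2 * (s / (1 + s)) := by
              rw [div_div, div_mul_div_comm, div_mul_div_comm, div_le_div_iff₀ (by positivity)
                (by positivity)]
              have : 0 ≤ E * (1 + E) ^ 2 * (1 + s) * s ^ 2 := by positivity
              nlinarith
          _ ≤ E * (e - 1) / ((1 + E * e) * (1 + E)) := by
              rw [div_mul_div_comm, div_le_div_iff₀ (by positivity) (by positivity)]
              have h2 : s * (1 + E * e) ≤ (e - 1) * (1 + E) * (1 + s) := by
                nlinarith [mul_nonneg hE.le (by linarith : (0:ℝ) ≤ e - s - 1)]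
              have h3 : 0 < E * (1 + E) := by positivity
              nlinarith
    have h := hmono (Set.mem_Ici.2 le_rfl) (Set.mem_Ici.2 hs) hs
    simp only [add_zero, sub_self, mul_zero, ne_eq, OfNat.ofNat_ne_zero, not_false_eq_true,
      zero_pow, zero_div] at h
    linarith
  · have hmono : MonotoneOn (fun s => s ^ 2 / 2 - (Real.log (1 + Real.exp (t + s)) -
        Real.log (1 + Real.exp t) - σ * s)) (Set.Ici 0) := by
      have hk : ∀ s : ℝ, HasDerivAt (fun s : ℝ => s ^ 2 / 2) s s := by
        intro s
        simpa using (hasDerivAt_pow 2 s).div_const 2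
      refine monotoneOn_of_hasDerivWithinAt_nonneg (convex_Ici 0)
        (f' := fun s => s - (Real.exp (t + s) / (1 + Real.exp (t + s)) - σ)) ?_ ?_ ?_
      · intro s _
        exact ((hk s).sub (hG s)).continuousAt.continuousWithinAt
      · intro s _
        exact ((hk s).sub (hG s)).hasDerivWithinAt
      · intro s hs
        rw [interior_Ici] at hs
        have hs' : (0 : ℝ) < s := hs
        have he : 1 - s ≤ Real.exp (-s) := by linarith [Real.add_one_le_exp (-s)]
        have hee : Real.exp (-s) * Real.exp s = 1 := by rw [← Real.exp_add]; simp
        have hepos := Real.exp_pos s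
        rw [hdiff, sub_nonneg]
        set e := Real.exp s
        set E := Real.exp t
        rw [div_le_iff₀ (by positivity)]
        have h1 : e - 1 ≤ s * e := by nlinarith
        have h2 : 0 ≤ s * (1 + E + E * E * e) := by positivity
        nlinarith [mul_le_mul_of_nonneg_left h1 hE.le]
    have h := hmono (Set.mem_Ici.2 le_rfl) (Set.mem_Ici.2 hs) hs
    simp only [add_zero, sub_self, mul_zero, ne_eq, OfNat.ofNat_ne_zero, not_false_eq_true,
      zero_pow, zero_div] at h
    linarith

theorem log_one_add_exp_neg (t : ℝ) :
    Real.log (1 + Real.exp (-t)) = Real.log (1 + Real.exp t) - t := by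
  have h : 1 + Real.exp (-t) = (1 + Real.exp t) / Real.exp t := by
    rw [Real.exp_neg]
    field_simp
    ring
  rw [h, Real.log_div (by positivity) (by positivity), Real.log_exp]

/-- Negative increments reduce to positive ones by the reflection `t ↦ -t`, which changes the
function by a linear term and leaves `σ (1 - σ)` invariant. -/
theorem softplus_bounds (t s : ℝ) :
    Real.exp t / (1 + Real.exp t) * (1 - Real.exp t / (1 + Real.exp t)) / 2 *
        (s ^ 2 / (1 + |s|)) ≤
      Real.log (1 + Real.exp (t + s)) - Real.log (1 + Real.exp t) -
        Real.exp t / (1 + Real.exp t) * s ∧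
    Real.log (1 + Real.exp (t + s)) - Real.log (1 + Real.exp t) -
        Real.exp t / (1 + Real.exp t) * s ≤ s ^ 2 / 2 := by
  rcases le_total 0 s with hs | hs
  · rw [abs_of_nonneg hs]
    exact softplus_bounds_of_nonneg t hs
  · have h := softplus_bounds_of_nonneg (-t) (neg_nonneg.2 hs)
    have h1 : Real.exp (-t) / (1 + Real.exp (-t)) = 1 - Real.exp t / (1 + Real.exp t) := by
      rw [Real.exp_neg]
      field_simp
      ring
    rw [← neg_add, log_one_add_exp_neg, log_one_add_exp_neg, h1, neg_sq] at h
    rw [abs_of_nonpos hs]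
    constructor
    · refine le_trans (le_of_eq ?_) (h.1.trans (le_of_eq ?_)) <;> ring
    · refine le_trans (le_of_eq ?_) h.2
      ring

variable {d : ℕ}

theorem tau_pos (x : EuclideanSpace ℝ (Fin d)) (α : EuclideanSpace ℝ (Fin (d + 1))) :
    0 < tau x α := by
  unfold tau; positivity

theorem one_sub_tau (x : EuclideanSpace ℝ (Fin d)) (α : EuclideanSpace ℝ (Fin (d + 1))) :
    1 - tau x α = 1 / (1 + Real.exp (inner ℝ (augment x) α)) := by
  unfold tau; field_simp; ring

theorem tau_lt_one (x : EuclideanSpace ℝ (Fin d)) (α : EuclideanSpace ℝ (Fin (d + 1))) :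
    tau x α < 1 := by
  have : 0 < 1 - tau x α := by rw [one_sub_tau]; positivity
  linarith

theorem likTerm_pos (α : EuclideanSpace ℝ (Fin (d + 1))) (z : Obs d) : 0 < likTerm α z := by
  unfold likTerm
  split_ifs
  · exact tau_pos _ _
  · linarith [tau_lt_one (cov z) α]

theorem log_likTerm (α : EuclideanSpace ℝ (Fin (d + 1))) (z : Obs d) :
    Real.log (likTerm α z) = trtInd z * inner ℝ (augment (cov z)) α -
      Real.log (1 + Real.exp (inner ℝ (augment (cov z)) α)) := by
  unfold likTerm trtInd
  split_ifs
  · rw [tau, Real.log_div (by positivity) (by positivity), Real.log_exp, one_mul]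
  · rw [one_sub_tau, Real.log_div one_ne_zero (by positivity), Real.log_one, zero_mul]

/-- Concavity with an explicit modulus; it yields existence and rate of the maximum likelihood
estimator. The companion minorant below serves to show that the score vanishes at a pseudo-true
value. -/
theorem log_likTerm_add_le (α v : EuclideanSpace ℝ (Fin (d + 1))) (z : Obs d) :
    Real.log (likTerm (α + v) z) - Real.log (likTerm α z) ≤
      (trtInd z - tau (cov z) α) * inner ℝ (augment (cov z)) v -
        tau (cov z) α * (1 - tau (cov z) α) / 2 *
          (inner ℝ (augment (cov z)) v ^ 2 / (1 + |inner ℝ (augment (cov z)) v|)) := by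
  have h := (softplus_bounds (inner ℝ (augment (cov z)) α) (inner ℝ (augment (cov z)) v)).1
  rw [log_likTerm, log_likTerm, inner_add_right]
  unfold tau
  linarith

theorem le_log_likTerm_add (α v : EuclideanSpace ℝ (Fin (d + 1))) (z : Obs d) :
    (trtInd z - tau (cov z) α) * inner ℝ (augment (cov z)) v -
        inner ℝ (augment (cov z)) v ^ 2 / 2 ≤
      Real.log (likTerm (α + v) z) - Real.log (likTerm α z) := by
  have h := (softplus_bounds (inner ℝ (augment (cov z)) α) (inner ℝ (augment (cov z)) v)).2
  rw [log_likTerm, log_likTerm, inner_add_right]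
  unfold tau
  linarith

/-- The log-likelihood of the propensity score model over the first `n` subjects. -/
noncomputable def logLik (z : ℕ → Obs d) (n : ℕ) (α : EuclideanSpace ℝ (Fin (d + 1))) : ℝ :=
  ∑ j ∈ Finset.range n, Real.log (likTerm α (z j))

theorem isMLE_iff {z : ℕ → Obs d} {n : ℕ} {α : EuclideanSpace ℝ (Fin (d + 1))} :
    IsMLE z n α ↔ ∀ a, logLik z n a ≤ logLik z n α := by
  have hpos : ∀ a, 0 < ∏ j ∈ Finset.range n, likTerm a (z j) := fun a =>
    Finset.prod_pos fun j _ => likTerm_pos a (z j)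
  have hlog : ∀ a, logLik z n a = Real.log (∏ j ∈ Finset.range n, likTerm a (z j)) := fun a =>
    (Real.log_prod fun j _ => (likTerm_pos a (z j)).ne').symm
  refine forall_congr' fun a => ?_
  rw [hlog, hlog, Real.log_le_log_iff (hpos _) (hpos _)]

theorem continuous_logLik (z : ℕ → Obs d) (n : ℕ) : Continuous (logLik z n) := by
  unfold logLik
  simp only [log_likTerm]
  refine continuous_finsetSum _ fun j _ => ?_
  refine Continuous.sub (by fun_prop) (Continuous.log (by fun_prop) fun α => ?_)
  positivity

theorem logLik_congr {z : ℕ → Obs d} {n : ℕ} {a b : EuclideanSpace ℝ (Fin (d + 1))}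
    (h : ∀ j < n, inner ℝ (augment (cov (z j))) a = inner ℝ (augment (cov (z j))) b) :
    logLik z n a = logLik z n b := by
  refine Finset.sum_congr rfl fun j hj => ?_
  rw [log_likTerm, log_likTerm, h j (Finset.mem_range.1 hj)]

/-- Existence and rate of the maximum likelihood estimator for a sample with bounded score at `α`
and with curvature bounded below on a subspace that contains the design. -/
theorem exists_isMLE_and_bound {z : ℕ → Obs d} {n : ℕ} {α : EuclideanSpace ℝ (Fin (d + 1))}
    {V : Submodule ℝ (EuclideanSpace ℝ (Fin (d + 1)))} {c κ C : ℝ}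
    (hV : ∀ j < n, augment (cov (z j)) ∈ V) (hc : 0 < c) (hκ : 0 < κ) (hC : 0 ≤ C)
    (hτ : ∀ j < n, c ≤ tau (cov (z j)) α * (1 - tau (cov (z j)) α))
    (hQ : ∀ v ∈ V, κ * n * ‖v‖ ^ 2 ≤ ∑ j ∈ Finset.range n,
      inner ℝ (augment (cov (z j))) v ^ 2 / (1 + ‖augment (cov (z j))‖))
    (hS : ∀ v, ∑ j ∈ Finset.range n, (trtInd (z j) - tau (cov (z j)) α) *
      inner ℝ (augment (cov (z j))) v ≤ C * √(n : ℝ) * ‖v‖)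
    (hn : 2 * C / (c * κ) < √(n : ℝ)) :
    (∃ a, IsMLE z n a) ∧ ∀ a, IsMLE z n a → ∃ v : EuclideanSpace ℝ (Fin (d + 1)),
      (∀ j < n, inner ℝ (augment (cov (z j))) a =
        inner ℝ (augment (cov (z j))) α + inner ℝ (augment (cov (z j))) v) ∧
      √(n : ℝ) * ‖v‖ ≤ 2 * C / (c * κ) := by
  have hsn : 0 < √(n : ℝ) := lt_of_le_of_lt (by positivity) hn
  have hnn : √(n : ℝ) * √(n : ℝ) = n := Real.mul_self_sqrt (Nat.cast_nonneg n)
  rw [div_lt_iff₀ (by positivity)] at hn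
  -- Since `1 + |x·v| ≤ (1 + ‖x‖) max 1 ‖v‖`, the size of `v` separates from the design, leaving the
  -- curvature form of `hQ`.
  have hquad : ∀ v ∈ V, logLik z n (α + v) - logLik z n α ≤
      C * √(n : ℝ) * ‖v‖ - c / 2 * (κ * n * ‖v‖ ^ 2) / max 1 ‖v‖ := by
    intro v hv
    unfold logLik
    have h1 : c / 2 * (κ * n * ‖v‖ ^ 2) / max 1 ‖v‖ ≤ ∑ j ∈ Finset.range n,
        tau (cov (z j)) α * (1 - tau (cov (z j)) α) / 2 *
          (inner ℝ (augment (cov (z j))) v ^ 2 / (1 + |inner ℝ (augment (cov (z j))) v|)) := by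
      refine (div_le_div_of_nonneg_right (mul_le_mul_of_nonneg_left (hQ v hv)
        (by positivity)) (by positivity)).trans ?_
      rw [Finset.mul_sum, Finset.sum_div]
      refine Finset.sum_le_sum fun j hj => ?_
      have h2 := hτ j (Finset.mem_range.1 hj)
      set x := augment (cov (z j))
      rw [mul_div_assoc, div_div]
      refine mul_le_mul (by linarith) ?_ (by positivity) (by linarith)
      refine div_le_div_of_nonneg_left (sq_nonneg _) (by positivity) ?_
      have h3 : |inner ℝ x v| ≤ ‖x‖ * ‖v‖ := abs_real_inner_le_norm x v
      have h4 : 1 ≤ max 1 ‖v‖ := le_max_left _ _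
      have h5 : ‖v‖ ≤ max 1 ‖v‖ := le_max_right _ _
      nlinarith [norm_nonneg x]
    have h2 := Finset.sum_le_sum fun j (_ : j ∈ Finset.range n) =>
      log_likTerm_add_le α v (z j)
    simp only [Finset.sum_sub_distrib] at h2
    linarith [hS v]
  -- Outside the unit ball score and curvature terms both grow linearly in `‖v‖`, and the curvature
  -- wins by the lower bound on `√n`. Inside, the quadratic bound gives the rate.
  have hbig : ∀ v ∈ V, 1 < ‖v‖ → logLik z n (α + v) < logLik z n α := by
    intro v hv h1
    have h := hquad v hv
    rw [max_eq_right h1.le] at h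
    have h2 : c / 2 * (κ * n * ‖v‖ ^ 2) / ‖v‖ = c / 2 * κ * n * ‖v‖ := by
      field_simp
    rw [h2] at h
    have h3 : 0 < (√(n : ℝ) * (c * κ) - 2 * C) * (√(n : ℝ) * ‖v‖) := by
      have : 0 < ‖v‖ := by linarith
      have : 0 < √(n : ℝ) * (c * κ) - 2 * C := by linarith
      positivity
    have h4 : (√(n : ℝ) * (c * κ) - 2 * C) * (√(n : ℝ) * ‖v‖) =
        c * κ * n * ‖v‖ - 2 * (C * √(n : ℝ) * ‖v‖) := by
      linear_combination (c * κ * ‖v‖) * hnn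
    nlinarith
  have hsmall : ∀ v ∈ V, logLik z n α ≤ logLik z n (α + v) →
      √(n : ℝ) * ‖v‖ ≤ 2 * C / (c * κ) := by
    intro v hv hle
    rcases lt_or_ge 1 ‖v‖ with h1 | h1
    · exact absurd (hbig v hv h1) (not_lt.2 hle)
    · have h := hquad v hv
      rw [max_eq_left h1, div_one] at h
      rw [le_div_iff₀ (by positivity)]
      by_contra hcon
      push Not at hcon
      have hv0 : 0 < √(n : ℝ) * ‖v‖ := by
        by_contra h0
        push Not at h0
        nlinarith [mul_pos hc hκ]
      have h3 : 0 < (√(n : ℝ) * ‖v‖ * (c * κ) - 2 * C) * (√(n : ℝ) * ‖v‖) :=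
        mul_pos (by linarith) hv0
      have h4 : (√(n : ℝ) * ‖v‖ * (c * κ) - 2 * C) * (√(n : ℝ) * ‖v‖) =
          c * κ * n * ‖v‖ ^ 2 - 2 * (C * √(n : ℝ) * ‖v‖) := by
        linear_combination (c * κ * ‖v‖ ^ 2) * hnn
      nlinarith
  -- The likelihood sees a parameter only through its projection onto `V`, so it suffices to
  -- maximize over the compact unit ball of `V`.
  have hproj : ∀ a, ∀ j < n, inner ℝ (augment (cov (z j))) a =
      inner ℝ (augment (cov (z j))) (α + V.starProjection (a - α)) := by
    intro a j hj
    have h1 := Submodule.inner_right_of_mem_orthogonal (hV j hj)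
      (Submodule.sub_starProjection_mem_orthogonal (K := V) (a - α))
    rw [inner_sub_right, inner_sub_right] at h1
    rw [inner_add_right]
    linarith
  have hmem : ∀ a, V.starProjection a ∈ V := fun a => Submodule.starProjection_apply_mem V a
  constructor
  · have hcomp : IsCompact (Metric.closedBall (0 : EuclideanSpace ℝ (Fin (d + 1))) 1 ∩
        (V : Set (EuclideanSpace ℝ (Fin (d + 1))))) :=
      (isCompact_closedBall _ _).inter_right V.closed_of_finiteDimensional
    obtain ⟨v, hv, hmax⟩ := hcomp.exists_isMaxOn ⟨0, by simp⟩
      ((continuous_logLik z n).comp (continuous_const_add α)).continuousOn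
    refine ⟨α + v, isMLE_iff.2 fun a => ?_⟩
    rw [logLik_congr (hproj a)]
    rcases lt_or_ge 1 ‖V.starProjection (a - α)‖ with h1 | h1
    · refine (hbig _ (hmem _) h1).le.trans ?_
      have h2 := hmax (show (0 : EuclideanSpace ℝ (Fin (d + 1))) ∈ _ by simp)
      simpa using h2
    · exact hmax ⟨by simpa using h1, hmem _⟩
  · intro a ha
    refine ⟨V.starProjection (a - α), fun j hj => ?_, hsmall _ (hmem _) ?_⟩
    · rw [hproj a j hj, inner_add_right]
    · rw [← logLik_congr (hproj a)]
      exact isMLE_iff.1 ha α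

end PELCausal

namespace PELCausal

/-! ### Asymptotics of the maximum likelihood estimator -/

section Design

variable {d : ℕ}

theorem continuous_augment :
    Continuous (augment : EuclideanSpace ℝ (Fin d) → EuclideanSpace ℝ (Fin (d + 1))) := by
  unfold augment
  refine (PiLp.continuous_toLp 2 _).comp (continuous_pi fun i => ?_)
  refine Fin.cases ?_ (fun i => ?_) i
  · simpa using continuous_const
  · simp only [Fin.cons_succ]
    fun_prop

theorem measurable_augment_cov : Measurable fun z : Obs d => augment (cov z) :=
  continuous_augment.measurable.comp measurable_cov

theorem norm_augment_le (x : EuclideanSpace ℝ (Fin d)) : ‖augment x‖ ≤ 1 + ‖x‖ := by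
  have h : ‖augment x‖ ^ 2 = 1 + ‖x‖ ^ 2 := by
    rw [EuclideanSpace.norm_sq_eq, EuclideanSpace.norm_sq_eq, Fin.sum_univ_succ]
    simp [augment]
  refine abs_le_of_sq_le_sq' ?_ (by positivity) |>.2
  rw [h]
  nlinarith [norm_nonneg x]

theorem abs_apply_le_norm {k : ℕ} (v : EuclideanSpace ℝ (Fin k)) (i : Fin k) : |v i| ≤ ‖v‖ :=
  PiLp.norm_apply_le v i

theorem inner_eq_sum {k : ℕ} (x v : EuclideanSpace ℝ (Fin k)) :
    inner ℝ x v = ∑ i, x i * v i := by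
  simp [PiLp.inner_apply, mul_comm]

/-- The normalized size of the score at `α`. -/
noncomputable def scoreSize (z : ℕ → Obs d) (α : EuclideanSpace ℝ (Fin (d + 1))) (n : ℕ) : ℝ :=
  ∑ k, |∑ j ∈ Finset.range n, (trtInd (z j) - tau (cov (z j)) α) *
    inner ℝ (augment (cov (z j))) (EuclideanSpace.single k (1 : ℝ))| / √(n : ℝ)

theorem score_le (z : ℕ → Obs d) (α v : EuclideanSpace ℝ (Fin (d + 1))) {n : ℕ} (hn : 0 < n) :
    ∑ j ∈ Finset.range n, (trtInd (z j) - tau (cov (z j)) α) *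
      inner ℝ (augment (cov (z j))) v ≤ scoreSize z α n * √(n : ℝ) * ‖v‖ := by
  have hs : 0 < √(n : ℝ) := Real.sqrt_pos.2 (Nat.cast_pos.2 hn)
  rw [scoreSize, ← Finset.sum_div, div_mul_cancel₀ _ hs.ne', Finset.sum_mul]
  have h1 : ∀ j, (trtInd (z j) - tau (cov (z j)) α) * inner ℝ (augment (cov (z j))) v =
      ∑ k, v k * ((trtInd (z j) - tau (cov (z j)) α) *
        inner ℝ (augment (cov (z j))) (EuclideanSpace.single k (1 : ℝ))) := by
    intro j
    rw [inner_eq_sum, Finset.mul_sum]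
    refine Finset.sum_congr rfl fun k _ => ?_
    rw [EuclideanSpace.inner_single_right]
    simp
    ring
  simp only [h1]
  rw [Finset.sum_comm]
  refine Finset.sum_le_sum fun k _ => ?_
  rw [← Finset.mul_sum, mul_comm]
  refine (le_abs_self _).trans ?_
  rw [abs_mul]
  gcongr
  exact abs_apply_le_norm v k

variable {P : Measure (Obs d)} [IsProbabilityMeasure P]

theorem memLp_augment (hX : MemLp (cov : Obs d → EuclideanSpace ℝ (Fin d)) 2 P) :
    MemLp (fun z : Obs d => augment (cov z)) 2 P := by
  refine MemLp.mono ((memLp_const (1 : ℝ)).add hX.norm)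
    measurable_augment_cov.aestronglyMeasurable (ae_of_all _ fun z => ?_)
  refine (norm_augment_le _).trans (le_abs_self _)

theorem memLp_norm_augment (hX : MemLp (cov : Obs d → EuclideanSpace ℝ (Fin d)) 2 P) :
    MemLp (fun z : Obs d => ‖augment (cov z)‖) 2 P := (memLp_augment hX).norm

theorem memLp_inner_augment (hX : MemLp (cov : Obs d → EuclideanSpace ℝ (Fin d)) 2 P)
    (v : EuclideanSpace ℝ (Fin (d + 1))) :
    MemLp (fun z : Obs d => inner ℝ (augment (cov z)) v) 2 P := by
  refine MemLp.mono ((memLp_norm_augment hX).const_mul ‖v‖)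
    ((measurable_augment_cov.inner measurable_const).aestronglyMeasurable)
    (ae_of_all _ fun z => ?_)
  rw [Real.norm_eq_abs, Real.norm_eq_abs]
  refine (abs_real_inner_le_norm _ _).trans ((le_of_eq (mul_comm _ _)).trans (le_abs_self _))

theorem measurable_tau (α : EuclideanSpace ℝ (Fin (d + 1))) :
    Measurable fun x : EuclideanSpace ℝ (Fin d) => tau x α := by
  have h : Measurable fun x : EuclideanSpace ℝ (Fin d) => (inner ℝ (augment x) α : ℝ) :=
    (continuous_augment.inner continuous_const).measurable
  unfold tau
  exact h.exp.div (measurable_const.add h.exp)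

/-- The expected score of the propensity score model vanishes at `α`. -/
def ScoreZero (P : Measure (Obs d)) (α : EuclideanSpace ℝ (Fin (d + 1))) : Prop :=
  ∀ v, ∫ z, (trtInd z - tau (cov z) α) * inner ℝ (augment (cov z)) v ∂P = 0

theorem abs_trtInd_sub_tau_le (α : EuclideanSpace ℝ (Fin (d + 1))) (z : Obs d) :
    |trtInd z - tau (cov z) α| ≤ 1 := by
  rw [abs_le]
  constructor <;> linarith [trtInd_nonneg z, trtInd_le_one z, tau_pos (cov z) α,
    tau_lt_one (cov z) α]

theorem memLp_score (hX : MemLp (cov : Obs d → EuclideanSpace ℝ (Fin d)) 2 P)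
    (α v : EuclideanSpace ℝ (Fin (d + 1))) :
    MemLp (fun z => (trtInd z - tau (cov z) α) * inner ℝ (augment (cov z)) v) 2 P := by
  have h := memLp_inner_augment hX v
  refine MemLp.mono h (AEStronglyMeasurable.mul ?_ h.1) (ae_of_all _ fun z => ?_)
  · exact (measurable_trtInd.sub ((measurable_tau α).comp measurable_cov)).aestronglyMeasurable
  · rw [norm_mul]
    exact mul_le_of_le_one_left (norm_nonneg _) (abs_trtInd_sub_tau_le α z)

theorem scoreZero_of_psCorrect (hX : MemLp (cov : Obs d → EuclideanSpace ℝ (Fin d)) 2 P)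
    (hS : SITA P) {α : EuclideanSpace ℝ (Fin (d + 1))} (h : PSCorrect P α) : ScoreZero P α := by
  intro v
  have hi := (memLp_inner_augment hX v).integrable (by norm_num)
  have h1 := hS.integral_trtInd_mul_cov (f := fun x => inner ℝ (augment x) v)
    (continuous_augment.inner continuous_const).measurable hi
  have hi2 : Integrable (fun z => tau (cov z) α * inner ℝ (augment (cov z)) v) P := by
    refine (integrable_trueScore_mul hi).congr ?_
    filter_upwards [h] with z hz
    rw [hz]
  simp only [sub_mul]
  rw [integral_sub (integrable_trtInd_mul hi) hi2, h1, sub_eq_zero]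
  refine integral_congr_ae ?_
  filter_upwards [h] with z hz
  rw [hz]

theorem integrable_log_likTerm (hX : MemLp (cov : Obs d → EuclideanSpace ℝ (Fin d)) 2 P)
    (α : EuclideanSpace ℝ (Fin (d + 1))) : Integrable (fun z => Real.log (likTerm α z)) P := by
  have hi := (memLp_inner_augment hX α).integrable (by norm_num)
  have hm : Measurable fun z : Obs d => (inner ℝ (augment (cov z)) α : ℝ) :=
    measurable_augment_cov.inner measurable_const
  simp only [log_likTerm]
  refine (integrable_trtInd_mul hi).sub ?_
  refine Integrable.mono ((integrable_const (Real.log 2)).add hi.abs)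
    (measurable_const.add hm.exp).log.aestronglyMeasurable (ae_of_all _ fun z => ?_)
  set t : ℝ := inner ℝ (augment (cov z)) α
  have h0 : 0 ≤ Real.log (1 + Real.exp t) := Real.log_nonneg (by linarith [Real.exp_pos t])
  rw [Real.norm_eq_abs, abs_of_nonneg h0]
  refine le_trans ?_ (le_abs_self _)
  have h1 : 1 + Real.exp t ≤ 2 * Real.exp |t| := by
    have := Real.exp_le_exp.2 (le_abs_self t)
    have := Real.one_le_exp (abs_nonneg t)
    linarith
  calc Real.log (1 + Real.exp t) ≤ Real.log (2 * Real.exp |t|) :=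
        Real.log_le_log (by positivity) h1
    _ = Real.log 2 + |t| := by rw [Real.log_mul (by norm_num) (by positivity), Real.log_exp]

/-- Integrating the quadratic minorant of the log-likelihood along `t v` gives `t A ≤ t ^ 2 K` for
all `t`, where `A` is the score in direction `v`; this forces `A = 0` without differentiating under
the integral. -/
theorem scoreZero_of_isPseudoTrue (hX : MemLp (cov : Obs d → EuclideanSpace ℝ (Fin d)) 2 P)
    {α : EuclideanSpace ℝ (Fin (d + 1))} (h : IsPseudoTrue P α) : ScoreZero P α := by
  intro v
  set A := ∫ z, (trtInd z - tau (cov z) α) * inner ℝ (augment (cov z)) v ∂P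
  set K := ∫ z, (inner ℝ (augment (cov z)) v : ℝ) ^ 2 / 2 ∂P
  have hK : Integrable (fun z : Obs d => (inner ℝ (augment (cov z)) v : ℝ) ^ 2 / 2) P :=
    (memLp_inner_augment hX v).integrable_sq.div_const 2
  have hA := (memLp_score hX α v).integrable (by norm_num)
  have key : ∀ t : ℝ, t * A ≤ t ^ 2 * K := by
    intro t
    have h1 : ∫ z, (t * ((trtInd z - tau (cov z) α) * inner ℝ (augment (cov z)) v) -
        t ^ 2 * ((inner ℝ (augment (cov z)) v : ℝ) ^ 2 / 2)) ∂P ≤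
        ∫ z, (Real.log (likTerm (α + t • v) z) - Real.log (likTerm α z)) ∂P := by
      refine integral_mono ((hA.const_mul t).sub (hK.const_mul _))
        ((integrable_log_likTerm hX _).sub (integrable_log_likTerm hX _)) fun z => ?_
      refine le_trans (le_of_eq ?_) (le_log_likTerm_add α (t • v) z)
      rw [inner_smul_right]
      ring
    rw [integral_sub (hA.const_mul t) (hK.const_mul _), integral_const_mul, integral_const_mul,
      integral_sub (integrable_log_likTerm hX _) (integrable_log_likTerm hX _)] at h1
    linarith [h (α + t • v)]
  have hKn : 0 ≤ K := integral_nonneg fun z => by positivity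
  by_contra hne
  -- Near-optimal step; `K + 1` replaces `K`, which may be zero.
  have h1 := key (A / (K + 1))
  have h2 : A / (K + 1) * A - (A / (K + 1)) ^ 2 * K = A ^ 2 / (K + 1) ^ 2 := by
    field_simp
    ring
  have h3 : 0 < A ^ 2 / (K + 1) ^ 2 := by positivity
  linarith

/-- The subspace spanned by the support of the design. -/
theorem exists_design_subspace (P : Measure (Obs d)) :
    ∃ V : Submodule ℝ (EuclideanSpace ℝ (Fin (d + 1))), (∀ᵐ z ∂P, augment (cov z) ∈ V) ∧
      ∀ v ∈ V, (∀ᵐ z ∂P, (inner ℝ (augment (cov z)) v : ℝ) = 0) → v = 0 := by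
  let N : Submodule ℝ (EuclideanSpace ℝ (Fin (d + 1))) :=
    { carrier := {v | ∀ᵐ z ∂P, (inner ℝ (augment (cov z)) v : ℝ) = 0}
      add_mem' := by
        intro a b ha hb
        have h : ∀ᵐ z ∂P, (inner ℝ (augment (cov z)) (a + b) : ℝ) = 0 := by
          filter_upwards [ha, hb] with z h1 h2
          rw [inner_add_right, h1, h2, add_zero]
        exact h
      zero_mem' := ae_of_all _ fun z => inner_zero_right _
      smul_mem' := by
        intro c a ha
        have h : ∀ᵐ z ∂P, (inner ℝ (augment (cov z)) (c • a) : ℝ) = 0 := by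
          filter_upwards [ha] with z h1
          rw [inner_smul_right, h1, mul_zero]
        exact h }
  refine ⟨Nᗮ, ?_, fun v hv h0 => ?_⟩
  -- A finite generating set makes one null set serve for all vectors of `N` at once.
  · obtain ⟨S, hS⟩ := (IsNoetherian.noetherian N : N.FG)
    have h1 : ∀ᵐ z ∂P, ∀ s ∈ S, (inner ℝ (augment (cov z)) s : ℝ) = 0 := by
      rw [Filter.eventually_all_finset]
      intro s hs
      have : s ∈ N := hS ▸ Submodule.subset_span hs
      exact this
    filter_upwards [h1] with z hz
    rw [Submodule.mem_orthogonal]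
    intro u hu
    rw [← hS] at hu
    rw [real_inner_comm]
    induction hu using Submodule.span_induction with
    | mem x hx => exact hz x hx
    | zero => exact inner_zero_right _
    | add x y _ _ hx hy => rw [inner_add_right, hx, hy, add_zero]
    | smul a x _ hx => rw [inner_smul_right, hx, mul_zero]
  · have h1 : v ∈ N := h0
    have h2 := (Submodule.mem_orthogonal N v).1 hv v h1
    exact inner_self_eq_zero.1 h2

/-- The entries of the weighted second moment matrix of the design. -/
noncomputable def gram (z : Obs d) (k l : Fin (d + 1)) : ℝ :=
  augment (cov z) k * augment (cov z) l / (1 + ‖augment (cov z)‖)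

theorem sum_gram (z : Obs d) (v : EuclideanSpace ℝ (Fin (d + 1))) :
    inner ℝ (augment (cov z)) v ^ 2 / (1 + ‖augment (cov z)‖) =
      ∑ k, ∑ l, v k * v l * gram z k l := by
  rw [inner_eq_sum, sq, Finset.sum_mul_sum, Finset.sum_div]
  refine Finset.sum_congr rfl fun k _ => ?_
  rw [Finset.sum_div]
  refine Finset.sum_congr rfl fun l _ => ?_
  unfold gram
  ring

theorem integrable_gram (hX : MemLp (cov : Obs d → EuclideanSpace ℝ (Fin d)) 2 P)
    (k l : Fin (d + 1)) : Integrable (fun z => gram z k l) P := by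
  have hm : ∀ k, Measurable fun z : Obs d => augment (cov z) k := fun k =>
    (by fun_prop : Measurable fun x : EuclideanSpace ℝ (Fin (d + 1)) => x k).comp
      measurable_augment_cov
  refine Integrable.mono ((memLp_norm_augment hX).integrable (by norm_num))
    (((hm k).mul (hm l)).div
      (measurable_const.add measurable_augment_cov.norm)).aestronglyMeasurable
    (ae_of_all _ fun z => ?_)
  rw [Real.norm_eq_abs, Real.norm_eq_abs, abs_of_nonneg (norm_nonneg _), gram, abs_div, abs_mul,
    abs_of_pos (by positivity : 0 < 1 + ‖augment (cov z)‖), div_le_iff₀ (by positivity)]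
  have h1 := abs_apply_le_norm (augment (cov z)) k
  have h2 := abs_apply_le_norm (augment (cov z)) l
  nlinarith [abs_nonneg (augment (cov z) k), abs_nonneg (augment (cov z) l),
    norm_nonneg (augment (cov z))]

variable {Ω : Type*} [MeasurableSpace Ω] {μ : Measure Ω} [IsProbabilityMeasure μ]
  {Z : ℕ → Ω → Obs d}

/-- The population quadratic form is positive definite on `V`, hence at least `κ ‖v‖ ^ 2` by
compactness of the sphere. Convergence of the finitely many Gram entries makes the empirical form
uniformly close, at the price of half of `κ`. Restricting to `V` avoids any identifiability
assumption. -/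
theorem exists_curvature (h : IsIIDSample μ P Z)
    (hX : MemLp (cov : Obs d → EuclideanSpace ℝ (Fin d)) 2 P) :
    ∃ (V : Submodule ℝ (EuclideanSpace ℝ (Fin (d + 1)))) (κ : ℝ), 0 < κ ∧
      (∀ᵐ z ∂P, augment (cov z) ∈ V) ∧
      ∀ᶠ p in whp μ, ∀ v ∈ V, κ * p.1 * ‖v‖ ^ 2 ≤ ∑ j ∈ Finset.range p.1,
        inner ℝ (augment (cov (Z j p.2))) v ^ 2 / (1 + ‖augment (cov (Z j p.2))‖) := by
  obtain ⟨V, hV, hV0⟩ := exists_design_subspace P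
  set q : EuclideanSpace ℝ (Fin (d + 1)) → ℝ := fun v =>
    ∑ k, ∑ l, v k * v l * ∫ z, gram z k l ∂P with hq
  have hqi : ∀ v, q v =
      ∫ z, (inner ℝ (augment (cov z)) v : ℝ) ^ 2 / (1 + ‖augment (cov z)‖) ∂P := by
    intro v
    simp only [sum_gram]
    rw [integral_finsetSum _ fun k _ => integrable_finsetSum _ fun l _ =>
      (integrable_gram hX k l).const_mul _]
    refine Finset.sum_congr rfl fun k _ => ?_
    rw [integral_finsetSum _ fun l _ => (integrable_gram hX k l).const_mul _]
    refine Finset.sum_congr rfl fun l _ => ?_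
    rw [integral_const_mul]
  have hint : ∀ v, Integrable (fun z : Obs d =>
      (inner ℝ (augment (cov z)) v : ℝ) ^ 2 / (1 + ‖augment (cov z)‖)) P := by
    intro v
    simp only [sum_gram]
    exact integrable_finsetSum _ fun k _ => integrable_finsetSum _ fun l _ =>
      (integrable_gram hX k l).const_mul _
  have hqpos : ∀ v ∈ V, v ≠ 0 → 0 < q v := by
    intro v hv hv0
    rw [hqi]
    refine lt_of_le_of_ne (integral_nonneg fun z => by positivity) fun h0 => hv0 (hV0 v hv ?_)
    have h1 := (integral_eq_zero_iff_of_nonneg (fun z => by positivity) (hint v)).1 h0.symm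
    filter_upwards [h1] with z hz
    have h2 : (0 : ℝ) < 1 + ‖augment (cov z)‖ := by positivity
    rw [Pi.zero_apply, div_eq_zero_iff] at hz
    rcases hz with hz | hz
    · exact pow_eq_zero_iff (two_ne_zero) |>.1 hz
    · exact absurd hz h2.ne'
  have hqc : Continuous q := by
    refine continuous_finsetSum _ fun k _ => continuous_finsetSum _ fun l _ => ?_
    fun_prop
  obtain ⟨κ, hκ, hκq⟩ : ∃ κ : ℝ, 0 < κ ∧ ∀ v ∈ V, ‖v‖ = 1 → κ ≤ q v := by
    have hcomp : IsCompact (Metric.sphere (0 : EuclideanSpace ℝ (Fin (d + 1))) 1 ∩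
        (V : Set (EuclideanSpace ℝ (Fin (d + 1))))) :=
      (isCompact_sphere _ _).inter_right V.closed_of_finiteDimensional
    rcases (Metric.sphere (0 : EuclideanSpace ℝ (Fin (d + 1))) 1 ∩
        (V : Set (EuclideanSpace ℝ (Fin (d + 1))))).eq_empty_or_nonempty with he | hne
    · refine ⟨1, one_pos, fun v hv h1 => ?_⟩
      have : v ∈ (∅ : Set (EuclideanSpace ℝ (Fin (d + 1)))) := he ▸ ⟨by simpa using h1, hv⟩
      exact absurd this (Set.notMem_empty v)
    · obtain ⟨v₀, hv₀, hmin⟩ := hcomp.exists_isMinOn hne hqc.continuousOn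
      refine ⟨q v₀, hqpos v₀ hv₀.2 ?_, fun v hv h1 => hmin ⟨by simpa using h1, hv⟩⟩
      rintro rfl
      have := hv₀.1
      simp at this
  have hqhom : ∀ v ∈ V, κ * ‖v‖ ^ 2 ≤ q v := by
    intro v hv
    rcases eq_or_ne v 0 with rfl | hv0
    · simp [hq]
    · have hn : 0 < ‖v‖ := norm_pos_iff.2 hv0
      have h1 := hκq (‖v‖⁻¹ • v) (V.smul_mem _ hv) (by
        rw [norm_smul, norm_inv, norm_norm, inv_mul_cancel₀ hn.ne'])
      have h2 : q (‖v‖⁻¹ • v) = (‖v‖ ^ 2)⁻¹ * q v := by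
        simp only [hq, Finset.mul_sum, PiLp.smul_apply, smul_eq_mul]
        refine Finset.sum_congr rfl fun k _ => Finset.sum_congr rfl fun l _ => ?_
        field_simp
      rw [h2, ← div_eq_inv_mul, le_div_iff₀ (by positivity)] at h1
      exact h1
  refine ⟨V, κ / 2, half_pos hκ, hV, ?_⟩
  have hlim : Tendsto (fun p : ℕ × Ω => ∑ k, ∑ l,
      |(avg p.1 fun j => gram (Z j p.2) k l) - ∫ z, gram z k l ∂P|) (whp μ) (𝓝 0) := by
    have h0 : (0 : ℝ) = ∑ _k : Fin (d + 1), ∑ _l : Fin (d + 1), (0 : ℝ) := by simp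
    rw [h0]
    refine tendsto_finsetSum _ fun k _ => tendsto_finsetSum _ fun l _ => ?_
    have h1 := ((h.lln (integrable_gram hX k l)).sub_const (∫ z, gram z k l ∂P)).abs
    simpa using h1
  filter_upwards [hlim.eventually (gt_mem_nhds (half_pos hκ)),
    tendsto_fst_whp.eventually_gt_atTop 0] with p hp hn v hv
  have hn' : (0 : ℝ) < p.1 := Nat.cast_pos.2 hn
  have h1 : (∑ j ∈ Finset.range p.1, (inner ℝ (augment (cov (Z j p.2))) v : ℝ) ^ 2 /
      (1 + ‖augment (cov (Z j p.2))‖)) / p.1 =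
      ∑ k, ∑ l, v k * v l * avg p.1 fun j => gram (Z j p.2) k l := by
    simp only [sum_gram]
    rw [Finset.sum_comm, Finset.sum_div]
    refine Finset.sum_congr rfl fun k _ => ?_
    rw [Finset.sum_comm, Finset.sum_div]
    refine Finset.sum_congr rfl fun l _ => ?_
    rw [avg, ← Finset.mul_sum, mul_div_assoc]
  have h2 : |(∑ k, ∑ l, v k * v l * avg p.1 fun j => gram (Z j p.2) k l) - q v| ≤
      ‖v‖ ^ 2 * ∑ k, ∑ l, |(avg p.1 fun j => gram (Z j p.2) k l) - ∫ z, gram z k l ∂P| := by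
    rw [hq]
    simp only [← Finset.sum_sub_distrib, Finset.mul_sum]
    refine (Finset.abs_sum_le_sum_abs _ _).trans (Finset.sum_le_sum fun k _ => ?_)
    refine (Finset.abs_sum_le_sum_abs _ _).trans (Finset.sum_le_sum fun l _ => ?_)
    rw [← mul_sub, abs_mul, abs_mul, sq]
    gcongr
    · exact abs_apply_le_norm v k
    · exact abs_apply_le_norm v l
  have h3 := hqhom v hv
  have h4 := (abs_le.1 h2).1
  rw [← h1] at h4
  have h5 : κ / 2 * ‖v‖ ^ 2 ≤ (∑ j ∈ Finset.range p.1,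
      (inner ℝ (augment (cov (Z j p.2))) v : ℝ) ^ 2 / (1 + ‖augment (cov (Z j p.2))‖)) / p.1 := by
    nlinarith [sq_nonneg ‖v‖]
  rw [le_div_iff₀ hn'] at h5
  linarith

theorem tight_scoreSize (h : IsIIDSample μ P Z)
    (hX : MemLp (cov : Obs d → EuclideanSpace ℝ (Fin d)) 2 P)
    {α : EuclideanSpace ℝ (Fin (d + 1))} (hα : ScoreZero P α) :
    Tight μ fun n ω => scoreSize (fun j => Z j ω) α n := by
  have h1 : ∀ k : Fin (d + 1), Tight μ fun n ω =>
      |∑ j ∈ Finset.range n, (trtInd (Z j ω) - tau (cov (Z j ω)) α) *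
        inner ℝ (augment (cov (Z j ω))) (EuclideanSpace.single k (1 : ℝ))| / √(n : ℝ) := fun k =>
    h.tight_sum (g := fun z => (trtInd z - tau (cov z) α) *
      inner ℝ (augment (cov z)) (EuclideanSpace.single k (1 : ℝ))) (memLp_score hX α _) (hα _)
  exact Tight.sum (s := Finset.univ) fun k _ => h1 k

/-- Along a filter on which the score is bounded, the maximum likelihood estimator exists and its
linear predictors agree with those of a parameter at distance `O(n^{-1/2})` from `α`. -/
theorem exists_mle_rate (h : IsIIDSample μ P Z)
    (hX : MemLp (cov : Obs d → EuclideanSpace ℝ (Fin d)) 2 P)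
    {α : EuclideanSpace ℝ (Fin (d + 1))} (hov : Overlap P α)
    {αhat : ℕ → Ω → EuclideanSpace ℝ (Fin (d + 1))}
    (hα : ∀ n ω, (∃ a, IsMLE (fun j => Z j ω) n a) → IsMLE (fun j => Z j ω) n (αhat n ω))
    {l : Filter (ℕ × Ω)} (hl : l ≤ whp μ) {C : ℝ}
    (hC : ∀ᶠ p in l, scoreSize (fun j => Z j p.2) α p.1 ≤ C) :
    ∃ C', ∀ᶠ p in l, ∃ v : EuclideanSpace ℝ (Fin (d + 1)),
      (∀ j < p.1, inner ℝ (augment (cov (Z j p.2))) (αhat p.1 p.2) =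
        inner ℝ (augment (cov (Z j p.2))) α + inner ℝ (augment (cov (Z j p.2))) v) ∧
      √(p.1 : ℝ) * ‖v‖ ≤ C' := by
  obtain ⟨V, κ, hκ, hV, hcurv⟩ := exists_curvature h hX
  obtain ⟨c₁, c₂, hc₁, hc₂, hc⟩ := hov
  have hsqrt : Tendsto (fun p : ℕ × Ω => √(p.1 : ℝ)) (whp μ) atTop :=
    Real.tendsto_sqrt_atTop.comp (tendsto_natCast_atTop_atTop.comp tendsto_fst_whp)
  have hcc : 0 < c₁ * (1 - c₂) := mul_pos hc₁ (by linarith)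
  refine ⟨2 * max C 0 / (c₁ * (1 - c₂) * κ), ?_⟩
  filter_upwards [hC, hl hcurv, hl (h.eventually hV), hl (h.eventually hc),
    hl (hsqrt.eventually_gt_atTop (2 * max C 0 / (c₁ * (1 - c₂) * κ))),
    hl (tendsto_fst_whp.eventually_gt_atTop 0)] with p h1 h2 h3 h4 h5 h6
  have hmain := exists_isMLE_and_bound (z := fun j => Z j p.2) (n := p.1) (α := α)
    (fun j _ => h3 j) hcc hκ (le_max_right C 0)
    (fun j _ => mul_le_mul (h4 j).1 (by linarith [(h4 j).2]) (by linarith) (tau_pos _ _).le)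
    h2 (fun v => (score_le _ α v h6).trans (by
      gcongr
      exact h1.trans (le_max_left _ _))) h5
  exact hmain.2 _ (hα p.1 p.2 hmain.1)

end Design

end PELCausal

namespace PELCausal

/-! ### The calibrated maximizer of the pseudo-empirical likelihood -/

section Lagrange

variable {s : Finset ℕ} {a u : ℕ → ℝ}

/-- The product `∏ (1 + λ uⱼ) ^ aⱼ` is maximized over the `λ` for which all factors are nonnegative.
It is `1` at `λ = 0` and `0` where a factor vanishes, so the maximizer is interior, and there the
logarithmic derivative, which is the calibration sum, is zero. -/
theorem exists_multiplier (ha : ∀ j ∈ s, 0 < a j) (hneg : ∃ j ∈ s, u j < 0)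
    (hpos : ∃ j ∈ s, 0 < u j) :
    ∃ lam : ℝ, (∀ j ∈ s, 0 < 1 + lam * u j) ∧ ∑ j ∈ s, a j * u j / (1 + lam * u j) = 0 := by
  obtain ⟨i, hi, hui⟩ := hneg
  obtain ⟨k, hk, huk⟩ := hpos
  set D : Set ℝ := {lam | ∀ j ∈ s, 0 ≤ 1 + lam * u j} with hD
  -- The factor with negative `u` bounds `λ` from above and the one with positive `u` from below.
  have hDc : IsCompact D := by
    refine isCompact_Icc.of_isClosed_subset (s := Set.Icc (-1 / u k) (-1 / u i)) ?_ ?_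
    · have : D = ⋂ j ∈ s, {lam : ℝ | 0 ≤ 1 + lam * u j} := by
        ext lam
        simp [hD]
      rw [this]
      refine isClosed_biInter fun j _ => isClosed_le (by fun_prop) (by fun_prop)
    · intro lam hlam
      have h1 := hlam i hi
      have h2 := hlam k hk
      refine ⟨?_, ?_⟩
      · rw [div_le_iff₀ huk]; linarith
      · rw [le_div_iff_of_neg hui]; linarith
  have hcont : Continuous fun lam : ℝ => ∏ j ∈ s, (1 + lam * u j) ^ a j := by
    refine continuous_finsetProd _ fun j hj => ?_
    exact Continuous.rpow_const (by fun_prop) fun _ => Or.inr (ha j hj).le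
  obtain ⟨lam, hlam, hmax⟩ := hDc.exists_isMaxOn (f := fun lam : ℝ =>
    ∏ j ∈ s, (1 + lam * u j) ^ a j) ⟨0, fun j _ => by simp⟩ hcont.continuousOn
  have h0 : 0 < ∏ j ∈ s, (1 + lam * u j) ^ a j := by
    have h1 := hmax (show (0 : ℝ) ∈ D from fun j _ => by simp)
    simp only [zero_mul, add_zero, Real.one_rpow, Finset.prod_const_one, Set.mem_ofPred_eq] at h1
    linarith
  have hlt : ∀ j ∈ s, 0 < 1 + lam * u j := by
    intro j hj
    refine lt_of_le_of_ne (hlam j hj) fun h => h0.ne' ?_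
    refine Finset.prod_eq_zero hj ?_
    rw [← h, Real.zero_rpow (ha j hj).ne']
  refine ⟨lam, hlt, ?_⟩
  have hder : HasDerivAt (fun lam : ℝ => ∑ j ∈ s, a j * Real.log (1 + lam * u j))
      (∑ j ∈ s, a j * u j / (1 + lam * u j)) lam := by
    refine HasDerivAt.fun_sum fun j hj => ?_
    have h1 : HasDerivAt (fun lam : ℝ => 1 + lam * u j) (u j) lam := by
      simpa using ((hasDerivAt_id lam).mul_const (u j)).const_add 1
    have h2 := (h1.log (hlt j hj).ne').const_mul (a j)
    rwa [← mul_div_assoc] at h2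
  refine IsLocalMax.hasDerivAt_eq_zero ?_ hder
  have hev : ∀ᶠ t in 𝓝 lam, ∀ j ∈ s, 0 < 1 + t * u j := by
    rw [Filter.eventually_all_finset]
    intro j hj
    have hc : Continuous fun t : ℝ => 1 + t * u j := by fun_prop
    exact hc.tendsto lam |>.eventually (lt_mem_nhds (hlt j hj))
  filter_upwards [hev] with t ht
  have hlog : ∀ t : ℝ, (∀ j ∈ s, 0 < 1 + t * u j) →
      ∑ j ∈ s, a j * Real.log (1 + t * u j) = Real.log (∏ j ∈ s, (1 + t * u j) ^ a j) := by
    intro t ht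
    rw [Real.log_prod fun j hj => (Real.rpow_pos_of_pos (ht j hj) _).ne']
    exact Finset.sum_congr rfl fun j hj => (Real.log_rpow (ht j hj) _).symm
  rw [hlog t ht, hlog lam hlt]
  refine Real.log_le_log (Finset.prod_pos fun j hj => Real.rpow_pos_of_pos (ht j hj) _) ?_
  exact hmax (show t ∈ D from fun j hj => (ht j hj).le)

variable {lam : ℝ}

theorem sum_multiplier_weights (hsum : ∑ j ∈ s, a j = 1) (hlt : ∀ j ∈ s, 0 < 1 + lam * u j)
    (hroot : ∑ j ∈ s, a j * u j / (1 + lam * u j) = 0) :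
    ∑ j ∈ s, a j / (1 + lam * u j) = 1 := by
  have h1 : ∀ j ∈ s, a j / (1 + lam * u j) = a j - lam * (a j * u j / (1 + lam * u j)) := by
    intro j hj
    have := (hlt j hj).ne'
    field_simp
    ring
  rw [Finset.sum_congr rfl h1, Finset.sum_sub_distrib, ← Finset.mul_sum, hroot, hsum]
  simp

/-- Apply `log x ≤ x - 1` to `rⱼ / pⱼ`. Since `aⱼ / pⱼ = 1 + λ uⱼ`, the linear bounds sum to zero
for every feasible `r`. Strictness of the inequality for `x ≠ 1` gives uniqueness. -/
theorem log_sum_sub_le {r : ℕ → ℝ} (ha : ∀ j ∈ s, 0 < a j) (hsum : ∑ j ∈ s, a j = 1)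
    (hlt : ∀ j ∈ s, 0 < 1 + lam * u j) (hr : ∀ j ∈ s, 0 < r j) (hr1 : ∑ j ∈ s, r j = 1)
    (hru : ∑ j ∈ s, r j * u j = 0) :
    ∑ j ∈ s, a j * Real.log (r j) ≤ ∑ j ∈ s, a j * Real.log (a j / (1 + lam * u j)) ∧
    (∑ j ∈ s, a j * Real.log (a j / (1 + lam * u j)) ≤ ∑ j ∈ s, a j * Real.log (r j) →
      ∀ j ∈ s, r j = a j / (1 + lam * u j)) := by
  set p : ℕ → ℝ := fun j => a j / (1 + lam * u j) with hp
  have hpp : ∀ j ∈ s, 0 < p j := fun j hj => div_pos (ha j hj) (hlt j hj)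
  have hterm : ∀ j ∈ s, a j * Real.log (r j) - a j * Real.log (p j) ≤ a j * (r j / p j - 1) := by
    intro j hj
    rw [← mul_sub, ← Real.log_div (hr j hj).ne' (hpp j hj).ne']
    exact mul_le_mul_of_nonneg_left
      (Real.log_le_sub_one_of_pos (div_pos (hr j hj) (hpp j hj))) (ha j hj).le
  have hzero : ∑ j ∈ s, a j * (r j / p j - 1) = 0 := by
    have h1 : ∀ j ∈ s, a j * (r j / p j - 1) = r j + lam * (r j * u j) - a j := by
      intro j hj
      have h2 := (ha j hj).ne'
      have h3 := (hlt j hj).ne'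
      simp only [hp]
      field_simp
    rw [Finset.sum_congr rfl h1, Finset.sum_sub_distrib, Finset.sum_add_distrib, ← Finset.mul_sum,
      hru, hr1, hsum]
    simp
  have hle := Finset.sum_le_sum hterm
  rw [hzero, Finset.sum_sub_distrib] at hle
  refine ⟨by linarith, fun hge j hj => ?_⟩
  by_contra hne
  have hlt' : ∑ j ∈ s, (a j * Real.log (r j) - a j * Real.log (p j)) <
      ∑ j ∈ s, a j * (r j / p j - 1) := by
    refine Finset.sum_lt_sum hterm ⟨j, hj, ?_⟩
    rw [← mul_sub, ← Real.log_div (hr j hj).ne' (hpp j hj).ne']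
    refine mul_lt_mul_of_pos_left (Real.log_lt_sub_one_of_pos (div_pos (hr j hj) (hpp j hj)) ?_)
      (ha j hj)
    rw [Ne, div_eq_one_iff_eq (hpp j hj).ne']
    exact hne
  rw [hzero, Finset.sum_sub_distrib] at hlt'
  linarith

end Lagrange

section PEL

variable {d q₁ q₀ : ℕ} {m₁ : EuclideanSpace ℝ (Fin d) → EuclideanSpace ℝ (Fin q₁) → ℝ}
  {m₀ : EuclideanSpace ℝ (Fin d) → EuclideanSpace ℝ (Fin q₀) → ℝ} {z : ℕ → Obs d} {n : ℕ}
  {α : EuclideanSpace ℝ (Fin (d + 1))} {β₁ : EuclideanSpace ℝ (Fin q₁)}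
  {β₀ : EuclideanSpace ℝ (Fin q₀)}

theorem mem_S1 {j : ℕ} : j ∈ S1 z n ↔ j < n ∧ trt (z j) = true := by
  simp [S1]

theorem mem_S0 {j : ℕ} : j ∈ S0 z n ↔ j < n ∧ trt (z j) = false := by
  simp [S0]

theorem sum_inv_tau_pos (hne : (S1 z n).Nonempty) :
    0 < ∑ l ∈ S1 z n, (tau (cov (z l)) α)⁻¹ :=
  Finset.sum_pos (fun _ _ => inv_pos.2 (tau_pos _ _)) hne

theorem a1_pos (hne : (S1 z n).Nonempty) (j : ℕ) : 0 < a1 z n α j :=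
  div_pos (inv_pos.2 (tau_pos _ _)) (sum_inv_tau_pos hne)

theorem sum_a1 (hne : (S1 z n).Nonempty) : ∑ j ∈ S1 z n, a1 z n α j = 1 := by
  unfold a1
  rw [← Finset.sum_div, div_self (sum_inv_tau_pos hne).ne']

theorem sum_inv_one_sub_tau_pos (hne : (S0 z n).Nonempty) :
    0 < ∑ l ∈ S0 z n, (1 - tau (cov (z l)) α)⁻¹ :=
  Finset.sum_pos (fun _ _ => inv_pos.2 (sub_pos.2 (tau_lt_one _ _))) hne

theorem a0_pos (hne : (S0 z n).Nonempty) (j : ℕ) : 0 < a0 z n α j :=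
  div_pos (inv_pos.2 (sub_pos.2 (tau_lt_one _ _))) (sum_inv_one_sub_tau_pos hne)

theorem sum_a0 (hne : (S0 z n).Nonempty) : ∑ j ∈ S0 z n, a0 z n α j = 1 := by
  unfold a0
  rw [← Finset.sum_div, div_self (sum_inv_one_sub_tau_pos hne).ne']

theorem sum_mul_uHat {q : ℕ} {m : EuclideanSpace ℝ (Fin d) → EuclideanSpace ℝ (Fin q) → ℝ}
    {β : EuclideanSpace ℝ (Fin q)} {s : Finset ℕ} {p : ℕ → ℝ} (hp : ∑ j ∈ s, p j = 1) :
    ∑ j ∈ s, p j * uHat m z n β j = (∑ j ∈ s, p j * fit m β (z j)) - fitMean m z n β := by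
  unfold uHat
  simp only [mul_sub, Finset.sum_sub_distrib]
  rw [← Finset.sum_mul, hp, one_mul]

/-- If the calibration equations are solvable, then the constrained maximizer exists, it is unique,
and it has the Lagrangian form. -/
theorem isMaxPEL_form
    (hneg₁ : ∃ j ∈ S1 z n, uHat m₁ z n β₁ j < 0) (hpos₁ : ∃ j ∈ S1 z n, 0 < uHat m₁ z n β₁ j)
    (hneg₀ : ∃ j ∈ S0 z n, uHat m₀ z n β₀ j < 0) (hpos₀ : ∃ j ∈ S0 z n, 0 < uHat m₀ z n β₀ j) :
    (∃ r₁ r₀, IsMaxPEL m₁ m₀ z n α β₁ β₀ r₁ r₀) ∧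
    ∀ p₁ p₀, IsMaxPEL m₁ m₀ z n α β₁ β₀ p₁ p₀ → ∃ lam : ℝ,
      (∀ j ∈ S1 z n, 0 < 1 + lam * uHat m₁ z n β₁ j) ∧
      ∑ j ∈ S1 z n, a1 z n α j * uHat m₁ z n β₁ j / (1 + lam * uHat m₁ z n β₁ j) = 0 ∧
      ∀ j ∈ S1 z n, p₁ j = a1 z n α j / (1 + lam * uHat m₁ z n β₁ j) := by
  have hne₁ : (S1 z n).Nonempty := hneg₁.imp fun j hj => hj.1
  have hne₀ : (S0 z n).Nonempty := hneg₀.imp fun j hj => hj.1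
  have hn : (0 : ℝ) < n := by
    obtain ⟨j, hj⟩ := hne₁
    exact Nat.cast_pos.2 ((Nat.zero_le j).trans_lt (mem_S1.1 hj).1)
  obtain ⟨lam, hlt, hroot⟩ :=
    exists_multiplier (a := a1 z n α) (fun j _ => a1_pos hne₁ j) hneg₁ hpos₁
  obtain ⟨nu, hlt₀, hroot₀⟩ :=
    exists_multiplier (a := a0 z n α) (fun j _ => a0_pos hne₀ j) hneg₀ hpos₀
  set r₁ : ℕ → ℝ := fun j => a1 z n α j / (1 + lam * uHat m₁ z n β₁ j) with hr₁
  set r₀ : ℕ → ℝ := fun j => a0 z n α j / (1 + nu * uHat m₀ z n β₀ j) with hr₀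
  have hs₁ : ∑ j ∈ S1 z n, r₁ j = 1 := sum_multiplier_weights (sum_a1 hne₁) hlt hroot
  have hs₀ : ∑ j ∈ S0 z n, r₀ j = 1 := sum_multiplier_weights (sum_a0 hne₀) hlt₀ hroot₀
  have hfeas : Feasible m₁ m₀ z n β₁ β₀ r₁ r₀ :=
    { pos_one := fun j hj => div_pos (a1_pos hne₁ j) (hlt j hj)
      pos_zero := fun j hj => div_pos (a0_pos hne₀ j) (hlt₀ j hj)
      sum_one := hs₁
      sum_zero := hs₀
      calib_one := by
        rw [← sub_eq_zero, ← sum_mul_uHat hs₁, ← hroot]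
        exact Finset.sum_congr rfl fun j _ => div_mul_eq_mul_div _ _ _
      calib_zero := by
        rw [← sub_eq_zero, ← sum_mul_uHat hs₀, ← hroot₀]
        exact Finset.sum_congr rfl fun j _ => div_mul_eq_mul_div _ _ _ }
  have hopt : ∀ p₁ p₀, Feasible m₁ m₀ z n β₁ β₀ p₁ p₀ →
      (∑ j ∈ S1 z n, a1 z n α j * Real.log (p₁ j) ≤
          ∑ j ∈ S1 z n, a1 z n α j * Real.log (r₁ j) ∧
        (∑ j ∈ S1 z n, a1 z n α j * Real.log (r₁ j) ≤
          ∑ j ∈ S1 z n, a1 z n α j * Real.log (p₁ j) → ∀ j ∈ S1 z n, p₁ j = r₁ j)) ∧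
      ∑ j ∈ S0 z n, a0 z n α j * Real.log (p₀ j) ≤
        ∑ j ∈ S0 z n, a0 z n α j * Real.log (r₀ j) := by
    intro p₁ p₀ hp
    refine ⟨log_sum_sub_le (fun j _ => a1_pos hne₁ j) (sum_a1 hne₁) hlt hp.pos_one hp.sum_one ?_,
      (log_sum_sub_le (fun j _ => a0_pos hne₀ j) (sum_a0 hne₀) hlt₀ hp.pos_zero hp.sum_zero ?_).1⟩
    · rw [sum_mul_uHat hp.sum_one, hp.calib_one, sub_self]
    · rw [sum_mul_uHat hp.sum_zero, hp.calib_zero, sub_self]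
  refine ⟨⟨r₁, r₀, hfeas, fun p₁ p₀ hp => ?_⟩, fun p₁ p₀ hp => ⟨lam, hlt, hroot, ?_⟩⟩
  · have h := hopt p₁ p₀ hp
    unfold pel
    refine mul_le_mul_of_nonneg_left ?_ hn.le
    linarith [h.1.1, h.2]
  -- The objective is a sum over the two arms. The control part of `p` cannot beat `r₀`, so its
  -- treated part must do at least as well as `r₁`, which forces equality.
  · have h := hopt p₁ p₀ hp.1
    refine h.1.2 ?_
    have h1 := le_of_mul_le_mul_left (hp.2 r₁ r₀ hfeas) hn
    linarith [h.2]

end PEL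

end PELCausal

namespace PELCausal

/-! ### Inverse probability weighted sums -/

section Weights

variable {d : ℕ}

/-- The weighted sum `∑_{𝒮₁} ã₁ⱼ fⱼ`. -/
noncomputable def wsum (z : ℕ → Obs d) (n : ℕ) (α : EuclideanSpace ℝ (Fin (d + 1)))
    (f : ℕ → ℝ) : ℝ := ∑ j ∈ S1 z n, a1 z n α j * f j

theorem sum_S1_eq (z : ℕ → Obs d) (n : ℕ) (f : ℕ → ℝ) :
    ∑ j ∈ S1 z n, f j = ∑ j ∈ Finset.range n, trtInd (z j) * f j := by
  rw [S1, Finset.sum_filter]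
  refine Finset.sum_congr rfl fun j _ => ?_
  unfold trtInd
  split_ifs <;> simp

theorem wsum_eq {z : ℕ → Obs d} {n : ℕ} (hn : 0 < n) (α : EuclideanSpace ℝ (Fin (d + 1)))
    (f : ℕ → ℝ) : wsum z n α f = (avg n fun j => trtInd (z j) * ((tau (cov (z j)) α)⁻¹ * f j)) /
      avg n fun j => trtInd (z j) * (tau (cov (z j)) α)⁻¹ := by
  have hn' : (n : ℝ) ≠ 0 := (Nat.cast_pos.2 hn).ne'
  unfold wsum avg
  rw [div_div_div_cancel_right₀ hn', ← sum_S1_eq, ← sum_S1_eq, Finset.sum_div]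
  refine Finset.sum_congr rfl fun j _ => ?_
  unfold a1
  ring

theorem inv_tau (x : EuclideanSpace ℝ (Fin d)) (α : EuclideanSpace ℝ (Fin (d + 1))) :
    (tau x α)⁻¹ = 1 + Real.exp (-inner ℝ (augment x) α) := by
  rw [tau, inv_div, Real.exp_neg]
  field_simp
  ring

/-- As `1 / τ = 1 + exp (-x̃ᵀα)`, a small change of the linear predictor gives a small relative
change of the weight. -/
theorem abs_inv_tau_sub_le {x : EuclideanSpace ℝ (Fin d)} {a α v : EuclideanSpace ℝ (Fin (d + 1))}
    (h : inner ℝ (augment x) a = inner ℝ (augment x) α + inner ℝ (augment x) v)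
    (hs : ‖augment x‖ * ‖v‖ ≤ 1) :
    |(tau x a)⁻¹ - (tau x α)⁻¹| ≤ (tau x α)⁻¹ * (2 * (‖augment x‖ * ‖v‖)) := by
  have h0 : |(inner ℝ (augment x) v : ℝ)| ≤ ‖augment x‖ * ‖v‖ := abs_real_inner_le_norm _ _
  have h1 : |-(inner ℝ (augment x) v : ℝ)| ≤ 1 := by rw [abs_neg]; exact h0.trans hs
  have h2 := Real.abs_exp_sub_one_le h1
  rw [abs_neg] at h2
  rw [inv_tau, inv_tau, h, neg_add, Real.exp_add]
  set t : ℝ := inner ℝ (augment x) α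
  set s : ℝ := inner ℝ (augment x) v
  have h3 : 1 + Real.exp (-t) * Real.exp (-s) - (1 + Real.exp (-t)) =
      Real.exp (-t) * (Real.exp (-s) - 1) := by ring
  rw [h3, abs_mul, abs_of_pos (Real.exp_pos _)]
  have h4 := Real.exp_pos (-t)
  exact mul_le_mul (by linarith) (h2.trans (by linarith)) (abs_nonneg _) (by linarith)

variable {Ω : Type*} [MeasurableSpace Ω]

/-- A filter finer than convergence in probability, along which the linear predictors of the
maximum likelihood estimator converge to those of `α` at the rate `n^{-1/2}`. -/
structure MLERegime (μ : Measure Ω) (P : Measure (Obs d)) (Z : ℕ → Ω → Obs d)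
    (α : EuclideanSpace ℝ (Fin (d + 1))) (αhat : ℕ → Ω → EuclideanSpace ℝ (Fin (d + 1)))
    (l : Filter (ℕ × Ω)) : Prop where
  iid : IsIIDSample μ P Z
  le : l ≤ whp μ
  covSq : MemLp (cov : Obs d → EuclideanSpace ℝ (Fin d)) 2 P
  overlap : Overlap P α
  treated : P {z | trt z = true} ≠ 0
  rate : ∃ C', ∀ᶠ p in l, ∃ v : EuclideanSpace ℝ (Fin (d + 1)),
    (∀ j < p.1, inner ℝ (augment (cov (Z j p.2))) (αhat p.1 p.2) =
      inner ℝ (augment (cov (Z j p.2))) α + inner ℝ (augment (cov (Z j p.2))) v) ∧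
    √(p.1 : ℝ) * ‖v‖ ≤ C'

variable {μ : Measure Ω} [IsProbabilityMeasure μ] {P : Measure (Obs d)} [IsProbabilityMeasure P]
  {Z : ℕ → Ω → Obs d} {α : EuclideanSpace ℝ (Fin (d + 1))}
  {αhat : ℕ → Ω → EuclideanSpace ℝ (Fin (d + 1))} {l : Filter (ℕ × Ω)}

theorem Overlap.exists_bound (h : Overlap P α) :
    ∃ b : ℝ, 0 < b ∧ ∀ᵐ z ∂P, (tau (cov z) α)⁻¹ ≤ b := by
  obtain ⟨c₁, c₂, h1, -, h2⟩ := h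
  refine ⟨c₁⁻¹, inv_pos.2 h1, ?_⟩
  filter_upwards [h2] with z hz
  exact inv_anti₀ h1 hz.1

theorem Overlap.abs_weight_le (h : Overlap P α) :
    ∃ b : ℝ, 0 < b ∧ ∀ᵐ z ∂P, ‖trtInd z * (tau (cov z) α)⁻¹‖ ≤ b := by
  obtain ⟨b, hb, h1⟩ := h.exists_bound
  refine ⟨b, hb, ?_⟩
  filter_upwards [h1] with z hz
  have h2 := inv_pos.2 (tau_pos (cov z) α)
  rw [Real.norm_eq_abs, abs_of_nonneg (mul_nonneg (trtInd_nonneg z) h2.le)]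
  exact (mul_le_of_le_one_left h2.le (trtInd_le_one z)).trans hz

theorem measurable_weight (α : EuclideanSpace ℝ (Fin (d + 1))) :
    Measurable fun z : Obs d => trtInd z * (tau (cov z) α)⁻¹ :=
  measurable_trtInd.mul ((measurable_tau α).comp measurable_cov).inv

theorem Overlap.integrable_weight_mul (h : Overlap P α) {g : Obs d → ℝ} (hg : Integrable g P) :
    Integrable (fun z => trtInd z * ((tau (cov z) α)⁻¹ * g z)) P := by
  obtain ⟨b, -, h1⟩ := h.abs_weight_le
  simp only [← mul_assoc]
  exact hg.bdd_mul (measurable_weight α).aestronglyMeasurable h1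

theorem Overlap.integrable_weight (h : Overlap P α) :
    Integrable (fun z => trtInd z * (tau (cov z) α)⁻¹) P := by
  simpa using h.integrable_weight_mul (integrable_const (1 : ℝ))

theorem Overlap.memLp_weight_mul (h : Overlap P α) {g : Obs d → ℝ} (hg : MemLp g 2 P) :
    MemLp (fun z => trtInd z * ((tau (cov z) α)⁻¹ * g z)) 2 P := by
  obtain ⟨b, hb, h1⟩ := h.abs_weight_le
  simp only [← mul_assoc]
  refine MemLp.mono (hg.const_mul b)
    ((measurable_weight α).aestronglyMeasurable.mul hg.1) ?_
  filter_upwards [h1] with z hz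
  rw [norm_mul, norm_mul b, Real.norm_of_nonneg hb.le]
  gcongr

/-- The normalizing constant `E{T / τ(x; α)}`. -/
noncomputable def ipwMass (P : Measure (Obs d)) (α : EuclideanSpace ℝ (Fin (d + 1))) : ℝ :=
  ∫ z, trtInd z * (tau (cov z) α)⁻¹ ∂P

/-- The inverse probability weighted mean `E{T g / τ(x; α)} / E{T / τ(x; α)}`. -/
noncomputable def ipwMean (P : Measure (Obs d)) (α : EuclideanSpace ℝ (Fin (d + 1)))
    (g : Obs d → ℝ) : ℝ :=
  (∫ z, trtInd z * ((tau (cov z) α)⁻¹ * g z) ∂P) / ipwMass P α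

theorem ipwMass_pos (h : Overlap P α) (hT : P {z | trt z = true} ≠ 0) : 0 < ipwMass P α := by
  have h0 : ∀ z : Obs d, 0 ≤ trtInd z * (tau (cov z) α)⁻¹ := fun z =>
    mul_nonneg (trtInd_nonneg z) (inv_pos.2 (tau_pos _ _)).le
  refine lt_of_le_of_ne (integral_nonneg h0) fun hc => hT ?_
  have h1 := (integral_eq_zero_iff_of_nonneg h0 h.integrable_weight).1 hc.symm
  refine measure_eq_zero_iff_ae_notMem.2 ?_
  filter_upwards [h1] with z hz hzT
  have h2 : trtInd z = 1 := if_pos hzT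
  rw [Pi.zero_apply, h2, one_mul] at hz
  exact (inv_pos.2 (tau_pos (cov z) α)).ne' hz

namespace MLERegime

theorem tendsto_n (R : MLERegime μ P Z α αhat l) :
    Tendsto (fun p : ℕ × Ω => (p.1 : ℝ)) l atTop :=
  (tendsto_natCast_atTop_atTop.comp tendsto_fst_whp).mono_left R.le

theorem tendsto_sqrt (R : MLERegime μ P Z α αhat l) :
    Tendsto (fun p : ℕ × Ω => √(p.1 : ℝ)) l atTop :=
  Real.tendsto_sqrt_atTop.comp R.tendsto_n

theorem lln (R : MLERegime μ P Z α αhat l) {g : Obs d → ℝ} (hg : Integrable g P) :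
    Tendsto (fun p : ℕ × Ω => avg p.1 fun j => g (Z j p.2)) l (𝓝 (∫ z, g z ∂P)) :=
  (R.iid.lln hg).mono_left R.le

theorem avg_le (R : MLERegime μ P Z α αhat l) {g : Obs d → ℝ} (hg : Integrable g P) :
    ∀ᶠ p in l, (avg p.1 fun j => g (Z j p.2)) ≤ (∫ z, g z ∂P) + 1 :=
  ((R.lln hg).eventually (gt_mem_nhds (lt_add_one _))).mono fun _ h => h.le

/-- The shift `v` of the parameter is `O(n^{-1/2})` and the largest covariate norm is `o(√n)`, so
`‖x̃ⱼ‖ ‖v‖ ≤ 1` for all units at once, and the exponential can be linearized uniformly. -/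
theorem inv_tau_rate (R : MLERegime μ P Z α αhat l) :
    ∃ K : ℝ, 0 < K ∧ ∀ᶠ p in l, ∀ j < p.1, √(p.1 : ℝ) * |(tau (cov (Z j p.2)) (αhat p.1 p.2))⁻¹ -
      (tau (cov (Z j p.2)) α)⁻¹| ≤ K * ‖augment (cov (Z j p.2))‖ := by
  obtain ⟨C, hC⟩ := R.rate
  obtain ⟨b, hb, hbz⟩ := R.overlap.exists_bound
  refine ⟨2 * b * max C 1, by positivity, ?_⟩
  filter_upwards [hC, R.le (R.iid.eventually hbz),
    R.le (R.iid.max_le_sqrt (memLp_norm_augment R.covSq)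
      (show 0 < (max C 1)⁻¹ by positivity)), R.tendsto_sqrt.eventually_gt_atTop 0]
    with p ⟨v, hv, hvC⟩ h2 h3 h4 j hj
  have hCm : √(p.1 : ℝ) * ‖v‖ ≤ max C 1 := hvC.trans (le_max_left _ _)
  have h5 := h3 j hj
  rw [abs_of_nonneg (norm_nonneg _)] at h5
  have hs : ‖augment (cov (Z j p.2))‖ * ‖v‖ ≤ 1 := by
    calc ‖augment (cov (Z j p.2))‖ * ‖v‖ ≤ (max C 1)⁻¹ * √(p.1 : ℝ) * ‖v‖ := by gcongr
      _ = (max C 1)⁻¹ * (√(p.1 : ℝ) * ‖v‖) := by ring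
      _ ≤ (max C 1)⁻¹ * max C 1 := by gcongr
      _ = 1 := inv_mul_cancel₀ (by positivity)
  have h6 := abs_inv_tau_sub_le (hv j hj) hs
  calc √(p.1 : ℝ) * |(tau (cov (Z j p.2)) (αhat p.1 p.2))⁻¹ - (tau (cov (Z j p.2)) α)⁻¹|
      ≤ √(p.1 : ℝ) * (b * (2 * (‖augment (cov (Z j p.2))‖ * ‖v‖))) := by
        gcongr
        refine h6.trans ?_
        gcongr
        exact h2 j
    _ = 2 * b * ‖augment (cov (Z j p.2))‖ * (√(p.1 : ℝ) * ‖v‖) := by ring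
    _ ≤ 2 * b * ‖augment (cov (Z j p.2))‖ * max C 1 := by gcongr
    _ = 2 * b * max C 1 * ‖augment (cov (Z j p.2))‖ := by ring

theorem inv_tau_uniform (R : MLERegime μ P Z α αhat l) {ε : ℝ} (hε : 0 < ε) :
    ∀ᶠ p in l, ∀ j < p.1, |(tau (cov (Z j p.2)) (αhat p.1 p.2))⁻¹ -
      (tau (cov (Z j p.2)) α)⁻¹| ≤ ε := by
  obtain ⟨K, hK, h⟩ := R.inv_tau_rate
  filter_upwards [h, R.le (R.iid.max_le_sqrt (memLp_norm_augment R.covSq) (div_pos hε hK)),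
    R.tendsto_sqrt.eventually_gt_atTop 0] with p h1 h2 h3 j hj
  have h5 := h2 j hj
  rw [abs_of_nonneg (norm_nonneg _), div_mul_eq_mul_div, le_div_iff₀ hK] at h5
  have h6 := h1 j hj
  nlinarith

/-- Estimating the score costs at most the uniform error of the inverse scores times the average of
`|g|`. -/
theorem tendsto_ipw (R : MLERegime μ P Z α αhat l) {g : Obs d → ℝ} (hg : Integrable g P) :
    Tendsto (fun p : ℕ × Ω => avg p.1 fun j => trtInd (Z j p.2) *
      ((tau (cov (Z j p.2)) (αhat p.1 p.2))⁻¹ * g (Z j p.2))) l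
      (𝓝 (∫ z, trtInd z * ((tau (cov z) α)⁻¹ * g z) ∂P)) := by
  have h1 := R.lln (R.overlap.integrable_weight_mul hg)
  have h2 : Tendsto (fun p : ℕ × Ω => (avg p.1 fun j => trtInd (Z j p.2) *
      ((tau (cov (Z j p.2)) (αhat p.1 p.2))⁻¹ * g (Z j p.2))) -
      avg p.1 fun j => trtInd (Z j p.2) * ((tau (cov (Z j p.2)) α)⁻¹ * g (Z j p.2))) l
      (𝓝 0) := by
    rw [Metric.tendsto_nhds]
    intro ε hε
    have hB : 0 < (∫ z, |g z| ∂P) + 1 := by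
      have : 0 ≤ ∫ z, |g z| ∂P := integral_nonneg fun z => abs_nonneg _
      linarith
    filter_upwards [R.avg_le hg.abs,
      R.inv_tau_uniform (show 0 < ε / 2 / ((∫ z, |g z| ∂P) + 1) by positivity)] with p h3 h4
    rw [Real.dist_eq, sub_zero, ← avg_sub]
    calc |avg p.1 fun j => trtInd (Z j p.2) *
          ((tau (cov (Z j p.2)) (αhat p.1 p.2))⁻¹ * g (Z j p.2)) -
          trtInd (Z j p.2) * ((tau (cov (Z j p.2)) α)⁻¹ * g (Z j p.2))|
        ≤ avg p.1 fun j => ε / 2 / ((∫ z, |g z| ∂P) + 1) * |g (Z j p.2)| := by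
          refine (abs_avg_le _ _).trans (avg_mono fun j hj => ?_)
          rw [← mul_sub, ← sub_mul, abs_mul, abs_mul]
          refine (mul_le_of_le_one_left (by positivity) (abs_trtInd_le_one _)).trans ?_
          gcongr
          exact h4 j hj
      _ ≤ ε / 2 / ((∫ z, |g z| ∂P) + 1) * ((∫ z, |g z| ∂P) + 1) := by
          rw [avg_const_mul]
          gcongr
      _ < ε := by
          rw [div_mul_cancel₀ _ hB.ne']
          linarith
  have h3 := h2.add h1
  simp only [sub_add_cancel, zero_add] at h3
  exact h3

theorem tendsto_mass (R : MLERegime μ P Z α αhat l) :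
    Tendsto (fun p : ℕ × Ω => avg p.1 fun j => trtInd (Z j p.2) *
      (tau (cov (Z j p.2)) (αhat p.1 p.2))⁻¹) l (𝓝 (ipwMass P α)) := by
  simpa [ipwMass] using R.tendsto_ipw (integrable_const (1 : ℝ))

theorem ipwMass_pos (R : MLERegime μ P Z α αhat l) : 0 < ipwMass P α :=
  PELCausal.ipwMass_pos R.overlap R.treated

theorem tendsto_wsum (R : MLERegime μ P Z α αhat l) {g : Obs d → ℝ} (hg : Integrable g P) :
    Tendsto (fun p : ℕ × Ω => wsum (fun j => Z j p.2) p.1 (αhat p.1 p.2)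
      fun j => g (Z j p.2)) l (𝓝 (ipwMean P α g)) := by
  refine ((R.tendsto_ipw hg).div R.tendsto_mass R.ipwMass_pos.ne').congr' ?_
  filter_upwards [R.tendsto_n.eventually_gt_atTop 0] with p hp
  rw [wsum_eq (Nat.cast_pos.1 hp)]
  rfl

/-- The hypothesis handles the weights at `α`. Estimating them adds at most a constant times the
average of `‖x̃‖ |g|` after scaling by `√n`, and this product is integrable by the two second
moments. -/
theorem wsum_rate (R : MLERegime μ P Z α αhat l) {g : Obs d → ℝ} (hg : MemLp g 2 P) {C : ℝ}
    (hC : ∀ᶠ p in l, |∑ j ∈ Finset.range p.1, trtInd (Z j p.2) *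
      ((tau (cov (Z j p.2)) α)⁻¹ * g (Z j p.2))| / √(p.1 : ℝ) ≤ C) :
    ∃ K : ℝ, ∀ᶠ p in l, √(p.1 : ℝ) * |wsum (fun j => Z j p.2) p.1 (αhat p.1 p.2)
      fun j => g (Z j p.2)| ≤ K := by
  obtain ⟨K, hK, h⟩ := R.inv_tau_rate
  have hgx : Integrable (fun z : Obs d => ‖augment (cov z)‖ * |g z|) P :=
    MemLp.integrable_mul (memLp_norm_augment R.covSq) hg.norm
  have hM := R.ipwMass_pos
  refine ⟨(C + K * ((∫ z, ‖augment (cov z)‖ * |g z| ∂P) + 1)) / (ipwMass P α / 2), ?_⟩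
  filter_upwards [h, hC, R.avg_le hgx, R.tendsto_mass.eventually (lt_mem_nhds (half_lt_self hM)),
    R.tendsto_n.eventually_gt_atTop 0] with p h1 h2 h3 h4 hp
  have hs : 0 < √(p.1 : ℝ) := Real.sqrt_pos.2 hp
  have hss : √(p.1 : ℝ) * √(p.1 : ℝ) = p.1 := Real.mul_self_sqrt hp.le
  rw [wsum_eq (Nat.cast_pos.1 hp), abs_div, abs_of_pos ((half_pos hM).trans h4),
    ← mul_div_assoc]
  have h5 : √(p.1 : ℝ) * |avg p.1 fun j => trtInd (Z j p.2) *
      ((tau (cov (Z j p.2)) (αhat p.1 p.2))⁻¹ * g (Z j p.2))| ≤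
      C + K * ((∫ z, ‖augment (cov z)‖ * |g z| ∂P) + 1) := by
    have h6 : (avg p.1 fun j => trtInd (Z j p.2) *
        ((tau (cov (Z j p.2)) (αhat p.1 p.2))⁻¹ * g (Z j p.2))) =
        (avg p.1 fun j => trtInd (Z j p.2) * ((tau (cov (Z j p.2)) α)⁻¹ * g (Z j p.2))) +
        avg p.1 fun j => trtInd (Z j p.2) * (((tau (cov (Z j p.2)) (αhat p.1 p.2))⁻¹ -
          (tau (cov (Z j p.2)) α)⁻¹) * g (Z j p.2)) := by
      rw [← avg_add]
      congr 1
      funext j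
      ring
    rw [h6]
    refine (mul_le_mul_of_nonneg_left (abs_add_le _ _) hs.le).trans ?_
    rw [mul_add]
    refine add_le_add ?_ ?_
    · refine le_trans (le_of_eq ?_) h2
      rw [avg, abs_div, Nat.abs_cast, eq_div_iff hs.ne', mul_comm, ← mul_assoc, hss]
      field_simp
    · refine (mul_le_mul_of_nonneg_left (abs_avg_le _ _) hs.le).trans ?_
      rw [← avg_const_mul]
      refine le_trans (avg_mono fun j hj => ?_) ((avg_const_mul p.1 K fun j =>
        ‖augment (cov (Z j p.2))‖ * |g (Z j p.2)|).le.trans (by gcongr))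
      rw [abs_mul, abs_mul]
      calc √(p.1 : ℝ) * (|trtInd (Z j p.2)| * (|(tau (cov (Z j p.2)) (αhat p.1 p.2))⁻¹ -
            (tau (cov (Z j p.2)) α)⁻¹| * |g (Z j p.2)|))
          ≤ √(p.1 : ℝ) * (1 * (|(tau (cov (Z j p.2)) (αhat p.1 p.2))⁻¹ -
            (tau (cov (Z j p.2)) α)⁻¹| * |g (Z j p.2)|)) := by
            gcongr
            exact abs_trtInd_le_one _
        _ = √(p.1 : ℝ) * |(tau (cov (Z j p.2)) (αhat p.1 p.2))⁻¹ -
            (tau (cov (Z j p.2)) α)⁻¹| * |g (Z j p.2)| := by ring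
        _ ≤ K * ‖augment (cov (Z j p.2))‖ * |g (Z j p.2)| :=
            mul_le_mul_of_nonneg_right (h1 j hj) (abs_nonneg _)
        _ = K * (‖augment (cov (Z j p.2))‖ * |g (Z j p.2)|) := by ring
  gcongr
  refine le_trans ?_ h5
  positivity

/-- The weights are of order `1 / n`. -/
theorem wsum_le_avg (R : MLERegime μ P Z α αhat l) :
    ∃ K : ℝ, 0 < K ∧ ∀ᶠ p in l, ∀ f : ℕ → ℝ, (∀ j < p.1, 0 ≤ f j) →
      wsum (fun j => Z j p.2) p.1 (αhat p.1 p.2) f ≤ K * avg p.1 f := by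
  obtain ⟨b, hb, hbz⟩ := R.overlap.exists_bound
  have hM := R.ipwMass_pos
  refine ⟨(b + 1) / (ipwMass P α / 2), by positivity, ?_⟩
  filter_upwards [R.inv_tau_uniform one_pos, R.le (R.iid.eventually hbz),
    R.tendsto_mass.eventually (lt_mem_nhds (half_lt_self hM)),
    R.tendsto_n.eventually_gt_atTop 0] with p h1 h2 h4 hp f hf
  rw [wsum_eq (Nat.cast_pos.1 hp), div_mul_eq_mul_div]
  have h5 : (avg p.1 fun j => trtInd (Z j p.2) *
      ((tau (cov (Z j p.2)) (αhat p.1 p.2))⁻¹ * f j)) ≤ (b + 1) * avg p.1 f := by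
    rw [← avg_const_mul]
    refine avg_mono fun j hj => ?_
    have h6 := (abs_le.1 (h1 j hj)).2
    have h7 := inv_pos.2 (tau_pos (cov (Z j p.2)) (αhat p.1 p.2))
    refine (mul_le_of_le_one_left (mul_nonneg h7.le (hf j hj)) (trtInd_le_one _)).trans ?_
    refine mul_le_mul_of_nonneg_right ?_ (hf j hj)
    linarith [h2 j]
  gcongr
  exact mul_nonneg (by linarith) (avg_nonneg hf)

end MLERegime

end Weights

end PELCausal

namespace PELCausal

/-! ### Estimated outcome regressions -/

section Regression

variable {d q : ℕ} {P : Measure (Obs d)} [IsProbabilityMeasure P]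
  {m : EuclideanSpace ℝ (Fin d) → EuclideanSpace ℝ (Fin q) → ℝ} {β : EuclideanSpace ℝ (Fin q)}

theorem GradientDominated.exists_lipschitz {r : ENNReal} (h : GradientDominated P m β r) :
    ∃ g : EuclideanSpace ℝ (Fin d) → ℝ, MemLp (fun z : Obs d => g (cov z)) r P ∧
      (∀ x, 0 ≤ g x) ∧ ∀ᶠ b in 𝓝 β, ∀ x, |m x b - m x β| ≤ g x * ‖b - β‖ := by
  obtain ⟨U, hU, g, hg, hd⟩ := h
  obtain ⟨ε, hε, hball⟩ := Metric.mem_nhds_iff.1 hU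
  refine ⟨g, hg, fun x => (norm_nonneg _).trans ((hd x).1 β (mem_of_mem_nhds hU)).2, ?_⟩
  filter_upwards [Metric.ball_mem_nhds β hε] with b hb x
  exact (convex_ball β ε).norm_image_sub_le_of_norm_fderiv_le (𝕜 := ℝ)
    (fun c hc => ((hd x).1 c (hball hc)).1) (fun c hc => ((hd x).1 c (hball hc)).2)
    (Metric.mem_ball_self hε) hb

theorem measurable_popU (hm : Measurable fun x => m x β) : Measurable (popU P m β) :=
  (measurable_fit hm).sub_const _

theorem memLp_popU (h : MemLp (fit m β : Obs d → ℝ) 2 P) : MemLp (popU P m β) 2 P :=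
  h.sub (memLp_const _)

theorem integral_popU (h : MemLp (fit m β : Obs d → ℝ) 2 P) : ∫ z, popU P m β z ∂P = 0 := by
  unfold popU
  rw [integral_sub (h.integrable (by norm_num)) (integrable_const _)]
  simp

theorem integral_popU_sq (h : MemLp (fit m β : Obs d → ℝ) 2 P) :
    ∫ z, popU P m β z ^ 2 ∂P = variance (fit m β : Obs d → ℝ) P :=
  (variance_eq_integral h.1.aemeasurable).symm

/-- Otherwise `f ≤ 0` almost everywhere, and a nonpositive function with integral zero vanishes. -/
theorem exists_measure_gt_ne_zero {X : Type*} [MeasurableSpace X] {ν : Measure X} {f : X → ℝ}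
    (hf : Integrable f ν) (h0 : ∫ x, f x ∂ν = 0) (hne : ¬ f =ᵐ[ν] 0) :
    ∃ δ : ℝ, 0 < δ ∧ ν {x | δ < f x} ≠ 0 := by
  by_contra hcon
  push Not at hcon
  apply hne
  have h1 : ∀ᵐ x ∂ν, ∀ k : ℕ, f x ≤ 1 / ((k : ℝ) + 1) := by
    rw [ae_all_iff]
    intro k
    have h2 := measure_eq_zero_iff_ae_notMem.1 (hcon (1 / ((k : ℝ) + 1)) (by positivity))
    filter_upwards [h2] with x hx
    exact not_lt.1 hx
  have h2 : ∀ᵐ x ∂ν, 0 ≤ -f x := by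
    filter_upwards [h1] with x hx
    rw [neg_nonneg]
    exact ge_of_tendsto' tendsto_one_div_add_atTop_nhds_zero_nat hx
  have h3 : ∫ x, -f x ∂ν = 0 := by rw [integral_neg, h0, neg_zero]
  filter_upwards [(integral_eq_zero_iff_of_nonneg_ae h2 hf.neg).1 h3] with x hx
  simpa using hx

variable {Ω : Type*} [MeasurableSpace Ω]

/-- A filter finer than convergence in probability, along which the parameter estimator of the
outcome regression model and the sample mean of the regression converge at the rate
`n^{-1/2}`. -/
structure ORRegime (μ : Measure Ω) (P : Measure (Obs d)) (Z : ℕ → Ω → Obs d)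
    (m : EuclideanSpace ℝ (Fin d) → EuclideanSpace ℝ (Fin q) → ℝ) (β : EuclideanSpace ℝ (Fin q))
    (βhat : ℕ → Ω → EuclideanSpace ℝ (Fin q)) (l : Filter (ℕ × Ω)) : Prop where
  iid : IsIIDSample μ P Z
  le : l ≤ whp μ
  meas : Measurable fun x => m x β
  fitSq : MemLp (fit m β : Obs d → ℝ) 2 P
  var_pos : 0 < variance (fit m β : Obs d → ℝ) P
  grad : GradientDominated P m β 1
  rate : ∃ C, ∀ᶠ p in l, √(p.1 : ℝ) * ‖βhat p.1 p.2 - β‖ ≤ C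
  mean_rate : ∃ C, ∀ᶠ p in l,
    |∑ j ∈ Finset.range p.1, popU P m β (Z j p.2)| / √(p.1 : ℝ) ≤ C

variable {μ : Measure Ω} [IsProbabilityMeasure μ] {Z : ℕ → Ω → Obs d}
  {βhat : ℕ → Ω → EuclideanSpace ℝ (Fin q)} {l : Filter (ℕ × Ω)}

namespace ORRegime

theorem tendsto_n (R : ORRegime μ P Z m β βhat l) :
    Tendsto (fun p : ℕ × Ω => (p.1 : ℝ)) l atTop :=
  (tendsto_natCast_atTop_atTop.comp tendsto_fst_whp).mono_left R.le

theorem tendsto_sqrt (R : ORRegime μ P Z m β βhat l) :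
    Tendsto (fun p : ℕ × Ω => √(p.1 : ℝ)) l atTop :=
  Real.tendsto_sqrt_atTop.comp R.tendsto_n

theorem avg_le (R : ORRegime μ P Z m β βhat l) {g : Obs d → ℝ} (hg : Integrable g P) :
    ∀ᶠ p in l, (avg p.1 fun j => g (Z j p.2)) ≤ (∫ z, g z ∂P) + 1 :=
  (((R.iid.lln hg).mono_left R.le).eventually (gt_mem_nhds (lt_add_one _))).mono fun _ h => h.le

theorem tendsto_βhat (R : ORRegime μ P Z m β βhat l) :
    Tendsto (fun p : ℕ × Ω => βhat p.1 p.2) l (𝓝 β) := by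
  obtain ⟨C, hC⟩ := R.rate
  rw [Metric.tendsto_nhds]
  intro ε hε
  filter_upwards [hC, R.tendsto_sqrt.eventually_gt_atTop (C / ε),
    R.tendsto_sqrt.eventually_gt_atTop 0] with p h1 h2 h3
  rw [dist_eq_norm]
  rw [div_lt_iff₀ hε] at h2
  by_contra hcon
  push Not at hcon
  nlinarith

/-- Pointwise domination by a function of one unit. The exponent `r` is kept general: the first
moment suffices for the averaged bounds of the expansion, while the second moment gives uniform
convergence of `û`. -/
theorem uHat_rate (R : ORRegime μ P Z m β βhat l) {r : ENNReal} (hr : 1 ≤ r)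
    (hgrad : GradientDominated P m β r) :
    ∃ H : Obs d → ℝ, MemLp H r P ∧ (∀ z, 0 ≤ H z) ∧ ∀ᶠ p in l, ∀ j < p.1,
      √(p.1 : ℝ) * |uHat m (fun i => Z i p.2) p.1 (βhat p.1 p.2) j - popU P m β (Z j p.2)| ≤
        H (Z j p.2) := by
  obtain ⟨g, hg, hg0, hlip⟩ := hgrad.exists_lipschitz
  obtain ⟨C, hC⟩ := R.rate
  obtain ⟨C', hC'⟩ := R.mean_rate
  have hgi : Integrable (fun z : Obs d => g (cov z)) P := hg.integrable hr
  set E := (∫ z : Obs d, g (cov z) ∂P) + 1 with hE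
  have hE0 : 0 ≤ E := by
    have : 0 ≤ ∫ z : Obs d, g (cov z) ∂P := integral_nonneg fun z => hg0 _
    linarith
  refine ⟨fun z => max C 0 * g (cov z) + (max C 0 * E + max C' 0),
    (hg.const_mul _).add (memLp_const _), fun z => ?_, ?_⟩
  · have := hg0 (cov z)
    positivity
  filter_upwards [hC, hC', R.tendsto_βhat.eventually hlip, R.avg_le hgi,
    R.tendsto_n.eventually_gt_atTop 0] with p h1 h2 h3 h4 hp j hj
  have hs : 0 < √(p.1 : ℝ) := Real.sqrt_pos.2 hp
  have hss : √(p.1 : ℝ) * √(p.1 : ℝ) = p.1 := Real.mul_self_sqrt hp.le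
  have hpn : p.1 ≠ 0 := (Nat.cast_pos.1 hp).ne'
  have hb : √(p.1 : ℝ) * ‖βhat p.1 p.2 - β‖ ≤ max C 0 := h1.trans (le_max_left _ _)
  have hfit : ∀ i, √(p.1 : ℝ) * |fit m (βhat p.1 p.2) (Z i p.2) - fit m β (Z i p.2)| ≤
      max C 0 * g (cov (Z i p.2)) := by
    intro i
    calc √(p.1 : ℝ) * |fit m (βhat p.1 p.2) (Z i p.2) - fit m β (Z i p.2)|
        ≤ √(p.1 : ℝ) * (g (cov (Z i p.2)) * ‖βhat p.1 p.2 - β‖) := by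
          gcongr
          exact h3 _
      _ = √(p.1 : ℝ) * ‖βhat p.1 p.2 - β‖ * g (cov (Z i p.2)) := by ring
      _ ≤ max C 0 * g (cov (Z i p.2)) := mul_le_mul_of_nonneg_right hb (hg0 _)
  -- Three sources of error: the fitted value itself, the average of the fitting errors, and the
  -- sample mean of `u`. The last two are constant in `j`.
  have hdec : uHat m (fun i => Z i p.2) p.1 (βhat p.1 p.2) j - popU P m β (Z j p.2) =
      (fit m (βhat p.1 p.2) (Z j p.2) - fit m β (Z j p.2)) -
      ((avg p.1 fun i => fit m (βhat p.1 p.2) (Z i p.2) - fit m β (Z i p.2)) +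
        avg p.1 fun i => popU P m β (Z i p.2)) := by
    rw [← avg_add]
    have h5 : (avg p.1 fun i => fit m (βhat p.1 p.2) (Z i p.2) - fit m β (Z i p.2) +
        popU P m β (Z i p.2)) = fitMean m (fun i => Z i p.2) p.1 (βhat p.1 p.2) -
          ∫ z, fit m β z ∂P := by
      conv_rhs => rw [← avg_const hpn (∫ z, fit m β z ∂P)]
      rw [fitMean, ← avg, ← avg_sub]
      congr 1
      funext i
      unfold popU
      ring
    rw [h5]
    unfold uHat popU
    ring
  rw [hdec]
  have h6 : √(p.1 : ℝ) * |avg p.1 fun i =>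
      fit m (βhat p.1 p.2) (Z i p.2) - fit m β (Z i p.2)| ≤ max C 0 * E := by
    refine (mul_le_mul_of_nonneg_left (abs_avg_le _ _) hs.le).trans ?_
    rw [← avg_const_mul]
    refine (avg_mono fun i _ => hfit i).trans ?_
    rw [avg_const_mul]
    gcongr
  have h7 : √(p.1 : ℝ) * |avg p.1 fun i => popU P m β (Z i p.2)| ≤ max C' 0 := by
    refine le_trans (le_of_eq ?_) (h2.trans (le_max_left _ _))
    rw [avg, abs_div, Nat.abs_cast, eq_div_iff hs.ne', mul_comm, ← mul_assoc, hss]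
    field_simp
  refine (mul_le_mul_of_nonneg_left ((abs_sub _ _).trans
    (add_le_add le_rfl (abs_add_le _ _))) hs.le).trans ?_
  rw [mul_add, mul_add]
  exact add_le_add (hfit j) (add_le_add h6 h7)

/-- With an integrable envelope `H` one has `max H = o(n)`, so `|û - u| ≤ H / √n` is still `o(√n)`.
-/
theorem max_uHat (R : ORRegime μ P Z m β βhat l) {ε : ℝ} (hε : 0 < ε) :
    ∀ᶠ p in l, ∀ j < p.1, |uHat m (fun i => Z i p.2) p.1 (βhat p.1 p.2) j| ≤ ε * √(p.1 : ℝ) := by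
  obtain ⟨H, hH, hH0, h⟩ := R.uHat_rate le_rfl R.grad
  filter_upwards [h, R.le (R.iid.max_le_sqrt (memLp_popU R.fitSq) (half_pos hε)),
    R.le (R.iid.max_le (memLp_one_iff_integrable.1 hH) (half_pos hε)),
    R.tendsto_n.eventually_gt_atTop 0] with p h1 h2 h3 hp j hj
  have hs : 0 < √(p.1 : ℝ) := Real.sqrt_pos.2 hp
  have hss : √(p.1 : ℝ) * √(p.1 : ℝ) = p.1 := Real.mul_self_sqrt hp.le
  have h4 := h1 j hj
  have h5 := h3 j hj
  rw [abs_of_nonneg (hH0 _), ← hss] at h5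
  have h6 : |uHat m (fun i => Z i p.2) p.1 (βhat p.1 p.2) j - popU P m β (Z j p.2)| ≤
      ε / 2 * √(p.1 : ℝ) := by
    refine le_of_mul_le_mul_left ?_ hs
    linarith
  have h7 := abs_sub_abs_le_abs_sub (uHat m (fun i => Z i p.2) p.1 (βhat p.1 p.2) j)
    (popU P m β (Z j p.2))
  linarith [h2 j hj]

/-- Here `max H = o(√n)`, so the error tends to zero uniformly; this is where part (b) needs the
squared gradient bound. -/
theorem uHat_uniform (R : ORRegime μ P Z m β βhat l) (hgrad : GradientDominated P m β 2) {ε : ℝ}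
    (hε : 0 < ε) : ∀ᶠ p in l, ∀ j < p.1,
      |uHat m (fun i => Z i p.2) p.1 (βhat p.1 p.2) j - popU P m β (Z j p.2)| ≤ ε := by
  obtain ⟨H, hH, hH0, h⟩ := R.uHat_rate one_le_two hgrad
  filter_upwards [h, R.le (R.iid.max_le_sqrt hH hε),
    R.tendsto_sqrt.eventually_gt_atTop 0] with p h1 h2 hs j hj
  have h4 := h1 j hj
  have h5 := h2 j hj
  rw [abs_of_nonneg (hH0 _)] at h5
  refine le_of_mul_le_mul_left ?_ hs
  linarith

/-- `(û - u) ^ 2 ≤ H ^ 2 / n ≤ (max H / n) H`, and `max H = o(n)`; no second moment of `H` is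
needed. -/
theorem avg_sq_uHat_sub (R : ORRegime μ P Z m β βhat l) {ε : ℝ} (hε : 0 < ε) :
    ∀ᶠ p in l, (avg p.1 fun j =>
      (uHat m (fun i => Z i p.2) p.1 (βhat p.1 p.2) j - popU P m β (Z j p.2)) ^ 2) ≤ ε := by
  obtain ⟨H, hH, hH0, h⟩ := R.uHat_rate le_rfl R.grad
  have hHi := memLp_one_iff_integrable.1 hH
  have hE0 : 0 < (∫ z, H z ∂P) + 1 := by
    have : 0 ≤ ∫ z, H z ∂P := integral_nonneg hH0
    linarith
  filter_upwards [h, R.le (R.iid.max_le hHi (div_pos hε hE0)), R.avg_le hHi,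
    R.tendsto_n.eventually_gt_atTop 0] with p h1 h2 h3 hp
  have hss : √(p.1 : ℝ) ^ 2 = p.1 := Real.sq_sqrt hp.le
  calc (avg p.1 fun j =>
        (uHat m (fun i => Z i p.2) p.1 (βhat p.1 p.2) j - popU P m β (Z j p.2)) ^ 2)
      ≤ avg p.1 fun j => ε / ((∫ z, H z ∂P) + 1) * H (Z j p.2) := by
        refine avg_mono fun j hj => ?_
        have h4 := h1 j hj
        have h5 := h2 j hj
        rw [abs_of_nonneg (hH0 _)] at h5
        have h6 := pow_le_pow_left₀ (by positivity) h4 2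
        rw [mul_pow, hss, sq_abs] at h6
        refine le_of_mul_le_mul_left ?_ hp
        refine h6.trans ?_
        rw [sq]
        have := mul_le_mul_of_nonneg_right h5 (hH0 (Z j p.2))
        linarith
    _ = ε / ((∫ z, H z ∂P) + 1) * avg p.1 fun j => H (Z j p.2) := avg_const_mul _ _ _
    _ ≤ ε / ((∫ z, H z ∂P) + 1) * ((∫ z, H z ∂P) + 1) := by gcongr
    _ = ε := div_mul_cancel₀ _ hE0.ne'

/-- Uniform closeness of `û` to `u` is not available under the first-moment bound, so the argument
is by averages. If no unit in `A` had the right sign, each would have an error above `δ`, and `√n δ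
P(A) / 2` would stay bounded by `E H + 1`. -/
theorem exists_uHat_pos (R : ORRegime μ P Z m β βhat l) {A : Set (Obs d)} (hA : MeasurableSet A)
    (hA0 : P A ≠ 0) {s δ : ℝ} (hs1 : |s| = 1) (hδ : 0 < δ) (hu : ∀ z ∈ A, δ < s * popU P m β z) :
    ∀ᶠ p in l, ∃ j < p.1, Z j p.2 ∈ A ∧
      0 < s * uHat m (fun i => Z i p.2) p.1 (βhat p.1 p.2) j := by
  obtain ⟨H, hH, hH0, h⟩ := R.uHat_rate le_rfl R.grad
  have hHi := memLp_one_iff_integrable.1 hH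
  have hi : Integrable (A.indicator fun _ => (1 : ℝ)) P := (integrable_const 1).indicator hA
  have hlim := (R.iid.lln hi).mono_left R.le
  have hreal : 0 < P.real A := ENNReal.toReal_pos hA0 (measure_ne_top _ _)
  rw [integral_indicator_const _ hA, smul_eq_mul, mul_one] at hlim
  filter_upwards [h, hlim.eventually (lt_mem_nhds (half_lt_self hreal)), R.avg_le hHi,
    R.tendsto_sqrt.eventually_gt_atTop 0,
    R.tendsto_sqrt.eventually_gt_atTop (((∫ z, H z ∂P) + 1) / (δ * (P.real A / 2)))]
    with p h1 h2 h3 hs0 hs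
  rw [div_lt_iff₀ (by positivity)] at hs
  by_contra hcon
  push Not at hcon
  have h4 : √(p.1 : ℝ) * δ * (avg p.1 fun j => A.indicator (fun _ => (1 : ℝ)) (Z j p.2)) ≤
      avg p.1 fun j => H (Z j p.2) := by
    rw [← avg_const_mul]
    refine avg_mono fun j hj => ?_
    by_cases hjA : Z j p.2 ∈ A
    · rw [Set.indicator_of_mem hjA, mul_one]
      refine le_trans (mul_le_mul_of_nonneg_left ?_ hs0.le) (h1 j hj)
      have h5 := hu _ hjA
      have h6 := hcon j hj hjA
      have h7 : |uHat m (fun i => Z i p.2) p.1 (βhat p.1 p.2) j - popU P m β (Z j p.2)| =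
          |s * uHat m (fun i => Z i p.2) p.1 (βhat p.1 p.2) j - s * popU P m β (Z j p.2)| := by
        rw [← mul_sub, abs_mul, hs1, one_mul]
      rw [h7, abs_sub_comm]
      refine le_trans ?_ (le_abs_self _)
      linarith
    · rw [Set.indicator_of_notMem hjA, mul_zero]
      exact hH0 _
  have h8 : √(p.1 : ℝ) * δ * (P.real A / 2) < √(p.1 : ℝ) * δ *
      (avg p.1 fun j => A.indicator (fun _ => (1 : ℝ)) (Z j p.2)) := by gcongr
  nlinarith

theorem exists_popU_gt (R : ORRegime μ P Z m β βhat l) {s : ℝ} (hs : |s| = 1) :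
    ∃ δ : ℝ, 0 < δ ∧ P (cov ⁻¹' {x | δ < s * (m x β - ∫ z', fit m β z' ∂P)}) ≠ 0 := by
  have hi : Integrable (fun z => s * popU P m β z) P :=
    ((memLp_popU R.fitSq).integrable (by norm_num)).const_mul s
  have key := exists_measure_gt_ne_zero hi ?_ fun h0 => R.var_pos.ne' ?_
  · exact key
  · rw [integral_const_mul, integral_popU R.fitSq, mul_zero]
  · rw [← integral_popU_sq R.fitSq]
    refine integral_eq_zero_of_ae ?_
    have hs0 : s ≠ 0 := fun h => by simp [h] at hs
    filter_upwards [h0] with z hz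
    have : popU P m β z = 0 := by simpa [hs0] using hz
    simp [this]

theorem measurableSet_popU_gt (R : ORRegime μ P Z m β βhat l) (s δ : ℝ) :
    MeasurableSet {x | δ < s * (m x β - ∫ z', fit m β z' ∂P)} :=
  measurableSet_lt measurable_const ((R.meas.sub_const _).const_mul s)

theorem exists_treated (R : ORRegime μ P Z m β βhat l) (hS : SITA P) (hpos : Positivity P) {s : ℝ}
    (hs : |s| = 1) : ∀ᶠ p in l, ∃ j ∈ S1 (fun i => Z i p.2) p.1,
      0 < s * uHat m (fun i => Z i p.2) p.1 (βhat p.1 p.2) j := by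
  obtain ⟨δ, hδ, h0⟩ := R.exists_popU_gt hs
  have hB := R.measurableSet_popU_gt s δ
  filter_upwards [R.exists_uHat_pos
    ((measurable_trt (measurableSet_singleton true)).inter (measurable_cov hB))
    (hS.measure_treated_ne_zero hpos hB h0) hs hδ fun z hz => hz.2] with p ⟨j, hj, hjA, hju⟩
  exact ⟨j, mem_S1.2 ⟨hj, hjA.1⟩, hju⟩

theorem exists_control (R : ORRegime μ P Z m β βhat l) (hS : SITA P) (hpos : Positivity P) {s : ℝ}
    (hs : |s| = 1) : ∀ᶠ p in l, ∃ j ∈ S0 (fun i => Z i p.2) p.1,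
      0 < s * uHat m (fun i => Z i p.2) p.1 (βhat p.1 p.2) j := by
  obtain ⟨δ, hδ, h0⟩ := R.exists_popU_gt hs
  have hB := R.measurableSet_popU_gt s δ
  filter_upwards [R.exists_uHat_pos
    ((measurable_trt (measurableSet_singleton false)).inter (measurable_cov hB))
    (hS.measure_control_ne_zero hpos hB h0) hs hδ fun z hz => hz.2] with p ⟨j, hj, hjA, hju⟩
  exact ⟨j, mem_S0.2 ⟨hj, hjA.1⟩, hju⟩

end ORRegime

end Regression

end PELCausal

namespace PELCausal

/-! ### Linearization of the calibrated estimator -/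

/-- Deterministic core of the expansion. With `N = ∑ a u` and `D = ∑ a u ^ 2`, the root is `λ ≈ N /
D`; the smallness condition keeps `|λ u| ≤ 1 / 2`, so the error is quadratic in `λ`. -/
theorem calibration_expansion {s : Finset ℕ} {a u : ℕ → ℝ} {lam M : ℝ} (y : ℕ → ℝ)
    (ha : ∀ j ∈ s, 0 ≤ a j)
    (hroot : ∑ j ∈ s, a j * u j / (1 + lam * u j) = 0) (hlt : ∀ j ∈ s, 0 < 1 + lam * u j)
    (hM : ∀ j ∈ s, |u j| ≤ M) (hM0 : 0 ≤ M) (hD : 0 < ∑ j ∈ s, a j * u j ^ 2)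
    (hN : 4 * |∑ j ∈ s, a j * u j| * M ≤ ∑ j ∈ s, a j * u j ^ 2) :
    |∑ j ∈ s, a j / (1 + lam * u j) * y j - (∑ j ∈ s, a j * y j -
        (∑ j ∈ s, a j * u j * y j) * (∑ j ∈ s, a j * u j ^ 2)⁻¹ * ∑ j ∈ s, a j * u j)| ≤
      16 * (∑ j ∈ s, a j * u j) ^ 2 * M / (∑ j ∈ s, a j * u j ^ 2) ^ 2 *
        ∑ j ∈ s, a j * |u j * y j| := by
  set N := ∑ j ∈ s, a j * u j with hNdef
  set D := ∑ j ∈ s, a j * u j ^ 2 with hDdef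
  set W := ∑ j ∈ s, a j * |u j * y j| with hW
  have hW0 : 0 ≤ W := Finset.sum_nonneg fun j hj => mul_nonneg (ha j hj) (abs_nonneg _)
  have hid : lam * ∑ j ∈ s, a j * u j ^ 2 / (1 + lam * u j) = N := by
    have h1 : N - lam * ∑ j ∈ s, a j * u j ^ 2 / (1 + lam * u j) =
        ∑ j ∈ s, a j * u j / (1 + lam * u j) := by
      rw [hNdef, Finset.mul_sum, ← Finset.sum_sub_distrib]
      refine Finset.sum_congr rfl fun j hj => ?_
      have h2 := (hlt j hj).ne'
      have h3 := div_mul_cancel₀ (a j * u j ^ 2) h2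
      rw [eq_div_iff h2]
      linear_combination (-lam) * h3
    rw [hroot] at h1
    linarith
  have habs : ∀ j ∈ s, |lam * u j| ≤ |lam| * M := by
    intro j hj
    rw [abs_mul]
    exact mul_le_mul_of_nonneg_left (hM j hj) (abs_nonneg _)
  -- From `|λ| D ≤ |N| (1 + |λ| M)`; the term `|N| |λ| M` is absorbed on the left by `hN`.
  have hlam : |lam| * D ≤ 2 * |N| := by
    have h1 : D / (1 + |lam| * M) ≤ ∑ j ∈ s, a j * u j ^ 2 / (1 + lam * u j) := by
      rw [hDdef, Finset.sum_div]
      refine Finset.sum_le_sum fun j hj => ?_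
      refine div_le_div_of_nonneg_left (mul_nonneg (ha j hj) (sq_nonneg _)) (hlt j hj) ?_
      linarith [(abs_le.1 (habs j hj)).2]
    have h2 : |lam| * (D / (1 + |lam| * M)) ≤ |N| := by
      rw [← hid, abs_mul]
      refine mul_le_mul_of_nonneg_left (h1.trans (le_abs_self _)) (abs_nonneg _)
    have h3 : 0 ≤ |lam| * M := by positivity
    rw [← mul_div_assoc, div_le_iff₀ (by positivity)] at h2
    nlinarith [mul_le_mul_of_nonneg_left hN (abs_nonneg lam), abs_nonneg N]
  have hlamM : |lam| * M ≤ 1 / 2 := by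
    have h1 : |lam| * D * M ≤ 2 * |N| * M := mul_le_mul_of_nonneg_right hlam hM0
    by_contra hcon
    push Not at hcon
    nlinarith
  have hhalf : ∀ j ∈ s, 1 / 2 ≤ 1 + lam * u j := by
    intro j hj
    linarith [(abs_le.1 (habs j hj)).1]
  have hexp : ∑ j ∈ s, a j / (1 + lam * u j) * y j - (∑ j ∈ s, a j * y j -
      lam * ∑ j ∈ s, a j * u j * y j) =
      lam ^ 2 * ∑ j ∈ s, a j * u j ^ 2 * y j / (1 + lam * u j) := by
    rw [Finset.mul_sum, Finset.mul_sum, ← Finset.sum_sub_distrib, ← Finset.sum_sub_distrib]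
    refine Finset.sum_congr rfl fun j hj => ?_
    have := (hlt j hj).ne'
    field_simp
    ring
  have hexpN : lam * D - N = lam ^ 2 * ∑ j ∈ s, a j * u j ^ 3 / (1 + lam * u j) := by
    rw [← hid, hDdef, Finset.mul_sum, Finset.mul_sum, Finset.mul_sum, ← Finset.sum_sub_distrib]
    refine Finset.sum_congr rfl fun j hj => ?_
    have := (hlt j hj).ne'
    field_simp
    ring
  have hb : ∀ f : ℕ → ℝ, |∑ j ∈ s, a j * u j * f j / (1 + lam * u j)| ≤
      2 * ∑ j ∈ s, a j * |u j * f j| := by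
    intro f
    rw [Finset.mul_sum]
    refine (Finset.abs_sum_le_sum_abs _ _).trans (Finset.sum_le_sum fun j hj => ?_)
    rw [abs_div, abs_of_pos (hlt j hj), div_le_iff₀ (hlt j hj), mul_assoc (a j), abs_mul (a j),
      abs_of_nonneg (ha j hj)]
    have h1 := mul_nonneg (ha j hj) (abs_nonneg (u j * f j))
    nlinarith [hhalf j hj]
  have h1 : |∑ j ∈ s, a j * u j ^ 2 * y j / (1 + lam * u j)| ≤ 2 * (M * W) := by
    have h2 := hb fun j => u j * y j
    have h3 : ∑ j ∈ s, a j * |u j * (u j * y j)| ≤ M * W := by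
      rw [hW, Finset.mul_sum]
      refine Finset.sum_le_sum fun j hj => ?_
      rw [abs_mul (u j)]
      have := mul_nonneg (ha j hj) (abs_nonneg (u j * y j))
      nlinarith [hM j hj]
    have h4 : ∀ j, a j * u j ^ 2 * y j = a j * u j * (u j * y j) := fun j => by ring
    simp only [h4]
    linarith
  have h2 : |∑ j ∈ s, a j * u j ^ 3 / (1 + lam * u j)| ≤ 2 * (M * D) := by
    have h2 := hb fun j => u j ^ 2
    have h3 : ∑ j ∈ s, a j * |u j * u j ^ 2| ≤ M * D := by
      rw [hDdef, Finset.mul_sum]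
      refine Finset.sum_le_sum fun j hj => ?_
      rw [abs_mul (u j), abs_of_nonneg (sq_nonneg (u j))]
      have := mul_nonneg (ha j hj) (sq_nonneg (u j))
      nlinarith [hM j hj]
    have h4 : ∀ j, a j * u j ^ 3 = a j * u j * u j ^ 2 := fun j => by ring
    simp only [h4]
    linarith
  have h3 : |∑ j ∈ s, a j * u j * y j| ≤ W := by
    refine (Finset.abs_sum_le_sum_abs _ _).trans (Finset.sum_le_sum fun j hj => ?_)
    rw [mul_assoc, abs_mul (a j), abs_of_nonneg (ha j hj)]
  have hlam2 : lam ^ 2 * D ^ 2 ≤ 4 * N ^ 2 := by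
    have := pow_le_pow_left₀ (by positivity) hlam 2
    rw [mul_pow, mul_pow, sq_abs, sq_abs] at this
    linarith
  -- Replacing `λ` by `N / D` in the linear term creates the second remainder. Each of the two is at
  -- most `2 λ ^ 2 M W`, and `λ ^ 2 D ^ 2 ≤ 4 N ^ 2` gives the factor `16`.
  have hfin : ∑ j ∈ s, a j / (1 + lam * u j) * y j - (∑ j ∈ s, a j * y j -
      (∑ j ∈ s, a j * u j * y j) * D⁻¹ * N) =
      lam ^ 2 * ∑ j ∈ s, a j * u j ^ 2 * y j / (1 + lam * u j) -
        (∑ j ∈ s, a j * u j * y j) * D⁻¹ *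
          (lam ^ 2 * ∑ j ∈ s, a j * u j ^ 3 / (1 + lam * u j)) := by
    rw [← hexp, ← hexpN]
    field_simp
    ring
  rw [hfin]
  calc |lam ^ 2 * ∑ j ∈ s, a j * u j ^ 2 * y j / (1 + lam * u j) -
        (∑ j ∈ s, a j * u j * y j) * D⁻¹ *
          (lam ^ 2 * ∑ j ∈ s, a j * u j ^ 3 / (1 + lam * u j))|
      ≤ lam ^ 2 * (2 * (M * W)) + W * D⁻¹ * (lam ^ 2 * (2 * (M * D))) := by
        refine (abs_sub _ _).trans (add_le_add ?_ ?_)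
        · rw [abs_mul, abs_of_nonneg (sq_nonneg lam)]
          exact mul_le_mul_of_nonneg_left h1 (sq_nonneg _)
        · rw [abs_mul, abs_mul, abs_mul (lam ^ 2), abs_of_nonneg (sq_nonneg lam),
            abs_of_pos (inv_pos.2 hD)]
          gcongr
    _ = 4 * (lam ^ 2 * D ^ 2) * M / D ^ 2 * W := by
        field_simp
        ring
    _ ≤ 4 * (4 * N ^ 2) * M / D ^ 2 * W := by gcongr
    _ = 16 * N ^ 2 * M / D ^ 2 * W := by ring

section Regimes

variable {d q₁ q₀ : ℕ} {Ω : Type*} [MeasurableSpace Ω] {μ : Measure Ω} [IsProbabilityMeasure μ]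
  {P : Measure (Obs d)} [IsProbabilityMeasure P] {Z : ℕ → Ω → Obs d}
  {α : EuclideanSpace ℝ (Fin (d + 1))} {αhat : ℕ → Ω → EuclideanSpace ℝ (Fin (d + 1))}
  {m₁ : EuclideanSpace ℝ (Fin d) → EuclideanSpace ℝ (Fin q₁) → ℝ}
  {m₀ : EuclideanSpace ℝ (Fin d) → EuclideanSpace ℝ (Fin q₀) → ℝ}
  {β₁ : EuclideanSpace ℝ (Fin q₁)} {β₀ : EuclideanSpace ℝ (Fin q₀)}
  {βhat₁ : ℕ → Ω → EuclideanSpace ℝ (Fin q₁)} {βhat₀ : ℕ → Ω → EuclideanSpace ℝ (Fin q₀)}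
  {phat₁ phat₀ : ℕ → Ω → ℕ → ℝ} {l : Filter (ℕ × Ω)}

/-- `p` are the Lagrangian weights `ã₁ⱼ / (1 + λ û₁ⱼ)` with the multiplier `lam`. -/
structure IsCalibrated {q : ℕ} (m : EuclideanSpace ℝ (Fin d) → EuclideanSpace ℝ (Fin q) → ℝ)
    (z : ℕ → Obs d) (n : ℕ) (α : EuclideanSpace ℝ (Fin (d + 1))) (β : EuclideanSpace ℝ (Fin q))
    (p : ℕ → ℝ) (lam : ℝ) : Prop where
  nonempty : (S1 z n).Nonempty
  pos : ∀ j ∈ S1 z n, 0 < 1 + lam * uHat m z n β j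
  root : ∑ j ∈ S1 z n, a1 z n α j * uHat m z n β j / (1 + lam * uHat m z n β j) = 0
  form : ∀ j ∈ S1 z n, p j = a1 z n α j / (1 + lam * uHat m z n β j)

theorem exists_isCalibrated (hS : SITA P) (hpos : Positivity P)
    (R₁ : ORRegime μ P Z m₁ β₁ βhat₁ l) (R₀ : ORRegime μ P Z m₀ β₀ βhat₀ l)
    (hp : ∀ n ω,
      (∃ r₁ r₀, IsMaxPEL m₁ m₀ (fun j => Z j ω) n (αhat n ω) (βhat₁ n ω) (βhat₀ n ω) r₁ r₀) →
      IsMaxPEL m₁ m₀ (fun j => Z j ω) n (αhat n ω) (βhat₁ n ω) (βhat₀ n ω)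
        (phat₁ n ω) (phat₀ n ω)) :
    ∀ᶠ p in l, ∃ lam, IsCalibrated m₁ (fun j => Z j p.2) p.1 (αhat p.1 p.2) (βhat₁ p.1 p.2)
      (phat₁ p.1 p.2) lam := by
  have hs : |(-1 : ℝ)| = 1 := by simp
  filter_upwards [R₁.exists_treated hS hpos abs_one, R₁.exists_treated hS hpos hs,
    R₀.exists_control hS hpos abs_one, R₀.exists_control hS hpos hs] with p h1 h2 h3 h4
  simp only [one_mul, neg_mul, Left.neg_pos_iff] at h1 h2 h3 h4
  have h := isMaxPEL_form (α := αhat p.1 p.2) h2 h1 h4 h3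
  obtain ⟨lam, hlt, hroot, hform⟩ := h.2 _ _ (hp p.1 p.2 h.1)
  exact ⟨lam, h1.imp fun j hj => hj.1, hlt, hroot, hform⟩

theorem wsum_uHat {q : ℕ} {m : EuclideanSpace ℝ (Fin d) → EuclideanSpace ℝ (Fin q) → ℝ}
    {z : ℕ → Obs d} {n : ℕ} {a : EuclideanSpace ℝ (Fin (d + 1))} {β : EuclideanSpace ℝ (Fin q)}
    (hne : (S1 z n).Nonempty) : wsum z n a (uHat m z n β) =
      wsum z n a (fun j => fit m β (z j)) - fitMean m z n β :=
  sum_mul_uHat (sum_a1 hne)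

theorem wsum_add (z : ℕ → Obs d) (n : ℕ) (a : EuclideanSpace ℝ (Fin (d + 1))) (f g : ℕ → ℝ) :
    wsum z n a (fun j => f j + g j) = wsum z n a f + wsum z n a g := by
  simp only [wsum, mul_add, Finset.sum_add_distrib]

theorem wsum_const_mul (z : ℕ → Obs d) (n : ℕ) (a : EuclideanSpace ℝ (Fin (d + 1))) (c : ℝ)
    (f : ℕ → ℝ) : wsum z n a (fun j => c * f j) = c * wsum z n a f := by
  simp only [wsum, Finset.mul_sum]
  exact Finset.sum_congr rfl fun j _ => by ring

theorem wsum_const {z : ℕ → Obs d} {n : ℕ} (a : EuclideanSpace ℝ (Fin (d + 1)))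
    (hne : (S1 z n).Nonempty) (c : ℝ) : wsum z n a (fun _ => c) = c := by
  rw [wsum, ← Finset.sum_mul, sum_a1 hne, one_mul]

theorem a1_nonneg (z : ℕ → Obs d) (n : ℕ) (a : EuclideanSpace ℝ (Fin (d + 1))) (j : ℕ) :
    0 ≤ a1 z n a j :=
  div_nonneg (inv_pos.2 (tau_pos _ _)).le
    (Finset.sum_nonneg fun _ _ => (inv_pos.2 (tau_pos _ _)).le)

theorem wsum_mono {z : ℕ → Obs d} {n : ℕ} {a : EuclideanSpace ℝ (Fin (d + 1))} {f g : ℕ → ℝ}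
    (h : ∀ j ∈ S1 z n, f j ≤ g j) : wsum z n a f ≤ wsum z n a g :=
  Finset.sum_le_sum fun j hj => mul_le_mul_of_nonneg_left (h j hj) (a1_nonneg z n a j)

theorem wsum_nonneg {z : ℕ → Obs d} {n : ℕ} {a : EuclideanSpace ℝ (Fin (d + 1))} {f : ℕ → ℝ}
    (h : ∀ j, 0 ≤ f j) : 0 ≤ wsum z n a f :=
  Finset.sum_nonneg fun j _ => mul_nonneg (a1_nonneg z n a j) (h j)

theorem abs_wsum_le (z : ℕ → Obs d) (n : ℕ) (a : EuclideanSpace ℝ (Fin (d + 1))) (f : ℕ → ℝ) :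
    |wsum z n a f| ≤ wsum z n a fun j => |f j| := by
  refine (Finset.abs_sum_le_sum_abs _ _).trans (Finset.sum_le_sum fun j _ => ?_)
  rw [abs_mul, abs_of_nonneg (a1_nonneg z n a j)]

/-- The second moment of the fitted values stays away from zero and from infinity. -/
theorem wsum_uHat_sq (hS : SITA P) (hpos : Positivity P)
    (R : MLERegime μ P Z α αhat l) (R₁ : ORRegime μ P Z m₁ β₁ βhat₁ l) :
    ∃ c C : ℝ, 0 < c ∧ ∀ᶠ p in l,
      c ≤ wsum (fun j => Z j p.2) p.1 (αhat p.1 p.2)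
        (fun j => uHat m₁ (fun i => Z i p.2) p.1 (βhat₁ p.1 p.2) j ^ 2) ∧
      wsum (fun j => Z j p.2) p.1 (αhat p.1 p.2)
        (fun j => uHat m₁ (fun i => Z i p.2) p.1 (βhat₁ p.1 p.2) j ^ 2) ≤ C := by
  have hu2 := (memLp_popU R₁.fitSq).integrable_sq
  have hlim := R.tendsto_wsum hu2
  -- If it vanished, `u` would be zero for almost all treated units, although treated units with `u
  -- > δ` have positive mass.
  have hv : 0 < ipwMean P α fun z => popU P m₁ β₁ z ^ 2 := by
    refine div_pos ?_ R.ipwMass_pos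
    have h0 : ∀ z, 0 ≤ trtInd z * ((tau (cov z) α)⁻¹ * popU P m₁ β₁ z ^ 2) := fun z =>
      mul_nonneg (trtInd_nonneg z) (mul_nonneg (inv_pos.2 (tau_pos _ _)).le (sq_nonneg _))
    refine lt_of_le_of_ne (integral_nonneg h0) fun hc => ?_
    have h1 := (integral_eq_zero_iff_of_nonneg h0 (R.overlap.integrable_weight_mul hu2)).1 hc.symm
    obtain ⟨δ, hδ, h2⟩ := R₁.exists_popU_gt (s := 1) abs_one
    refine hS.measure_treated_ne_zero hpos (R₁.measurableSet_popU_gt 1 δ) h2 ?_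
    refine measure_eq_zero_iff_ae_notMem.2 ?_
    filter_upwards [h1] with z hz hzA
    have h3 : trtInd z = 1 := if_pos hzA.1
    have h4 : δ < 1 * popU P m₁ β₁ z := hzA.2
    have h5 := inv_pos.2 (tau_pos (cov z) α)
    rw [one_mul] at h4
    rw [Pi.zero_apply, h3, one_mul] at hz
    have h6 : 0 < (tau (cov z) α)⁻¹ * popU P m₁ β₁ z ^ 2 :=
      mul_pos h5 (pow_pos (hδ.trans h4) 2)
    exact h6.ne' hz
  obtain ⟨K, hK, hKf⟩ := R.wsum_le_avg
  set v := ipwMean P α fun z => popU P m₁ β₁ z ^ 2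
  -- From `û ^ 2 ≥ u ^ 2 / 2 - (û - u) ^ 2` and `û ^ 2 ≤ 2 u ^ 2 + 2 (û - u) ^ 2`, with the weighted
  -- mean of `u ^ 2` between `v / 2` and `2 v`.
  refine ⟨v / 8, 4 * v + v, by positivity, ?_⟩
  filter_upwards [hlim.eventually (lt_mem_nhds (half_lt_self hv)),
    hlim.eventually (gt_mem_nhds (show v < 2 * v by linarith)), hKf,
    R₁.avg_sq_uHat_sub (show 0 < v / 8 / K by positivity)] with p h1 h2 h3 h4
  set w := wsum (fun j => Z j p.2) p.1 (αhat p.1 p.2)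
  set û := uHat m₁ (fun i => Z i p.2) p.1 (βhat₁ p.1 p.2)
  have h5 : w (fun j => (û j - popU P m₁ β₁ (Z j p.2)) ^ 2) ≤ v / 8 := by
    refine (h3 _ fun j _ => sq_nonneg _).trans ?_
    refine (mul_le_mul_of_nonneg_left h4 hK.le).trans (le_of_eq ?_)
    field_simp
  have h6 : w (fun j => 1 / 2 * popU P m₁ β₁ (Z j p.2) ^ 2) ≤
      w (fun j => û j ^ 2 + (û j - popU P m₁ β₁ (Z j p.2)) ^ 2) :=
    wsum_mono fun j _ => by nlinarith [sq_nonneg (2 * û j - popU P m₁ β₁ (Z j p.2))]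
  have h7 : w (fun j => û j ^ 2) ≤ w (fun j => 2 * popU P m₁ β₁ (Z j p.2) ^ 2 +
      2 * (û j - popU P m₁ β₁ (Z j p.2)) ^ 2) :=
    wsum_mono fun j _ => by nlinarith [sq_nonneg (û j - 2 * popU P m₁ β₁ (Z j p.2))]
  rw [show w = wsum (fun j => Z j p.2) p.1 (αhat p.1 p.2) from rfl] at *
  rw [wsum_const_mul, wsum_add] at h6
  rw [wsum_add, wsum_const_mul, wsum_const_mul] at h7
  constructor <;> linarith

/-- If the inverse probability weights are asymptotically calibrated, then the calibrated estimator
has the asymptotic expansion of a regression estimator. -/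
theorem expansion_of_calibrated (hS : SITA P) (hpos : Positivity P)
    (hY : MemLp (y1 : Obs d → ℝ) 2 P)
    (R : MLERegime μ P Z α αhat l) (R₁ : ORRegime μ P Z m₁ β₁ βhat₁ l)
    (hcal : ∀ᶠ p in l, ∃ lam, IsCalibrated m₁ (fun j => Z j p.2) p.1 (αhat p.1 p.2)
      (βhat₁ p.1 p.2) (phat₁ p.1 p.2) lam)
    {C : ℝ} (hC : ∀ᶠ p in l, |∑ j ∈ Finset.range p.1, trtInd (Z j p.2) *
      ((tau (cov (Z j p.2)) α)⁻¹ * popU P m₁ β₁ (Z j p.2))| / √(p.1 : ℝ) ≤ C) :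
    Tendsto (fun p : ℕ × Ω => √(p.1 : ℝ) * (muHat (fun j => Z j p.2) p.1 (phat₁ p.1 p.2) -
      leadingTerm m₁ (fun j => Z j p.2) p.1 (αhat p.1 p.2) (βhat₁ p.1 p.2))) l (𝓝 0) ∧
    Tendsto (fun p : ℕ × Ω => muHat (fun j => Z j p.2) p.1 (phat₁ p.1 p.2)) l
      (𝓝 (ipwMean P α y1)) := by
  obtain ⟨c, D, hc, hD⟩ := wsum_uHat_sq hS hpos R R₁
  obtain ⟨K, hK⟩ := R.wsum_rate (memLp_popU R₁.fitSq) hC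
  obtain ⟨H, hH, hH0, hHr⟩ := R₁.uHat_rate le_rfl R₁.grad
  have hHi := memLp_one_iff_integrable.1 hH
  have hyLim := R.tendsto_wsum (hY.integrable (by norm_num))
  have hy2 := (R.tendsto_wsum hY.integrable_sq).eventually (gt_mem_nhds (lt_add_one _))
  have hHlim := (R.tendsto_wsum hHi).eventually (gt_mem_nhds (lt_add_one _))
  set B := ipwMean P α (fun z => y1 z ^ 2) + 1
  set L := max (K + (ipwMean P α H + 1)) 1 with hL
  have hL1 : 1 ≤ L := le_max_right _ _
  have hNrate : ∀ᶠ p in l, √(p.1 : ℝ) * |wsum (fun j => Z j p.2) p.1 (αhat p.1 p.2)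
      (uHat m₁ (fun i => Z i p.2) p.1 (βhat₁ p.1 p.2))| ≤ L := by
    filter_upwards [hK, hHr, hHlim, R.tendsto_sqrt.eventually_gt_atTop 0] with p h1 h2 h3 hs
    have h4 : wsum (fun j => Z j p.2) p.1 (αhat p.1 p.2)
        (uHat m₁ (fun i => Z i p.2) p.1 (βhat₁ p.1 p.2)) =
        wsum (fun j => Z j p.2) p.1 (αhat p.1 p.2) (fun j => popU P m₁ β₁ (Z j p.2)) +
        wsum (fun j => Z j p.2) p.1 (αhat p.1 p.2) (fun j =>
          uHat m₁ (fun i => Z i p.2) p.1 (βhat₁ p.1 p.2) j - popU P m₁ β₁ (Z j p.2)) := by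
      rw [← wsum_add]
      congr 1
      funext j
      ring
    rw [h4]
    refine le_trans (mul_le_mul_of_nonneg_left (abs_add_le _ _) hs.le) ?_
    rw [mul_add]
    refine le_trans (add_le_add h1 ?_) (le_max_left _ _)
    refine (mul_le_mul_of_nonneg_left (abs_wsum_le _ _ _ _) hs.le).trans ?_
    rw [← wsum_const_mul]
    refine (wsum_mono fun j hj => ?_).trans h3.le
    exact h2 j (mem_S1.1 hj).1
  have hWbound : ∀ᶠ p in l, wsum (fun j => Z j p.2) p.1 (αhat p.1 p.2)
      (fun j => |uHat m₁ (fun i => Z i p.2) p.1 (βhat₁ p.1 p.2) j * y1 (Z j p.2)|) ≤ D + B := by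
    filter_upwards [hD, hy2] with p h1 h2
    calc wsum (fun j => Z j p.2) p.1 (αhat p.1 p.2)
          (fun j => |uHat m₁ (fun i => Z i p.2) p.1 (βhat₁ p.1 p.2) j * y1 (Z j p.2)|)
        ≤ wsum (fun j => Z j p.2) p.1 (αhat p.1 p.2)
          (fun j => uHat m₁ (fun i => Z i p.2) p.1 (βhat₁ p.1 p.2) j ^ 2 + y1 (Z j p.2) ^ 2) := by
          refine wsum_mono fun j _ => abs_le.2 ⟨?_, ?_⟩ <;>
          nlinarith [sq_nonneg (uHat m₁ (fun i => Z i p.2) p.1 (βhat₁ p.1 p.2) j - y1 (Z j p.2)),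
            sq_nonneg (uHat m₁ (fun i => Z i p.2) p.1 (βhat₁ p.1 p.2) j + y1 (Z j p.2))]
      _ ≤ D + B := by
          rw [wsum_add]
          exact add_le_add h1.2 h2.le
  have hexp : Tendsto (fun p : ℕ × Ω => √(p.1 : ℝ) *
      (muHat (fun j => Z j p.2) p.1 (phat₁ p.1 p.2) -
        leadingTerm m₁ (fun j => Z j p.2) p.1 (αhat p.1 p.2) (βhat₁ p.1 p.2))) l (𝓝 0) := by
    rw [Metric.tendsto_nhds]
    intro ε hε
    -- If `max |û| ≤ η √n`, the remainder times `√n` is at most `η E`. The bound `c / (4 L)` on `η`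
    -- provides the smallness condition of `calibration_expansion`.
    set E := 16 * L ^ 2 / c ^ 2 * (|D + B| + 1) with hE
    have hE0 : 0 < E := by positivity
    filter_upwards [hcal, hD, hNrate, hWbound,
      R₁.max_uHat (show 0 < min (ε / 2 / E) (c / (4 * L)) by positivity),
      R.tendsto_sqrt.eventually_gt_atTop 0] with p ⟨lam, hlam⟩ h1 h2 h3 h4 hs
    rw [Real.dist_eq, sub_zero]
    have hη1 := min_le_left (ε / 2 / E) (c / (4 * L))
    have hη2 := min_le_right (ε / 2 / E) (c / (4 * L))
    have hη0 : 0 < min (ε / 2 / E) (c / (4 * L)) := by positivity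
    set η := min (ε / 2 / E) (c / (4 * L))
    set r := √(p.1 : ℝ) with hr
    set û := uHat m₁ (fun i => Z i p.2) p.1 (βhat₁ p.1 p.2) with hû
    have hb := calibration_expansion (M := η * r) (fun j => y1 (Z j p.2))
      (fun j _ => a1_nonneg (fun j => Z j p.2) p.1 (αhat p.1 p.2) j) hlam.root hlam.pos
      (fun j hj => h4 j (mem_S1.1 hj).1) (by positivity) (hc.trans_le h1.1) (by
        refine le_trans ?_ h1.1
        calc 4 * |wsum (fun j => Z j p.2) p.1 (αhat p.1 p.2) û| * (η * r)
            = 4 * η * (r * |wsum (fun j => Z j p.2) p.1 (αhat p.1 p.2) û|) := by ring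
          _ ≤ 4 * (c / (4 * L)) * L := by gcongr
          _ = c := by field_simp)
    have hmu : muHat (fun j => Z j p.2) p.1 (phat₁ p.1 p.2) = ∑ j ∈ S1 (fun j => Z j p.2) p.1,
        a1 (fun j => Z j p.2) p.1 (αhat p.1 p.2) j / (1 + lam * û j) * y1 (Z j p.2) :=
      Finset.sum_congr rfl fun j hj => by rw [hlam.form j hj]
    have hlead : leadingTerm m₁ (fun j => Z j p.2) p.1 (αhat p.1 p.2) (βhat₁ p.1 p.2) =
        ∑ j ∈ S1 (fun j => Z j p.2) p.1, a1 (fun j => Z j p.2) p.1 (αhat p.1 p.2) j *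
          y1 (Z j p.2) -
        (∑ j ∈ S1 (fun j => Z j p.2) p.1, a1 (fun j => Z j p.2) p.1 (αhat p.1 p.2) j * û j *
          y1 (Z j p.2)) * (∑ j ∈ S1 (fun j => Z j p.2) p.1,
          a1 (fun j => Z j p.2) p.1 (αhat p.1 p.2) j * û j ^ 2)⁻¹ *
        ∑ j ∈ S1 (fun j => Z j p.2) p.1, a1 (fun j => Z j p.2) p.1 (αhat p.1 p.2) j * û j := by
      have h5 := wsum_uHat (m := m₁) (a := αhat p.1 p.2) (β := βhat₁ p.1 p.2) hlam.nonempty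
      unfold wsum at h5
      rw [hû, h5, leadingTerm, BHat]
      ring
    rw [← hmu, ← hlead] at hb
    rw [abs_mul, abs_of_pos hs]
    change _ ≤ 16 * wsum (fun j => Z j p.2) p.1 (αhat p.1 p.2) û ^ 2 * (η * r) /
      wsum (fun j => Z j p.2) p.1 (αhat p.1 p.2) (fun j => û j ^ 2) ^ 2 *
      wsum (fun j => Z j p.2) p.1 (αhat p.1 p.2) (fun j => |û j * y1 (Z j p.2)|) at hb
    set N := wsum (fun j => Z j p.2) p.1 (αhat p.1 p.2) û
    have hN2 : r ^ 2 * N ^ 2 ≤ L ^ 2 := by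
      have := pow_le_pow_left₀ (by positivity) h2 2
      rwa [mul_pow, sq_abs] at this
    have hc1 := h1.1
    calc r * |muHat (fun j => Z j p.2) p.1 (phat₁ p.1 p.2) -
          leadingTerm m₁ (fun j => Z j p.2) p.1 (αhat p.1 p.2) (βhat₁ p.1 p.2)|
        ≤ r * (16 * N ^ 2 * (η * r) / c ^ 2 * (|D + B| + 1)) := by
          refine mul_le_mul_of_nonneg_left (hb.trans ?_) hs.le
          gcongr
          · exact wsum_nonneg fun j => abs_nonneg _
          · linarith [le_abs_self (D + B)]
      _ = η * (16 * (r ^ 2 * N ^ 2) / c ^ 2 * (|D + B| + 1)) := by ring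
      _ ≤ ε / 2 / E * (16 * L ^ 2 / c ^ 2 * (|D + B| + 1)) := by gcongr
      _ = ε / 2 := div_mul_cancel₀ _ hE0.ne'
      _ < ε := by linarith
  refine ⟨hexp, ?_⟩
  -- The regression correction is a bounded coefficient times `∑ ã û = O(n^{-1/2})`, so it does not
  -- affect the limit.
  have hsmall : Tendsto (fun p : ℕ × Ω =>
      leadingTerm m₁ (fun j => Z j p.2) p.1 (αhat p.1 p.2) (βhat₁ p.1 p.2) -
      wsum (fun j => Z j p.2) p.1 (αhat p.1 p.2) (fun j => y1 (Z j p.2))) l (𝓝 0) := by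
    rw [Metric.tendsto_nhds]
    intro ε hε
    filter_upwards [hcal, hD, hNrate, hWbound,
      R.tendsto_sqrt.eventually_gt_atTop ((|D + B| + 1) / c * L / ε),
      R.tendsto_sqrt.eventually_gt_atTop 0] with p ⟨lam, hlam⟩ h1 h2 h3 h4 hs
    rw [Real.dist_eq, sub_zero]
    set û := uHat m₁ (fun i => Z i p.2) p.1 (βhat₁ p.1 p.2) with hû
    have h5 := wsum_uHat (m := m₁) (a := αhat p.1 p.2) (β := βhat₁ p.1 p.2) hlam.nonempty
    have h6 : leadingTerm m₁ (fun j => Z j p.2) p.1 (αhat p.1 p.2) (βhat₁ p.1 p.2) -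
        wsum (fun j => Z j p.2) p.1 (αhat p.1 p.2) (fun j => y1 (Z j p.2)) =
        -((wsum (fun j => Z j p.2) p.1 (αhat p.1 p.2) fun j => û j * y1 (Z j p.2)) *
          (wsum (fun j => Z j p.2) p.1 (αhat p.1 p.2) fun j => û j ^ 2)⁻¹ *
          wsum (fun j => Z j p.2) p.1 (αhat p.1 p.2) û) := by
      rw [hû, h5, leadingTerm, BHat]
      simp only [wsum, mul_assoc]
      ring
    have h7 := (abs_wsum_le (fun j => Z j p.2) p.1 (αhat p.1 p.2)
      fun j => û j * y1 (Z j p.2)).trans h3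
    rw [h6, abs_neg, abs_mul, abs_mul, abs_inv, abs_of_pos (hc.trans_le h1.1)]
    rw [div_lt_iff₀ hε] at h4
    have hc1 := h1.1
    have h8 : |wsum (fun j => Z j p.2) p.1 (αhat p.1 p.2) fun j => û j * y1 (Z j p.2)| *
        (wsum (fun j => Z j p.2) p.1 (αhat p.1 p.2) fun j => û j ^ 2)⁻¹ ≤ (|D + B| + 1) / c := by
      rw [div_eq_mul_inv]
      gcongr
      · exact inv_nonneg.2 (hc.le.trans hc1)
      · linarith [le_abs_self (D + B)]
    refine lt_of_mul_lt_mul_left ?_ hs.le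
    calc √(p.1 : ℝ) * (|wsum (fun j => Z j p.2) p.1 (αhat p.1 p.2) fun j => û j * y1 (Z j p.2)| *
        (wsum (fun j => Z j p.2) p.1 (αhat p.1 p.2) fun j => û j ^ 2)⁻¹ *
        |wsum (fun j => Z j p.2) p.1 (αhat p.1 p.2) û|)
        ≤ √(p.1 : ℝ) * ((|D + B| + 1) / c *
          |wsum (fun j => Z j p.2) p.1 (αhat p.1 p.2) û|) := by gcongr
      _ = (|D + B| + 1) / c * (√(p.1 : ℝ) *
          |wsum (fun j => Z j p.2) p.1 (αhat p.1 p.2) û|) := by ring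
      _ ≤ (|D + B| + 1) / c * L := by gcongr
      _ < √(p.1 : ℝ) * ε := h4
  have hdiff : Tendsto (fun p : ℕ × Ω => muHat (fun j => Z j p.2) p.1 (phat₁ p.1 p.2) -
      leadingTerm m₁ (fun j => Z j p.2) p.1 (αhat p.1 p.2) (βhat₁ p.1 p.2)) l (𝓝 0) := by
    have h1 := hexp.mul (tendsto_inv_atTop_zero.comp R.tendsto_sqrt)
    rw [zero_mul] at h1
    refine h1.congr' ?_
    filter_upwards [R.tendsto_sqrt.eventually_gt_atTop 0] with p hs
    simp only [Function.comp]
    field_simp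
  have hall := (hdiff.add hsmall).add hyLim
  simp only [zero_add, add_zero] at hall
  refine hall.congr fun p => ?_
  ring

end Regimes

end PELCausal

namespace PELCausal

/-! ### Tilted weights -/

/-- `p` are the weights `aⱼ / (1 - ρ vⱼ)` that calibrate `v` to zero. -/
structure IsTilted (s : Finset ℕ) (a v p : ℕ → ℝ) (ρ : ℝ) : Prop where
  nonneg : ∀ j ∈ s, 0 ≤ a j
  sum_one : ∑ j ∈ s, a j = 1
  pos : ∀ j ∈ s, 0 < 1 - ρ * v j
  root : ∑ j ∈ s, a j * v j / (1 - ρ * v j) = 0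
  form : ∀ j ∈ s, p j = a j / (1 - ρ * v j)

namespace IsTilted

variable {s : Finset ℕ} {a v p : ℕ → ℝ} {ρ : ℝ}

theorem p_nonneg (h : IsTilted s a v p ρ) {j : ℕ} (hj : j ∈ s) : 0 ≤ p j := by
  rw [h.form j hj]
  exact div_nonneg (h.nonneg j hj) (h.pos j hj).le

theorem sum_p (h : IsTilted s a v p ρ) : ∑ j ∈ s, p j = 1 := by
  have hlt : ∀ j ∈ s, 0 < 1 + -ρ * v j := fun j hj => by
    rw [neg_mul, ← sub_eq_add_neg]; exact h.pos j hj
  have hroot : ∑ j ∈ s, a j * v j / (1 + -ρ * v j) = 0 := by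
    simp only [neg_mul, ← sub_eq_add_neg]; exact h.root
  rw [← sum_multiplier_weights h.sum_one hlt hroot]
  refine Finset.sum_congr rfl fun j hj => ?_
  rw [h.form j hj, neg_mul, ← sub_eq_add_neg]

theorem sum_p_mul (h : IsTilted s a v p ρ) : ∑ j ∈ s, p j * v j = 0 := by
  rw [← h.root]
  refine Finset.sum_congr rfl fun j hj => ?_
  rw [h.form j hj, div_mul_eq_mul_div]

/-- Since `p` calibrates `v` to zero, its positive and negative parts have the same mean under `p`.
Where `v ≤ 0` the denominator is at least `1`, so `p ≤ a`. Thus the mean of the positive part stays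
bounded even if single weights do not. -/
theorem sum_p_mul_max_le (h : IsTilted s a v p ρ) (hρ : 0 ≤ ρ) :
    ∑ j ∈ s, p j * max (v j) 0 ≤ ∑ j ∈ s, a j * |v j| := by
  have h1 : ∑ j ∈ s, p j * max (v j) 0 = ∑ j ∈ s, p j * max (-v j) 0 := by
    rw [← sub_eq_zero, ← Finset.sum_sub_distrib]
    refine (Finset.sum_congr rfl fun j _ => ?_).trans h.sum_p_mul
    rw [← mul_sub]
    congr 1
    rcases le_total 0 (v j) with hv | hv
    · rw [max_eq_left hv, max_eq_right (by linarith), sub_zero]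
    · rw [max_eq_right hv, max_eq_left (by linarith), zero_sub, neg_neg]
  rw [h1]
  refine Finset.sum_le_sum fun j hj => ?_
  rcases le_total 0 (v j) with hv | hv
  · rw [max_eq_right (by linarith), mul_zero]
    exact mul_nonneg (h.nonneg j hj) (abs_nonneg _)
  · rw [max_eq_left (by linarith), abs_of_nonpos hv, h.form j hj]
    refine mul_le_mul_of_nonneg_right (div_le_self (h.nonneg j hj) ?_) (by linarith)
    nlinarith

/-- `ρ ↦ v / (1 - ρ v)` is nondecreasing for either sign of `v`, so the calibration sum can be
positive only at or beyond its root. The next lemma is the comparison with `ρ₁ = 0`. -/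
theorem le_of_sum_pos (h : IsTilted s a v p ρ) {ρ₁ : ℝ} (h1 : ∀ j ∈ s, 0 < 1 - ρ₁ * v j)
    (hs : 0 < ∑ j ∈ s, a j * (v j / (1 - ρ₁ * v j))) : ρ ≤ ρ₁ := by
  by_contra hcon
  push Not at hcon
  have h2 : ∑ j ∈ s, a j * (v j / (1 - ρ₁ * v j)) ≤ ∑ j ∈ s, a j * v j / (1 - ρ * v j) := by
    refine Finset.sum_le_sum fun j hj => ?_
    rw [mul_div_assoc]
    refine mul_le_mul_of_nonneg_left ?_ (h.nonneg j hj)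
    rw [div_le_div_iff₀ (h1 j hj) (h.pos j hj)]
    nlinarith [mul_nonneg (sub_nonneg.2 hcon.le) (sq_nonneg (v j))]
  rw [h.root] at h2
  linarith

theorem nonneg_of_sum_neg (h : IsTilted s a v p ρ) (hs : ∑ j ∈ s, a j * v j < 0) : 0 ≤ ρ := by
  by_contra hcon
  push Not at hcon
  have h2 : ∑ j ∈ s, a j * v j / (1 - ρ * v j) ≤ ∑ j ∈ s, a j * v j := by
    refine Finset.sum_le_sum fun j hj => ?_
    rw [mul_div_assoc]
    refine mul_le_mul_of_nonneg_left ?_ (h.nonneg j hj)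
    rw [div_le_iff₀ (h.pos j hj)]
    nlinarith [mul_nonneg (neg_nonneg.2 hcon.le) (sq_nonneg (v j))]
  rw [h.root] at h2
  linarith

/-- A bound for a tilted sum: the indices in `g` are compared with the tilting by `w`, and the
other ones either have bounded tilting or small residuals. -/
theorem abs_sum_le (h : IsTilted s a v p ρ) {w e I : ℕ → ℝ} {g : ℕ → Prop} [DecidablePred g]
    {Λ r κ κ' ε : ℝ} (hρ : 0 ≤ ρ) (hΛ : ρ ≤ Λ) (hr : ∀ j ∈ s, |v j - w j| ≤ r) (hκ : 0 < κ)
    (hκ' : 0 < κ') (hε : 0 ≤ ε) (hI : ∀ j, 0 ≤ I j)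
    (hg : ∀ j ∈ s, g j → κ ≤ 1 - ρ * v j ∧ κ ≤ 1 - ρ * w j)
    (hng : ∀ j ∈ s, ¬ g j → (κ' ≤ 1 - ρ * v j ∧ |e j| ≤ I j) ∨ |e j| ≤ ε * w j) :
    |∑ j ∈ s, p j * e j| ≤ |∑ j ∈ s, a j * (if g j then e j / (1 - ρ * w j) else 0)| +
      Λ * r / κ ^ 2 * ∑ j ∈ s, a j * |e j| + 1 / κ' * ∑ j ∈ s, a j * I j +
      ε * (∑ j ∈ s, a j * |v j| + r) := by
  have hΛ0 : 0 ≤ Λ := hρ.trans hΛ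
  have hterm : ∀ j ∈ s, |p j * e j - a j * (if g j then e j / (1 - ρ * w j) else 0)| ≤
      Λ * r / κ ^ 2 * (a j * |e j|) + 1 / κ' * (a j * I j) +
        ε * (p j * max (v j) 0 + p j * r) := by
    intro j hj
    have ha := h.nonneg j hj
    have hp := h.p_nonneg hj
    have hr0 : 0 ≤ r := (abs_nonneg _).trans (hr j hj)
    have t1 : 0 ≤ Λ * r / κ ^ 2 * (a j * |e j|) := by positivity
    have t2 : 0 ≤ 1 / κ' * (a j * I j) := mul_nonneg (by positivity) (mul_nonneg ha (hI j))
    have t3 : 0 ≤ ε * (p j * max (v j) 0 + p j * r) :=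
      mul_nonneg hε (add_nonneg (mul_nonneg hp (le_max_right _ _)) (mul_nonneg hp hr0))
    by_cases hgj : g j
    · obtain ⟨k1, k2⟩ := hg j hj hgj
      rw [if_pos hgj]
      have k1' := hκ.trans_le k1
      have k2' := hκ.trans_le k2
      -- Difference of two reciprocals; both denominators are at least `κ`.
      have heq : a j / (1 - ρ * v j) * e j - a j * (e j / (1 - ρ * w j)) =
          a j * e j * (ρ * (v j - w j)) / ((1 - ρ * v j) * (1 - ρ * w j)) := by
        rw [eq_div_iff (mul_pos k1' k2').ne']
        field_simp
        ring
      have hb : |p j * e j - a j * (e j / (1 - ρ * w j))| ≤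
          Λ * r / κ ^ 2 * (a j * |e j|) := by
        rw [h.form j hj, heq, abs_div, abs_mul, abs_mul, abs_mul, abs_of_nonneg ha,
          abs_of_nonneg hρ,
          abs_of_pos (mul_pos k1' k2')]
        calc a j * |e j| * (ρ * |v j - w j|) / ((1 - ρ * v j) * (1 - ρ * w j))
            ≤ a j * |e j| * (Λ * r) / (κ * κ) := by
              gcongr
              exact hr j hj
          _ = Λ * r / κ ^ 2 * (a j * |e j|) := by ring
      linarith
    · rw [if_neg hgj, mul_zero, sub_zero, abs_mul, abs_of_nonneg hp]
      rcases hng j hj hgj with ⟨k1, k2⟩ | k2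
      · have hb : p j * |e j| ≤ 1 / κ' * (a j * I j) := by
          rw [h.form j hj]
          calc a j / (1 - ρ * v j) * |e j| ≤ a j / κ' * I j := by gcongr
            _ = 1 / κ' * (a j * I j) := by ring
        linarith
      · have hb : p j * |e j| ≤ ε * (p j * max (v j) 0 + p j * r) := by
          have k3 : w j ≤ max (v j) 0 + r := by
            linarith [(abs_le.1 (hr j hj)).1, le_max_left (v j) 0]
          calc p j * |e j| ≤ p j * (ε * (max (v j) 0 + r)) := by
                gcongr
                exact k2.trans (mul_le_mul_of_nonneg_left k3 hε)
            _ = ε * (p j * max (v j) 0 + p j * r) := by ring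
        linarith
  have hsum := (Finset.abs_sum_le_sum_abs _ _).trans (Finset.sum_le_sum hterm)
  rw [Finset.sum_sub_distrib, Finset.sum_add_distrib, Finset.sum_add_distrib, ← Finset.mul_sum,
    ← Finset.mul_sum, ← Finset.mul_sum, Finset.sum_add_distrib, ← Finset.sum_mul, h.sum_p,
    one_mul] at hsum
  have h1 := abs_sub_abs_le_abs_sub (∑ j ∈ s, p j * e j)
    (∑ j ∈ s, a j * (if g j then e j / (1 - ρ * w j) else 0))
  have h2 := mul_le_mul_of_nonneg_left (add_le_add (h.sum_p_mul_max_le hρ) (le_refl r)) hε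
  linarith

end IsTilted

/-- The sign `s` is chosen later so that the tilt `ρ = -s λ` is nonnegative, which treats both signs
of the gap together. -/
theorem IsCalibrated.isTilted {d q : ℕ}
    {m : EuclideanSpace ℝ (Fin d) → EuclideanSpace ℝ (Fin q) → ℝ} {z : ℕ → Obs d} {n : ℕ}
    {α : EuclideanSpace ℝ (Fin (d + 1))} {β : EuclideanSpace ℝ (Fin q)} {p : ℕ → ℝ} {lam : ℝ}
    (h : IsCalibrated m z n α β p lam) {s : ℝ} (hs : s * s = 1) :
    IsTilted (S1 z n) (a1 z n α) (fun j => s * uHat m z n β j) p (-s * lam) := by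
  have h1 : ∀ j, 1 - -s * lam * (s * uHat m z n β j) = 1 + lam * uHat m z n β j := fun j => by
    linear_combination (lam * uHat m z n β j) * hs
  refine ⟨fun j _ => a1_nonneg z n α j, sum_a1 h.nonempty, fun j hj => ?_, ?_, fun j hj => ?_⟩
  · rw [h1]; exact h.pos j hj
  · simp only [h1]
    have h2 : ∀ j, a1 z n α j * (s * uHat m z n β j) / (1 + lam * uHat m z n β j) =
        s * (a1 z n α j * uHat m z n β j / (1 + lam * uHat m z n β j)) := fun j => by ring
    simp only [h2]
    rw [← Finset.mul_sum, h.root, mul_zero]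
  · rw [h1]; exact h.form j hj

section Misspecified

variable {d q : ℕ} {Ω : Type*} [MeasurableSpace Ω] {μ : Measure Ω} [IsProbabilityMeasure μ]
  {P : Measure (Obs d)} [IsProbabilityMeasure P] {Z : ℕ → Ω → Obs d}
  {α : EuclideanSpace ℝ (Fin (d + 1))} {αhat : ℕ → Ω → EuclideanSpace ℝ (Fin (d + 1))}
  {m : EuclideanSpace ℝ (Fin d) → EuclideanSpace ℝ (Fin q) → ℝ}
  {β : EuclideanSpace ℝ (Fin q)} {βhat : ℕ → Ω → EuclideanSpace ℝ (Fin q)}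
  {phat : ℕ → Ω → ℕ → ℝ} {l : Filter (ℕ × Ω)}

/-- The residual `Y₁ - m(x; β)`. -/
def resid (m : EuclideanSpace ℝ (Fin d) → EuclideanSpace ℝ (Fin q) → ℝ)
    (β : EuclideanSpace ℝ (Fin q)) (z : Obs d) : ℝ := y1 z - fit m β z

theorem memLp_resid (hY : MemLp (y1 : Obs d → ℝ) 2 P)
    (hfit : MemLp (fit m β : Obs d → ℝ) 2 P) : MemLp (resid m β : Obs d → ℝ) 2 P := hY.sub hfit

/-- The inverse probability weighted mean of the residuals times a bounded function of the
covariates vanishes. -/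
theorem ipwMean_resid_mul (hS : SITA P) (hov : Overlap P α)
    (hY : MemLp (y1 : Obs d → ℝ) 2 P) (hfit : MemLp (fit m β : Obs d → ℝ) 2 P)
    (hm : Measurable fun x => m x β) (hOR : ORCorrect P m β)
    {g : EuclideanSpace ℝ (Fin d) → ℝ} (hg : Measurable g) {K : ℝ}
    (hK : ∀ᵐ z ∂P, |g (cov z)| ≤ K) :
    Integrable (fun z : Obs d => resid m β z * g (cov z)) P ∧
      ipwMean P α (fun z => resid m β z * g (cov z)) = 0 := by
  have hy := hY.integrable (q := 2) (by norm_num)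
  have hf := hfit.integrable (q := 2) (by norm_num)
  have hgm : AEStronglyMeasurable (fun z : Obs d => g (cov z)) P :=
    (hg.comp measurable_cov).aestronglyMeasurable
  have hi : Integrable (fun z : Obs d => resid m β z * g (cov z)) P :=
    (hy.sub hf).mul_bdd hgm hK
  refine ⟨hi, ?_⟩
  obtain ⟨b, hb, hbz⟩ := hov.exists_bound
  have hτm : Measurable fun x : EuclideanSpace ℝ (Fin d) => (tau x α)⁻¹ := (measurable_tau α).inv
  have hi2 : Integrable (fun z : Obs d => (y1 z - fit m β z) *
      ((tau (cov z) α)⁻¹ * g (cov z))) P := by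
    have h1 : Integrable (fun z : Obs d => (tau (cov z) α)⁻¹ *
        (resid m β z * g (cov z))) P := by
      refine hi.bdd_mul (c := b) (hτm.comp measurable_cov).aestronglyMeasurable ?_
      filter_upwards [hbz] with z hz
      rw [Real.norm_of_nonneg (inv_pos.2 (tau_pos _ _)).le]
      exact hz
    refine h1.congr (ae_of_all _ fun z => ?_)
    simp only [resid]
    ring
  have h2 := hS.integral_trtInd_mul_resid hm hOR hy hf (hτm.mul hg) hi2
  unfold ipwMean
  rw [div_eq_zero_iff]
  left
  rw [← h2]
  refine integral_congr_ae (ae_of_all _ fun z => ?_)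
  simp only [resid, Pi.mul_apply]
  ring

open Classical in
/-- A uniform law of large numbers for the tilted residuals. -/
theorem tilted_resid_uniform (hS : SITA P) (hY : MemLp (y1 : Obs d → ℝ) 2 P)
    (hfit : MemLp (fit m β : Obs d → ℝ) 2 P) (hm : Measurable fun x => m x β)
    (hOR : ORCorrect P m β) (R : MLERegime μ P Z α αhat l)
    {G : Set (EuclideanSpace ℝ (Fin d))} (hG : MeasurableSet G) {Λ κ s : ℝ} (hs : |s| = 1)
    (hκ : 0 < κ)
    (hκG : ∀ᵐ z ∂P, cov z ∈ G → ∀ ρ ∈ Set.Icc 0 Λ, κ ≤ 1 - ρ * (s * popU P m β z))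
    {ε : ℝ} (hε : 0 < ε) :
    ∀ᶠ p in l, ∀ ρ ∈ Set.Icc 0 Λ, |wsum (fun j => Z j p.2) p.1 (αhat p.1 p.2) fun j =>
      if cov (Z j p.2) ∈ G then
        resid m β (Z j p.2) / (1 - ρ * (s * popU P m β (Z j p.2))) else 0| ≤ ε := by
  have heu : Integrable (fun z => |resid m β z * popU P m β z|) P :=
    ((memLp_resid hY hfit).integrable_mul (memLp_popU hfit)).abs
  set Q := |(ipwMean P α fun z => |resid m β z * popU P m β z|)| + 1 with hQ
  have hQ0 : 0 < Q := by positivity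
  -- The tilted residual sum is Lipschitz in `ρ` with constant at most `Q / κ ^ 2`, so this radius
  -- costs at most `ε / 2` between the points of a finite net.
  obtain ⟨t, htS, htfin, hcover⟩ :=
    (isCompact_Icc (a := (0 : ℝ)) (b := Λ)).finite_cover_balls
      (show 0 < ε / 2 * κ ^ 2 / Q by positivity)
  have hpoint : ∀ ρ ∈ t, ∀ᶠ p in l, |wsum (fun j => Z j p.2) p.1 (αhat p.1 p.2) fun j =>
      if cov (Z j p.2) ∈ G then
        resid m β (Z j p.2) / (1 - ρ * (s * popU P m β (Z j p.2))) else 0| < ε / 2 := by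
    intro ρ hρ
    have hgm : Measurable fun x => if x ∈ G then
        (1 - ρ * (s * (m x β - ∫ z', fit m β z' ∂P)))⁻¹ else 0 :=
      Measurable.ite hG
        (measurable_const.sub (((hm.sub_const _).const_mul s).const_mul ρ)).inv measurable_const
    have hbd : ∀ᵐ z : Obs d ∂P, |(fun x => if x ∈ G then
        (1 - ρ * (s * (m x β - ∫ z', fit m β z' ∂P)))⁻¹ else 0) (cov z)| ≤ κ⁻¹ := by
      filter_upwards [hκG] with z hz
      split_ifs with h
      · have h1 := hz h ρ (htS hρ)
        change κ ≤ 1 - ρ * (s * (m (cov z) β - _)) at h1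
        rw [abs_inv, abs_of_pos (hκ.trans_le h1)]
        exact inv_anti₀ hκ h1
      · simp [hκ.le]
    obtain ⟨hi, h0⟩ := ipwMean_resid_mul (α := α) hS R.overlap hY hfit hm hOR hgm hbd
    have hlim := R.tendsto_wsum hi
    rw [h0] at hlim
    have h1 := hlim.abs.eventually (gt_mem_nhds (show |(0 : ℝ)| < ε / 2 by simpa using hε))
    refine h1.mono fun p hp => ?_
    refine lt_of_eq_of_lt ?_ hp
    congr 2
    funext j
    split_ifs with h
    · rw [div_eq_mul_inv]
      rfl
    · simp
  filter_upwards [(htfin.eventually_all).2 hpoint, R.le (R.iid.eventually hκG),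
    (R.tendsto_wsum heu).eventually (gt_mem_nhds (lt_add_one _))] with p h1 h2 h3 ρ hρ
  obtain ⟨ρ', hρ't, hball⟩ := Set.mem_iUnion₂.1 (hcover hρ)
  have hρ' := htS hρ't
  rw [Metric.mem_ball, Real.dist_eq] at hball
  have hdiff : |(wsum (fun j => Z j p.2) p.1 (αhat p.1 p.2) fun j =>
      if cov (Z j p.2) ∈ G then
        resid m β (Z j p.2) / (1 - ρ * (s * popU P m β (Z j p.2))) else 0) -
      wsum (fun j => Z j p.2) p.1 (αhat p.1 p.2) fun j =>
      if cov (Z j p.2) ∈ G then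
        resid m β (Z j p.2) / (1 - ρ' * (s * popU P m β (Z j p.2))) else 0| ≤
      (ε / 2 * κ ^ 2 / Q) / κ ^ 2 * wsum (fun j => Z j p.2) p.1 (αhat p.1 p.2) fun j =>
        |resid m β (Z j p.2) * popU P m β (Z j p.2)| := by
    rw [← wsum_const_mul, sub_eq_add_neg, ← neg_one_mul, ← wsum_const_mul, ← wsum_add]
    refine (abs_wsum_le _ _ _ _).trans (wsum_mono fun j _ => ?_)
    split_ifs with h
    · have k1 := h2 j h ρ hρ
      have k2 := h2 j h ρ' hρ'
      have k1' := hκ.trans_le k1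
      have k2' := hκ.trans_le k2
      set e := resid m β (Z j p.2)
      set u := popU P m β (Z j p.2)
      have heq : e / (1 - ρ * (s * u)) + -1 * (e / (1 - ρ' * (s * u))) =
          (ρ - ρ') * s * (e * u) / ((1 - ρ * (s * u)) * (1 - ρ' * (s * u))) := by
        rw [neg_one_mul, ← sub_eq_add_neg, div_sub_div _ _ k1'.ne' k2'.ne']
        congr 1
        ring
      rw [heq, abs_div, abs_mul, abs_mul (ρ - ρ'), hs, mul_one, abs_of_pos (mul_pos k1' k2')]
      calc |ρ - ρ'| * |e * u| / ((1 - ρ * (s * u)) * (1 - ρ' * (s * u)))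
          ≤ ε / 2 * κ ^ 2 / Q * |e * u| / (κ * κ) := by gcongr
        _ = (ε / 2 * κ ^ 2 / Q) / κ ^ 2 * |e * u| := by ring
    · simp only [mul_zero, add_zero, abs_zero]
      positivity
  have hfin : (ε / 2 * κ ^ 2 / Q) / κ ^ 2 * (wsum (fun j => Z j p.2) p.1 (αhat p.1 p.2) fun j =>
        |resid m β (Z j p.2) * popU P m β (Z j p.2)|) ≤ ε / 2 := by
    calc (ε / 2 * κ ^ 2 / Q) / κ ^ 2 * (wsum (fun j => Z j p.2) p.1 (αhat p.1 p.2) fun j =>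
          |resid m β (Z j p.2) * popU P m β (Z j p.2)|)
        ≤ (ε / 2 * κ ^ 2 / Q) / κ ^ 2 * Q := by
          gcongr
          rw [hQ]
          linarith [le_abs_self (ipwMean P α fun z => |resid m β z * popU P m β z|)]
      _ = ε / 2 := by field_simp
  have h4 := abs_sub_abs_le_abs_sub (wsum (fun j => Z j p.2) p.1 (αhat p.1 p.2) fun j =>
      if cov (Z j p.2) ∈ G then
        resid m β (Z j p.2) / (1 - ρ * (s * popU P m β (Z j p.2))) else 0)
      (wsum (fun j => Z j p.2) p.1 (αhat p.1 p.2) fun j =>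
      if cov (Z j p.2) ∈ G then
        resid m β (Z j p.2) / (1 - ρ' * (s * popU P m β (Z j p.2))) else 0)
  linarith [h1 ρ' hρ't]

end Misspecified

end PELCausal

namespace PELCausal

/-! ### Consistency under a correct outcome regression model -/

section Misspecified

variable {d q : ℕ} {Ω : Type*} [MeasurableSpace Ω] {μ : Measure Ω} [IsProbabilityMeasure μ]
  {P : Measure (Obs d)} [IsProbabilityMeasure P] {Z : ℕ → Ω → Obs d}
  {α : EuclideanSpace ℝ (Fin (d + 1))} {αhat : ℕ → Ω → EuclideanSpace ℝ (Fin (d + 1))}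
  {m : EuclideanSpace ℝ (Fin d) → EuclideanSpace ℝ (Fin q) → ℝ}
  {β : EuclideanSpace ℝ (Fin q)} {βhat : ℕ → Ω → EuclideanSpace ℝ (Fin q)}
  {phat : ℕ → Ω → ℕ → ℝ} {l : Filter (ℕ × Ω)}

theorem integral_y1_eq_of_orCorrect (hOR : ORCorrect P m β) :
    ∫ z, y1 z ∂P = ∫ z, fit m β z ∂P := by
  rw [← integral_condExp (covSigma_le d)]
  exact integral_congr_ae hOR

/-- The error of the calibrated mean is a tilted sum of residuals, up to the error of the centred
regression values. -/
theorem IsCalibrated.abs_muHat_sub_le {z : ℕ → Obs d} {n : ℕ}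
    {a : EuclideanSpace ℝ (Fin (d + 1))} {b : EuclideanSpace ℝ (Fin q)} {p : ℕ → ℝ} {lam : ℝ}
    (h : IsCalibrated m z n a b p lam) {r : ℝ}
    (hr : ∀ j ∈ S1 z n, |uHat m z n b j - popU P m β (z j)| ≤ r) :
    |muHat z n p - ∫ z', fit m β z' ∂P| ≤ |∑ j ∈ S1 z n, p j * resid m β (z j)| + r := by
  have t := h.isTilted (mul_one (1 : ℝ))
  have h1 : muHat z n p - ∫ z', fit m β z' ∂P = ∑ j ∈ S1 z n, p j * resid m β (z j) +
      ∑ j ∈ S1 z n, p j * (popU P m β (z j) - uHat m z n b j) := by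
    have h2 : ∑ j ∈ S1 z n, p j * (popU P m β (z j) - uHat m z n b j) =
        ∑ j ∈ S1 z n, p j * popU P m β (z j) := by
      have h3 := t.sum_p_mul
      simp only [one_mul] at h3
      simp only [mul_sub, Finset.sum_sub_distrib, h3, sub_zero]
    have h4 : ∑ j ∈ S1 z n, p j * ∫ z', fit m β z' ∂P = ∫ z', fit m β z' ∂P := by
      rw [← Finset.sum_mul, t.sum_p, one_mul]
    rw [h2, ← Finset.sum_add_distrib, muHat]
    nth_rewrite 1 [← h4]
    rw [← Finset.sum_sub_distrib]
    refine Finset.sum_congr rfl fun j _ => ?_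
    unfold resid popU
    ring
  have h5 : |∑ j ∈ S1 z n, p j * (popU P m β (z j) - uHat m z n b j)| ≤ r := by
    calc |∑ j ∈ S1 z n, p j * (popU P m β (z j) - uHat m z n b j)|
        ≤ ∑ j ∈ S1 z n, p j * r := by
          refine (Finset.abs_sum_le_sum_abs _ _).trans (Finset.sum_le_sum fun j hj => ?_)
          rw [abs_mul, abs_of_nonneg (t.p_nonneg hj), abs_sub_comm]
          exact mul_le_mul_of_nonneg_left (hr j hj) (t.p_nonneg hj)
      _ = r := by rw [← Finset.sum_mul, t.sum_p, one_mul]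
  rw [h1]
  exact (abs_add_le _ _).trans (add_le_add le_rfl h5)

/-- Control of the tilting: it is bounded on the covariate set `G`, and outside of `G` either it
is bounded and the residuals are dominated by `I`, or the residuals are small. -/
structure TiltControl (P : Measure (Obs d)) (Z : ℕ → Ω → Obs d)
    (m : EuclideanSpace ℝ (Fin d) → EuclideanSpace ℝ (Fin q) → ℝ)
    (α : EuclideanSpace ℝ (Fin (d + 1))) (β : EuclideanSpace ℝ (Fin q))
    (αhat : ℕ → Ω → EuclideanSpace ℝ (Fin (d + 1))) (βhat : ℕ → Ω → EuclideanSpace ℝ (Fin q))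
    (phat : ℕ → Ω → ℕ → ℝ) (l : Filter (ℕ × Ω)) (s ε : ℝ)
    (G : Set (EuclideanSpace ℝ (Fin d))) (Λ κ κ' : ℝ) (I : Obs d → ℝ) : Prop where
  meas : MeasurableSet G
  pos : 0 < κ
  pos' : 0 < κ'
  nonneg : ∀ z, 0 ≤ I z
  integrable : Integrable I P
  mean_le : ipwMean P α I ≤ ε * κ'
  limit : ∀ᵐ z ∂P, cov z ∈ G → ∀ ρ ∈ Set.Icc 0 Λ, κ ≤ 1 - ρ * (s * popU P m β z)
  sample : ∀ᶠ p in l, ∀ lam, IsCalibrated m (fun j => Z j p.2) p.1 (αhat p.1 p.2)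
    (βhat p.1 p.2) (phat p.1 p.2) lam → 0 ≤ -s * lam ∧ -s * lam ≤ Λ ∧
      ∀ j ∈ S1 (fun i => Z i p.2) p.1,
        (cov (Z j p.2) ∈ G →
          κ ≤ 1 - -s * lam * (s * uHat m (fun i => Z i p.2) p.1 (βhat p.1 p.2) j)) ∧
        (cov (Z j p.2) ∉ G →
          (κ' ≤ 1 - -s * lam * (s * uHat m (fun i => Z i p.2) p.1 (βhat p.1 p.2) j) ∧
            |resid m β (Z j p.2)| ≤ I (Z j p.2)) ∨
          |resid m β (Z j p.2)| ≤ ε * (s * popU P m β (Z j p.2)))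

theorem sq_eq_one_of_abs {s : ℝ} (hs : |s| = 1) : s * s = 1 := by
  rw [← abs_mul_abs_self, hs, one_mul]

/-- The four terms of `IsTilted.abs_sum_le` are made small by, in order, the uniform law of large
numbers, uniform convergence of `û`, the mean bound on `I`, and the bounded second moment of `û`. -/
theorem tendsto_muHat_of_tiltControl (hS : SITA P) (hpos : Positivity P)
    (hY : MemLp (y1 : Obs d → ℝ) 2 P) (hOR : ORCorrect P m β) (hgrad : GradientDominated P m β 2)
    (R : MLERegime μ P Z α αhat l) (R₁ : ORRegime μ P Z m β βhat l)
    (hcal : ∀ᶠ p in l, ∃ lam, IsCalibrated m (fun j => Z j p.2) p.1 (αhat p.1 p.2)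
      (βhat p.1 p.2) (phat p.1 p.2) lam) {s : ℝ} (hs : |s| = 1)
    (H : ∀ ε : ℝ, 0 < ε → ∃ G Λ κ κ' I, TiltControl P Z m α β αhat βhat phat l s ε G Λ κ κ' I) :
    Tendsto (fun p : ℕ × Ω => muHat (fun j => Z j p.2) p.1 (phat p.1 p.2)) l
      (𝓝 (∫ z, y1 z ∂P)) := by
  classical
  rw [integral_y1_eq_of_orCorrect hOR, Metric.tendsto_nhds]
  intro ε₀ hε₀
  obtain ⟨_, C₀, -, hC₀⟩ := wsum_uHat_sq hS hpos R R₁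
  set C := max C₀ 0
  have hC : 0 ≤ C := le_max_right _ _
  -- The pieces add up to at most `(C + 7) ε`, leaving room for strictness.
  set ε := ε₀ / (C + 9) with hεdef
  have hε : 0 < ε := by positivity
  obtain ⟨G, Λ, κ, κ', I, T⟩ := H ε hε
  have hκ := T.pos
  have hκ' := T.pos'
  have hei := (memLp_resid hY R₁.fitSq).integrable (q := 2) (by norm_num)
  set Q := ipwMean P α (fun z => |resid m β z|) + 1
  set r := min ε (min 1 (ε * κ ^ 2 / ((|Λ| + 1) * (|Q| + 1))))
  have hr : 0 < r := by positivity
  filter_upwards [hcal, hC₀, T.sample, R₁.uHat_uniform hgrad hr,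
    tilted_resid_uniform hS hY R₁.fitSq R₁.meas hOR R T.meas hs hκ T.limit hε,
    (R.tendsto_wsum hei.abs).eventually (gt_mem_nhds (lt_add_one _)),
    (R.tendsto_wsum T.integrable).eventually
      (gt_mem_nhds (lt_add_of_pos_right _ (mul_pos hε hκ'))),
    R.le (R.iid.eventually T.limit)]
    with p ⟨lam, hlam⟩ ⟨_, h1⟩ h2 h3 h4 h5 h6 h7
  obtain ⟨hρ, hρΛ, hj⟩ := h2 lam hlam
  have t := hlam.isTilted (sq_eq_one_of_abs hs)
  have hj3 : ∀ j ∈ S1 (fun i => Z i p.2) p.1,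
      |uHat m (fun i => Z i p.2) p.1 (βhat p.1 p.2) j - popU P m β (Z j p.2)| ≤ r :=
    fun j hjS => h3 j (mem_S1.1 hjS).1
  have b1 := hlam.abs_muHat_sub_le hj3
  have b2 := t.abs_sum_le (w := fun j => s * popU P m β (Z j p.2))
    (e := fun j => resid m β (Z j p.2)) (I := fun j => I (Z j p.2))
    (g := fun j => cov (Z j p.2) ∈ G) hρ hρΛ (r := r)
    (fun j hjS => by rw [← mul_sub, abs_mul, hs, one_mul]; exact hj3 j hjS) hκ hκ' hε.le
    (fun j => T.nonneg _) (fun j hjS hG => ⟨(hj j hjS).1 hG, ?_⟩) (fun j hjS hG => (hj j hjS).2 hG)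
  swap
  · exact h7 j hG _ ⟨hρ, hρΛ⟩
  have b3 := h4 _ ⟨hρ, hρΛ⟩
  have hΛ : 0 ≤ Λ := hρ.trans hρΛ
  have hr1 : r ≤ ε := min_le_left _ _
  have hr2 : r ≤ 1 := (min_le_right _ _).trans (min_le_left _ _)
  have hr3 : r ≤ ε * κ ^ 2 / ((|Λ| + 1) * (|Q| + 1)) := (min_le_right _ _).trans (min_le_right _ _)
  have c1 : Λ * r / κ ^ 2 * wsum (fun j => Z j p.2) p.1 (αhat p.1 p.2)
      (fun j => |resid m β (Z j p.2)|) ≤ ε := by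
    rw [le_div_iff₀ (by positivity)] at hr3
    have hw : wsum (fun j => Z j p.2) p.1 (αhat p.1 p.2) (fun j => |resid m β (Z j p.2)|) ≤
        |Q| + 1 := by linarith [le_abs_self Q]
    calc Λ * r / κ ^ 2 * wsum (fun j => Z j p.2) p.1 (αhat p.1 p.2)
          (fun j => |resid m β (Z j p.2)|)
        ≤ (|Λ| + 1) * r / κ ^ 2 * (|Q| + 1) := by
          refine mul_le_mul ?_ hw (wsum_nonneg fun j => abs_nonneg _) (by positivity)
          gcongr
          linarith [le_abs_self Λ]
      _ = r * ((|Λ| + 1) * (|Q| + 1)) / κ ^ 2 := by ring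
      _ ≤ ε * κ ^ 2 / κ ^ 2 := by gcongr
      _ = ε := by field_simp
  have c2 : 1 / κ' * wsum (fun j => Z j p.2) p.1 (αhat p.1 p.2) (fun j => I (Z j p.2)) ≤
      2 * ε := by
    rw [one_div_mul_eq_div, div_le_iff₀ hκ']
    linarith [T.mean_le]
  have c3 : wsum (fun j => Z j p.2) p.1 (αhat p.1 p.2)
      (fun j => |s * uHat m (fun i => Z i p.2) p.1 (βhat p.1 p.2) j|) ≤ 1 + C := by
    calc wsum (fun j => Z j p.2) p.1 (αhat p.1 p.2)
          (fun j => |s * uHat m (fun i => Z i p.2) p.1 (βhat p.1 p.2) j|)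
        ≤ wsum (fun j => Z j p.2) p.1 (αhat p.1 p.2)
          (fun j => 1 + uHat m (fun i => Z i p.2) p.1 (βhat p.1 p.2) j ^ 2) := by
          refine wsum_mono fun j _ => ?_
          rw [abs_mul, hs, one_mul, ← sq_abs (uHat _ _ _ _ _)]
          nlinarith [sq_nonneg (|uHat m (fun i => Z i p.2) p.1 (βhat p.1 p.2) j| - 1)]
      _ ≤ 1 + C := by
          rw [wsum_add, wsum_const _ hlam.nonempty]
          linarith [le_max_left C₀ 0]
  have c4 : ε * (wsum (fun j => Z j p.2) p.1 (αhat p.1 p.2)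
      (fun j => |s * uHat m (fun i => Z i p.2) p.1 (βhat p.1 p.2) j|) + r) ≤ ε * (2 + C) :=
    mul_le_mul_of_nonneg_left (by linarith) hε.le
  have c5 : ε * (C + 9) = ε₀ := by
    rw [hεdef]
    field_simp
  unfold wsum at b3 c1 c2 c4
  rw [Real.dist_eq]
  nlinarith

end Misspecified

end PELCausal

namespace PELCausal

/-! ### Interior population multipliers -/

section Interior

variable {d q : ℕ} {Ω : Type*} [MeasurableSpace Ω] {μ : Measure Ω} [IsProbabilityMeasure μ]
  {P : Measure (Obs d)} [IsProbabilityMeasure P] {Z : ℕ → Ω → Obs d}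
  {α : EuclideanSpace ℝ (Fin (d + 1))} {αhat : ℕ → Ω → EuclideanSpace ℝ (Fin (d + 1))}
  {m : EuclideanSpace ℝ (Fin d) → EuclideanSpace ℝ (Fin q) → ℝ}
  {β : EuclideanSpace ℝ (Fin q)} {βhat : ℕ → Ω → EuclideanSpace ℝ (Fin q)}
  {phat : ℕ → Ω → ℕ → ℝ} {l : Filter (ℕ × Ω)}

theorem calibGap_eq : calibGap P m α β =
    ∫ z, trtInd z * ((tau (cov z) α)⁻¹ * popU P m β z) ∂P :=
  integral_congr_ae (ae_of_all _ fun z => by simp only [div_eq_mul_inv]; ring)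

/-- If the weighted values of `v` are negative on average, then the tilting is nonnegative. -/
theorem tilt_nonneg (hgrad : GradientDominated P m β 2) (R : MLERegime μ P Z α αhat l)
    (R₁ : ORRegime μ P Z m β βhat l) {s : ℝ} (hs : |s| = 1) (hc : s * calibGap P m α β < 0) :
    ∀ᶠ p in l, ∀ lam, IsCalibrated m (fun j => Z j p.2) p.1 (αhat p.1 p.2)
      (βhat p.1 p.2) (phat p.1 p.2) lam → 0 ≤ -s * lam := by
  have hA : s * ipwMean P α (popU P m β) < 0 := by
    unfold ipwMean
    rw [← calibGap_eq, mul_div_assoc']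
    exact div_neg_of_neg_of_pos hc R.ipwMass_pos
  set A := s * ipwMean P α (popU P m β)
  have hlim := (R.tendsto_wsum ((memLp_popU R₁.fitSq).integrable (by norm_num))).const_mul s
  filter_upwards [hlim.eventually (gt_mem_nhds (show A < A / 2 by linarith)),
    R₁.uHat_uniform hgrad (show 0 < -A / 4 by linarith)] with p h1 h2 lam hlam
  refine (hlam.isTilted (sq_eq_one_of_abs hs)).nonneg_of_sum_neg ?_
  have h3 : wsum (fun j => Z j p.2) p.1 (αhat p.1 p.2)
      (fun j => s * uHat m (fun i => Z i p.2) p.1 (βhat p.1 p.2) j) ≤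
      wsum (fun j => Z j p.2) p.1 (αhat p.1 p.2)
        (fun j => s * popU P m β (Z j p.2) + -A / 4) := by
    refine wsum_mono fun j hj => ?_
    have h4 : |s * (uHat m (fun i => Z i p.2) p.1 (βhat p.1 p.2) j - popU P m β (Z j p.2))| ≤
        -A / 4 := by
      rw [abs_mul, hs, one_mul]
      exact h2 j (mem_S1.1 hj).1
    linarith [(abs_le.1 h4).2]
  rw [wsum_add, wsum_const_mul _ _ _ s (fun j => popU P m β (Z j p.2)),
    wsum_const _ hlam.nonempty] at h3
  change wsum (fun j => Z j p.2) p.1 (αhat p.1 p.2)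
      (fun j => s * uHat m (fun i => Z i p.2) p.1 (βhat p.1 p.2) j) < 0
  linarith

theorem div_one_sub_le_div {ρ ρ' v : ℝ} (h : ρ ≤ ρ') (h1 : 0 < 1 - ρ * v) (h2 : 0 < 1 - ρ' * v) :
    v / (1 - ρ * v) ≤ v / (1 - ρ' * v) := by
  rw [div_le_div_iff₀ h1 h2]
  nlinarith [mul_nonneg (sub_nonneg.2 h) (sq_nonneg v)]

theorem one_sub_mul_ge_of_le {ρ ρ' v δ : ℝ} (hδ : δ ≤ 1) (h0 : 0 ≤ ρ) (h : ρ ≤ ρ')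
    (h1 : δ ≤ 1 - ρ' * v) : δ ≤ 1 - ρ * v := by
  rcases le_total v 0 with hv | hv
  · nlinarith [mul_nonneg h0 (neg_nonneg.2 hv)]
  · nlinarith [mul_le_mul_of_nonneg_right h hv]

theorem integrable_tilted_popU (hfit : MemLp (fit m β : Obs d → ℝ) 2 P)
    (hm : Measurable fun x => m x β) {s ρ δ : ℝ} (hδ : 0 < δ)
    (h : ∀ᵐ z ∂P, δ ≤ 1 - ρ * (s * popU P m β z)) :
    Integrable (fun z => s * popU P m β z / (1 - ρ * (s * popU P m β z))) P := by
  have hi := ((memLp_popU hfit).integrable (q := 2) (by norm_num)).const_mul s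
  simp only [div_eq_mul_inv]
  refine hi.mul_bdd (c := δ⁻¹) ?_ ?_
  · exact (measurable_const.sub (((measurable_popU hm).const_mul s).const_mul
      ρ)).inv.aestronglyMeasurable
  · filter_upwards [h] with z hz
    rw [norm_inv, Real.norm_of_nonneg (hδ.le.trans hz)]
    exact inv_anti₀ hδ hz

/-- An interior population multiplier is dominated by a tilting with bounded weights for which the
calibration equation has a positive value. -/
theorem PopMultiplier.exists_tilt (hov : Overlap P α) (hfit : MemLp (fit m β : Obs d → ℝ) 2 P)
    (hm : Measurable fun x => m x β) {lam : ℝ} (h : PopMultiplier P m α β lam) {s : ℝ}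
    (hs : |s| = 1) (hc : s * calibGap P m α β < 0) :
    ∃ ρ δ : ℝ, 0 < ρ ∧ 0 < δ ∧ δ ≤ 1 ∧ (∀ᵐ z ∂P, δ ≤ 1 - ρ * (s * popU P m β z)) ∧
      0 < ∫ z, trtInd z * ((tau (cov z) α)⁻¹ *
        (s * popU P m β z / (1 - ρ * (s * popU P m β z)))) ∂P := by
  obtain ⟨⟨δ₀, hδ₀, hlt⟩, hroot⟩ := h
  have hss := sq_eq_one_of_abs hs
  set ρ₀ := -s * lam with hρ₀
  have e1 : ∀ u, 1 - ρ₀ * (s * u) = 1 + lam * u := fun u => by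
    rw [hρ₀]
    linear_combination (lam * u) * hss
  have hlt' : ∀ᵐ z ∂P, δ₀ ≤ 1 - ρ₀ * (s * popU P m β z) := by simpa only [e1] using hlt
  have hroot' : ∫ z, trtInd z * ((tau (cov z) α)⁻¹ *
      (s * popU P m β z / (1 - ρ₀ * (s * popU P m β z)))) ∂P = 0 := by
    rw [← mul_zero s, ← hroot, ← integral_const_mul]
    refine integral_congr_ae (ae_of_all _ fun z => ?_)
    simp only [e1, div_eq_mul_inv, mul_inv]
    ring
  have hτ : ∀ z : Obs d, 0 ≤ trtInd z * (tau (cov z) α)⁻¹ := fun z =>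
    mul_nonneg (trtInd_nonneg z) (inv_pos.2 (tau_pos _ _)).le
  have hi0 := hov.integrable_weight_mul (integrable_tilted_popU hfit hm hδ₀ hlt')
  have hiu := hov.integrable_weight_mul
    (((memLp_popU hfit).integrable (q := 2) (by norm_num)).const_mul s)
  have hgap : ∫ z, trtInd z * ((tau (cov z) α)⁻¹ * (s * popU P m β z)) ∂P < 0 := by
    refine lt_of_eq_of_lt ?_ hc
    rw [calibGap_eq, ← integral_const_mul]
    exact integral_congr_ae (ae_of_all _ fun z => by simp only; ring)
  -- At tilt zero the calibration integral is the signed gap, which is negative; by monotonicity its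
  -- root lies strictly to the right.
  have hρ : 0 < ρ₀ := by
    by_contra hcon
    push Not at hcon
    refine hgap.not_ge ?_
    rw [← hroot']
    refine integral_mono_ae hi0 hiu ?_
    filter_upwards [hlt'] with z hz
    simp only [← mul_assoc]
    have h1 := div_one_sub_le_div (v := s * popU P m β z) hcon (hδ₀.trans_le hz) (by simp)
    rw [zero_mul, sub_zero, div_one] at h1
    simpa only [mul_assoc] using mul_le_mul_of_nonneg_left h1 (hτ z)
  set δ := min δ₀ (1 / 2)
  have hδ : 0 < δ := by positivity
  have hδ1 : δ ≤ 1 / 2 := min_le_right _ _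
  -- Just beyond the root: `ρ₀ v ≤ 1 - δ` still leaves a denominator of at least `δ / 2`.
  set ρ := ρ₀ * (1 + δ / 2) with hρdef
  have hρlt : ρ₀ < ρ := by
    rw [hρdef]
    nlinarith [mul_pos hρ hδ]
  have hb : ∀ᵐ z ∂P, δ / 2 ≤ 1 - ρ * (s * popU P m β z) := by
    filter_upwards [hlt'] with z hz
    have h1 : δ ≤ 1 - ρ₀ * (s * popU P m β z) := (min_le_left _ _).trans hz
    rw [hρdef]
    nlinarith
  have hi1 := hov.integrable_weight_mul (integrable_tilted_popU hfit hm (half_pos hδ) hb)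
  refine ⟨ρ, δ / 2, hρ.trans hρlt, half_pos hδ, by linarith, hb, ?_⟩
  have hdiff : 0 ≤ᵐ[P] fun z => trtInd z * ((tau (cov z) α)⁻¹ *
      (s * popU P m β z / (1 - ρ * (s * popU P m β z)))) - trtInd z * ((tau (cov z) α)⁻¹ *
      (s * popU P m β z / (1 - ρ₀ * (s * popU P m β z)))) := by
    filter_upwards [hlt', hb] with z h1 h2
    have h3 := div_one_sub_le_div (v := s * popU P m β z) hρlt.le (hδ₀.trans_le h1)
      ((half_pos hδ).trans_le h2)
    have h4 := mul_le_mul_of_nonneg_left h3 (hτ z)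
    simp only [Pi.zero_apply]
    linarith
  have hge := integral_nonneg_of_ae hdiff
  rw [integral_sub hi1 hi0, hroot', sub_zero] at hge
  refine lt_of_le_of_ne hge fun hzero => ?_
  have hz0 : ∫ z, (trtInd z * ((tau (cov z) α)⁻¹ *
      (s * popU P m β z / (1 - ρ * (s * popU P m β z)))) - trtInd z * ((tau (cov z) α)⁻¹ *
      (s * popU P m β z / (1 - ρ₀ * (s * popU P m β z))))) ∂P = 0 := by
    rw [integral_sub hi1 hi0, hroot', sub_zero, ← hzero]
  -- Equality of the integrals at `ρ` and `ρ₀` would force `T v = 0` almost surely, contradicting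
  -- the nonzero gap.
  have hae := (integral_eq_zero_iff_of_nonneg_ae hdiff (hi1.sub hi0)).1 hz0
  refine hgap.ne (integral_eq_zero_of_ae ?_)
  filter_upwards [hae, hlt', hb] with z h1 h2 h3
  have h2' := hδ₀.trans_le h2
  have h3' := (half_pos hδ).trans_le h3
  set v := s * popU P m β z
  have h4 : trtInd z * ((tau (cov z) α)⁻¹ * (v / (1 - ρ * v))) -
      trtInd z * ((tau (cov z) α)⁻¹ * (v / (1 - ρ₀ * v))) =
      (trtInd z * ((tau (cov z) α)⁻¹ * v)) * (v * (ρ - ρ₀)) / ((1 - ρ * v) * (1 - ρ₀ * v)) := by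
    rw [← mul_sub, ← mul_sub, div_sub_div _ _ h3'.ne' h2'.ne']
    ring
  simp only [Pi.zero_apply] at h1 ⊢
  rw [h4, div_eq_zero_iff, or_iff_left (mul_pos h3' h2').ne', mul_eq_zero] at h1
  rcases h1 with h1 | h1
  · exact h1
  · rcases mul_eq_zero.1 h1 with h5 | h5
    · rw [h5]; ring
    · linarith

/-- An interior population multiplier controls the tilting. -/
theorem PopMultiplier.tiltControl (hgrad : GradientDominated P m β 2)
    (R : MLERegime μ P Z α αhat l) (R₁ : ORRegime μ P Z m β βhat l) {lam : ℝ}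
    (h : PopMultiplier P m α β lam) {s : ℝ} (hs : |s| = 1) (hc : s * calibGap P m α β < 0)
    {ε : ℝ} (hε : 0 < ε) :
    ∃ G Λ κ κ' I, TiltControl P Z m α β αhat βhat phat l s ε G Λ κ κ' I := by
  obtain ⟨ρ₁, δ, hρ₁, hδ, hδ1, hlt, hint⟩ := h.exists_tilt R.overlap R₁.fitSq R₁.meas hs hc
  set A := ipwMean P α fun z => s * popU P m β z / (1 - ρ₁ * (s * popU P m β z)) with hAdef
  have hA : 0 < A := div_pos hint R.ipwMass_pos
  refine ⟨Set.univ, ρ₁, δ / 2, 1, fun _ => 0, MeasurableSet.univ, half_pos hδ, one_pos,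
    fun _ => le_rfl, integrable_zero _ _ _, ?_, ?_, ?_⟩
  · simp only [ipwMean, mul_zero, integral_zero, zero_div]
    positivity
  · filter_upwards [hlt] with z hz _ ρ hρ
    exact one_sub_mul_ge_of_le (by linarith) hρ.1 hρ.2 (by linarith)
  -- The first bound keeps the denominators at `û` above `δ / 2`; the second limits the loss in the
  -- calibration sum to `A / 4`, so it stays positive at `ρ₁` and bounds the sample tilt.
  · set r := min (δ / (2 * ρ₁)) (A * δ ^ 2 / 8)
    have hr : 0 < r := by positivity
    have hr1 : ρ₁ * r ≤ δ / 2 := by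
      have h1 : r ≤ δ / (2 * ρ₁) := min_le_left _ _
      rw [le_div_iff₀ (by positivity)] at h1
      linarith
    have hr2 : r ≤ A * δ ^ 2 / 8 := min_le_right _ _
    filter_upwards [tilt_nonneg (phat := phat) hgrad R R₁ hs hc, R₁.uHat_uniform hgrad hr,
      R.le (R.iid.eventually hlt),
      (R.tendsto_wsum (integrable_tilted_popU R₁.fitSq R₁.meas hδ hlt)).eventually
        (lt_mem_nhds (half_lt_self hA))] with p h1 h2 h3 h4 lam' hlam
    have h0 := h1 lam' hlam
    have hv : ∀ j ∈ S1 (fun i => Z i p.2) p.1,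
        |s * uHat m (fun i => Z i p.2) p.1 (βhat p.1 p.2) j - s * popU P m β (Z j p.2)| ≤ r :=
      fun j hj => by
        rw [← mul_sub, abs_mul, hs, one_mul]
        exact h2 j (mem_S1.1 hj).1
    have hk : ∀ j ∈ S1 (fun i => Z i p.2) p.1,
        δ / 2 ≤ 1 - ρ₁ * (s * uHat m (fun i => Z i p.2) p.1 (βhat p.1 p.2) j) := fun j hj => by
      nlinarith [h3 j, (abs_le.1 (hv j hj)).2]
    have hle : -s * lam' ≤ ρ₁ := by
      refine (hlam.isTilted (sq_eq_one_of_abs hs)).le_of_sum_pos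
        (fun j hj => (half_pos hδ).trans_le (hk j hj)) ?_
      have h5 : wsum (fun j => Z j p.2) p.1 (αhat p.1 p.2) (fun j =>
          s * popU P m β (Z j p.2) / (1 - ρ₁ * (s * popU P m β (Z j p.2))) + -(A / 4)) ≤
          wsum (fun j => Z j p.2) p.1 (αhat p.1 p.2) (fun j =>
            s * uHat m (fun i => Z i p.2) p.1 (βhat p.1 p.2) j /
              (1 - ρ₁ * (s * uHat m (fun i => Z i p.2) p.1 (βhat p.1 p.2) j))) := by
        refine wsum_mono fun j hj => ?_
        have k1 := hk j hj
        have k2 := h3 j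
        have k3 := hv j hj
        set w := s * popU P m β (Z j p.2)
        set v := s * uHat m (fun i => Z i p.2) p.1 (βhat p.1 p.2) j
        have k1' := (half_pos hδ).trans_le k1
        have k2' := hδ.trans_le k2
        have k4 : w / (1 - ρ₁ * w) - v / (1 - ρ₁ * v) =
            (w - v) / ((1 - ρ₁ * w) * (1 - ρ₁ * v)) := by
          rw [div_sub_div _ _ k2'.ne' k1'.ne']
          congr 1
          ring
        have k5 : (w - v) / ((1 - ρ₁ * w) * (1 - ρ₁ * v)) ≤ A / 4 := by
          rw [div_le_iff₀ (mul_pos k2' k1')]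
          calc w - v ≤ r := by linarith [(abs_le.1 k3).1]
            _ ≤ A / 4 * (δ * (δ / 2)) := by linarith
            _ ≤ A / 4 * ((1 - ρ₁ * w) * (1 - ρ₁ * v)) := by gcongr
        linarith
      rw [wsum_add, wsum_const _ hlam.nonempty] at h5
      change 0 < wsum (fun j => Z j p.2) p.1 (αhat p.1 p.2) (fun j =>
            s * uHat m (fun i => Z i p.2) p.1 (βhat p.1 p.2) j /
              (1 - ρ₁ * (s * uHat m (fun i => Z i p.2) p.1 (βhat p.1 p.2) j)))
      linarith
    exact ⟨h0, hle, fun j hj => ⟨fun _ => one_sub_mul_ge_of_le (by linarith) h0 hle (hk j hj),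
      fun hj' => absurd (Set.mem_univ _) hj'⟩⟩

end Interior

end PELCausal

namespace PELCausal

/-! ### Small residuals at the extreme regression values -/

section Extreme

variable {d q : ℕ} {Ω : Type*} [MeasurableSpace Ω] {μ : Measure Ω} [IsProbabilityMeasure μ]
  {P : Measure (Obs d)} [IsProbabilityMeasure P] {Z : ℕ → Ω → Obs d}
  {α : EuclideanSpace ℝ (Fin (d + 1))} {αhat : ℕ → Ω → EuclideanSpace ℝ (Fin (d + 1))}
  {m : EuclideanSpace ℝ (Fin d) → EuclideanSpace ℝ (Fin q) → ℝ}
  {β : EuclideanSpace ℝ (Fin q)} {βhat : ℕ → Ω → EuclideanSpace ℝ (Fin q)}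
  {phat : ℕ → Ω → ℕ → ℝ} {l : Filter (ℕ × Ω)}

theorem measurableSet_treated_gt (hm : Measurable fun x => m x β) (s b : ℝ) :
    MeasurableSet {z : Obs d | trt z = true ∧ b < s * popU P m β z} :=
  (measurable_trt (measurableSet_singleton true)).inter
    (measurableSet_lt measurable_const ((measurable_popU hm).const_mul s))

/-- Truncation of the residuals from below at a level of `s * popU`. -/
theorem tendsto_ipwMean_truncated (hov : Overlap P α) (hY : MemLp (y1 : Obs d → ℝ) 2 P)
    (hfit : MemLp (fit m β : Obs d → ℝ) 2 P) (hm : Measurable fun x => m x β) (s : ℝ) :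
    Tendsto (fun K : ℕ => ipwMean P α fun z =>
      Set.indicator {z | (K : ℝ) ≤ s * popU P m β z} (fun z => |resid m β z|) z) atTop (𝓝 0) := by
  have hei := ((memLp_resid hY hfit).integrable (q := 2) (by norm_num)).abs
  have hmeas : ∀ K : ℕ, MeasurableSet {z : Obs d | (K : ℝ) ≤ s * popU P m β z} := fun K =>
    measurableSet_le measurable_const ((measurable_popU hm).const_mul s)
  rw [show (0 : ℝ) = (∫ z : Obs d, (0 : ℝ) ∂P) / ipwMass P α by simp]
  refine Tendsto.div_const (tendsto_integral_of_dominated_convergence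
    (fun z => trtInd z * ((tau (cov z) α)⁻¹ * |resid m β z|)) (fun K => ?_)
    (hov.integrable_weight_mul hei) (fun K => ae_of_all _ fun z => ?_)
    (ae_of_all _ fun z => ?_)) _
  · exact (hov.integrable_weight_mul (hei.indicator (hmeas K))).aestronglyMeasurable
  · have h1 := trtInd_nonneg z
    have h2 := (inv_pos.2 (tau_pos (cov z) α)).le
    rw [norm_mul, norm_mul, Real.norm_of_nonneg h1, Real.norm_of_nonneg h2]
    gcongr
    refine (norm_indicator_le_norm_self _ _).trans ?_
    rw [Real.norm_eq_abs, abs_abs]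
  · refine tendsto_const_nhds.congr' ?_
    filter_upwards [eventually_gt_atTop ⌈s * popU P m β z⌉₊] with K hK
    rw [Set.indicator_of_notMem, mul_zero, mul_zero]
    simp only [Set.mem_ofPred_eq, not_le]
    exact (Nat.le_ceil _).trans_lt (Nat.cast_lt.2 hK)

/-- A level `K` of `v = s * popU` that is exceeded among the treated, and such that the residuals
above it are negligible unless `v` is close to its maximum. -/
theorem exists_threshold (hS : SITA P) (hpos : Positivity P) (hY : MemLp (y1 : Obs d → ℝ) 2 P)
    (hov : Overlap P α) (R₁ : ORRegime μ P Z m β βhat l) {s : ℝ} (hs : |s| = 1)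
    {η ε : ℝ} (hη : 0 < η) (hη1 : η < 1) (hε : 0 < ε) :
    ∃ (K ζ : ℝ) (I : Obs d → ℝ), 0 < K ∧ 0 < ζ ∧ ζ < 1 ∧ (∀ z, 0 ≤ I z) ∧ Integrable I P ∧
      ipwMean P α I ≤ ε ∧ P {z | trt z = true ∧ K / (1 - ζ) < s * popU P m β z} ≠ 0 ∧
      ∃ M : ℝ → Prop, (∀ᵐ z ∂P, trt z = true → M (s * popU P m β z)) ∧
        ∀ z v, K ≤ s * popU P m β z → M v → s * popU P m β z < (1 - η) * v →
          |resid m β z| ≤ I z := by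
  by_cases hB : ∀ K : ℝ, P {z | trt z = true ∧ K < s * popU P m β z} ≠ 0
  -- If `v` is unbounded on the treated, every level is exceeded with positive probability, and a
  -- high enough one makes the residuals above it negligible in mean.
  · have hlim := tendsto_ipwMean_truncated hov hY R₁.fitSq R₁.meas s
    obtain ⟨K, hK, hK0⟩ := ((hlim.eventually (gt_mem_nhds hε)).and (eventually_gt_atTop 0)).exists
    have hei := ((memLp_resid hY R₁.fitSq).integrable (q := 2) (by norm_num)).abs
    refine ⟨K, 1 / 2, Set.indicator {z | (K : ℝ) ≤ s * popU P m β z} fun z => |resid m β z|,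
      Nat.cast_pos.2 hK0, by norm_num, by norm_num,
      Set.indicator_nonneg fun z _ => abs_nonneg _, hei.indicator (measurableSet_le
        measurable_const ((measurable_popU R₁.meas).const_mul s)), hK.le, hB _, fun _ => True,
      by simp, fun z v hz _ _ => ?_⟩
    rw [Set.indicator_of_mem (by exact hz)]
  · push Not at hB
    obtain ⟨K₀, hK₀⟩ := hB
    obtain ⟨δ, hδ, hδ0⟩ := R₁.exists_popU_gt hs
    have hδ1 := hS.measure_treated_ne_zero hpos (R₁.measurableSet_popU_gt s δ) hδ0
    -- If `v` is bounded on the treated, `sInf B` is its essential supremum there. With `K = (1 - η)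
    -- sInf B` no value from `K` on is below `1 - η` times a treated value, so `I = 0` works.
    set B := {b : ℝ | P {z | trt z = true ∧ b < s * popU P m β z} = 0} with hBdef
    have hBδ : ∀ b ∈ B, δ ≤ b := fun b hb => by
      by_contra hcon
      push Not at hcon
      have hsub : {z : Obs d | trt z = true ∧ cov z ∈ {x | δ < s * (m x β - ∫ z', fit m β z' ∂P)}} ⊆
          {z | trt z = true ∧ b < s * popU P m β z} := fun z hz => ⟨hz.1, hcon.trans hz.2⟩
      exact hδ1 (measure_mono_null hsub hb)
    have hbdd : BddBelow B := ⟨δ, hBδ⟩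
    have hMδ : δ ≤ sInf B := le_csInf ⟨K₀, hK₀⟩ hBδ
    have hM0 : 0 < sInf B := hδ.trans_le hMδ
    have hlast : ∀ᵐ z ∂P, trt z = true → s * popU P m β z ≤ sInf B := by
      have h1 : ∀ n : ℕ, ∀ᵐ z ∂P, trt z = true → s * popU P m β z ≤ sInf B + 1 / (n + 1) := by
        intro n
        obtain ⟨b, hb, hbn⟩ := exists_lt_of_csInf_lt ⟨K₀, hK₀⟩
          (lt_add_of_pos_right (sInf B) (Nat.one_div_pos_of_nat (α := ℝ) (n := n)))
        rw [ae_iff]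
        refine measure_mono_null (fun z hz => ?_) hb
        simp only [Set.mem_ofPred_eq, Classical.not_imp, not_le] at hz
        exact ⟨hz.1, hbn.trans hz.2⟩
      filter_upwards [ae_all_iff.2 h1] with z hz hT
      have h2 := tendsto_one_div_add_atTop_nhds_zero_nat (𝕜 := ℝ).const_add (sInf B)
      rw [add_zero] at h2
      exact ge_of_tendsto' h2 fun n => hz n hT
    refine ⟨(1 - η) * sInf B, η / 2, fun _ => 0, mul_pos (by linarith) hM0, by linarith,
      by linarith, fun _ => le_rfl, integrable_zero _ _ _, ?_, fun hcon => ?_,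
      fun v => v ≤ sInf B, hlast, fun z v hz hv hlt => ?_⟩
    · simp only [ipwMean, mul_zero, integral_zero, zero_div]
      exact hε.le
    · refine (csInf_le hbdd hcon).not_gt ?_
      rw [div_lt_iff₀ (by linarith)]
      nlinarith
    · have h1 : (1 - η) * v ≤ (1 - η) * sInf B := mul_le_mul_of_nonneg_left hv (by linarith)
      linarith

/-- Small residuals at the extreme regression values control the tilting. -/
theorem SmallExtremeResiduals.tiltControl (hS : SITA P) (hpos : Positivity P)
    (hY : MemLp (y1 : Obs d → ℝ) 2 P) (hgrad : GradientDominated P m β 2)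
    (R : MLERegime μ P Z α αhat l) (R₁ : ORRegime μ P Z m β βhat l)
    {s : ℝ} (h : SmallExtremeResiduals μ P Z m β s) (hs : |s| = 1)
    (hc : s * calibGap P m α β < 0) {ε : ℝ} (hε : 0 < ε) :
    ∃ G Λ κ κ' I, TiltControl P Z m α β αhat βhat phat l s ε G Λ κ κ' I := by
  obtain ⟨η, hη, hη1, hlim⟩ := h ε hε
  obtain ⟨K, ζ, I, hK, hζ, hζ1, hI, hIi, hIm, hne, M, hM, hres⟩ :=
    exists_threshold hS hpos hY R.overlap R₁ hs hη hη1 (mul_pos hε (half_pos hη))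
  have hext : ∀ᶠ p in whp μ, ¬ ∃ j ∈ S1 (fun i => Z i p.2) p.1,
      (∀ k ∈ S1 (fun i => Z i p.2) p.1,
        (1 - η) * (s * popU P m β (Z k p.2)) ≤ s * popU P m β (Z j p.2)) ∧
      ε * (s * popU P m β (Z j p.2)) < |y1 (Z j p.2) - fit m β (Z j p.2)| := by
    refine (eventually_whp (Q := fun n ω => ¬ ∃ j ∈ S1 (fun i => Z i ω) n,
      (∀ k ∈ S1 (fun i => Z i ω) n,
        (1 - η) * (s * popU P m β (Z k ω)) ≤ s * popU P m β (Z j ω)) ∧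
      ε * (s * popU P m β (Z j ω)) < |y1 (Z j ω) - fit m β (Z j ω)|)).2 ?_
    simpa only [not_not] using hlim
  -- A treated unit with value at least `K / (1 - ζ / 2)` has a positive denominator, which bounds
  -- the tilt by `Λ`.
  set Λ := (1 - ζ / 2) / K with hΛdef
  have hΛ : 0 < Λ := div_pos (by linarith) hK
  have hΛK : Λ * K = 1 - ζ / 2 := div_mul_cancel₀ _ hK.ne'
  have hgap : 0 < K / (1 - ζ) - K / (1 - ζ / 2) :=
    sub_pos.2 (div_lt_div_of_pos_left hK (by linarith) (by linarith))
  refine ⟨{x | s * (m x β - ∫ z', fit m β z' ∂P) < K}, Λ, ζ / 4, η / 2, I,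
    measurableSet_lt ((R₁.meas.sub_const _).const_mul s) measurable_const, by linarith,
    by linarith, hI, hIi, hIm, ae_of_all _ fun z hz ρ hρ => ?_, ?_⟩
  · refine one_sub_mul_ge_of_le (by linarith) hρ.1 hρ.2 ?_
    have hz' : s * popU P m β z < K := hz
    nlinarith
  -- The three bounds transfer the large value of the unit `k₀` from `u` to `û`, keep the
  -- denominators below level `K` above `ζ / 4`, and absorb the error `2 ρ r ≤ η / 2` away from the
  -- maximum.
  · set r := min (K / (1 - ζ) - K / (1 - ζ / 2)) (min (ζ / 4 / Λ) (η / 4 / Λ))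
    have hr : 0 < r := by
      refine lt_min hgap ?_
      positivity
    have hr1 : r ≤ K / (1 - ζ) - K / (1 - ζ / 2) := min_le_left _ _
    have hr2 : r * Λ ≤ ζ / 4 := (le_div_iff₀ hΛ).1 ((min_le_right _ _).trans (min_le_left _ _))
    have hr3 : r * Λ ≤ η / 4 := (le_div_iff₀ hΛ).1 ((min_le_right _ _).trans (min_le_right _ _))
    filter_upwards [tilt_nonneg (phat := phat) hgrad R R₁ hs hc, R₁.uHat_uniform hgrad hr,
      R.le hext, R.le (R.iid.eventually hM),
      R.le (R.iid.exists_mem (measurableSet_treated_gt R₁.meas s _) hne)]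
      with p h1 h2 h3 h4 ⟨k₀, hk₀, hk₀T, hk₀v⟩ lam hlam
    have h0 := h1 lam hlam
    set ρ := -s * lam
    have t := hlam.isTilted (sq_eq_one_of_abs hs)
    set v : ℕ → ℝ := fun j => s * uHat m (fun i => Z i p.2) p.1 (βhat p.1 p.2) j with hvdef
    set w : ℕ → ℝ := fun j => s * popU P m β (Z j p.2) with hwdef
    have hv : ∀ j ∈ S1 (fun i => Z i p.2) p.1, |v j - w j| ≤ r := fun j hj => by
      rw [hvdef, hwdef, ← mul_sub, abs_mul, hs, one_mul]
      exact h2 j (mem_S1.1 hj).1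
    have hΛρ : ρ ≤ Λ := by
      have hk : k₀ ∈ S1 (fun i => Z i p.2) p.1 := mem_S1.2 ⟨hk₀, hk₀T⟩
      have k1 : K / (1 - ζ / 2) ≤ v k₀ := by
        have k2 : K / (1 - ζ) < w k₀ := hk₀v
        linarith [(abs_le.1 (hv k₀ hk)).1]
      have k3 : 0 < 1 - ρ * v k₀ := t.pos k₀ hk
      have k4 : ρ * (K / (1 - ζ / 2)) ≤ 1 := by
        linarith [mul_le_mul_of_nonneg_left k1 h0]
      rw [mul_div_assoc', div_le_one (by linarith)] at k4
      rw [hΛdef, le_div_iff₀ hK]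
      exact k4
    refine ⟨h0, hΛρ, fun j hj => ⟨fun hG => ?_, fun hG => ?_⟩⟩
    · refine one_sub_mul_ge_of_le (by linarith) h0 hΛρ ?_
      have hG' : w j < K := hG
      change ζ / 4 ≤ 1 - Λ * v j
      have k1 : v j ≤ K + r := by linarith [(abs_le.1 (hv j hj)).2]
      have k2 := mul_le_mul_of_nonneg_left k1 hΛ.le
      linarith
    · have hG' : K ≤ w j := not_lt.1 hG
      by_cases hmax : ∀ k ∈ S1 (fun i => Z i p.2) p.1, (1 - η) * w k ≤ w j
      · right
        by_contra hcon
        exact h3 ⟨j, hj, hmax, not_le.1 hcon⟩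
      · left
        push Not at hmax
        obtain ⟨k, hk, hkj⟩ := hmax
        refine ⟨?_, hres _ (w k) hG' (h4 k (mem_S1.1 hk).2) hkj⟩
        change η / 2 ≤ 1 - ρ * v j
        -- Positivity at `k` gives `ρ vₖ < 1`, hence `ρ vⱼ ≤ 1 - η + η / 2`: the denominator at `j`
        -- is bounded although that at the maximum may tend to zero.
        have k1 : v j ≤ (1 - η) * v k + 2 * r := by
          nlinarith [(abs_le.1 (hv j hj)).2, (abs_le.1 (hv k hk)).1]
        have k2 : 0 < 1 - ρ * v k := t.pos k hk
        have k3 := mul_le_mul_of_nonneg_left k1 h0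
        have k4 : ρ * r ≤ η / 4 := by nlinarith
        nlinarith

end Extreme

end PELCausal

namespace PELCausal

/-! ### Limits in probability of the calibrated estimator -/

section Limits

variable {d q₁ q₀ : ℕ} {Ω : Type*} [MeasurableSpace Ω] {μ : Measure Ω} [IsProbabilityMeasure μ]
  {P : Measure (Obs d)} [IsProbabilityMeasure P] {Z : ℕ → Ω → Obs d}
  {α : EuclideanSpace ℝ (Fin (d + 1))} {αhat : ℕ → Ω → EuclideanSpace ℝ (Fin (d + 1))}
  {m₁ : EuclideanSpace ℝ (Fin d) → EuclideanSpace ℝ (Fin q₁) → ℝ}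
  {m₀ : EuclideanSpace ℝ (Fin d) → EuclideanSpace ℝ (Fin q₀) → ℝ}
  {β₁ : EuclideanSpace ℝ (Fin q₁)} {β₀ : EuclideanSpace ℝ (Fin q₀)}
  {βhat₁ : ℕ → Ω → EuclideanSpace ℝ (Fin q₁)} {βhat₀ : ℕ → Ω → EuclideanSpace ℝ (Fin q₀)}
  {phat₁ : ℕ → Ω → ℕ → ℝ} {l : Filter (ℕ × Ω)}

theorem scoreSize_nonneg (z : ℕ → Obs d) (α : EuclideanSpace ℝ (Fin (d + 1))) (n : ℕ) :
    0 ≤ scoreSize z α n := by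
  unfold scoreSize
  positivity

/-- A tight sequence whose boundedness along a filter puts the estimators of all parameters into
their asymptotic regime. -/
theorem exists_tight_regime (hiid : IsIIDSample μ P Z) (hS : SITA P) (hpos : Positivity P)
    (hX : MemLp (cov : Obs d → EuclideanSpace ℝ (Fin d)) 2 P)
    (hm₁ : ∀ b, Measurable fun x => m₁ x b) (hm₀ : ∀ b, Measurable fun x => m₀ x b)
    (hm₁sq : MemLp (fit m₁ β₁ : Obs d → ℝ) 2 P) (hm₀sq : MemLp (fit m₀ β₀ : Obs d → ℝ) 2 P)
    (hm₁var : 0 < variance (fit m₁ β₁ : Obs d → ℝ) P)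
    (hm₀var : 0 < variance (fit m₀ β₀ : Obs d → ℝ) P)
    (hm₁grad : GradientDominated P m₁ β₁ 1) (hm₀grad : GradientDominated P m₀ β₀ 1)
    (hβ₁ : RootNConsistent μ βhat₁ β₁) (hβ₀ : RootNConsistent μ βhat₀ β₀)
    (hα : ∀ n ω, (∃ a, IsMLE (fun j => Z j ω) n a) → IsMLE (fun j => Z j ω) n (αhat n ω))
    (hscore : ScoreZero P α) (hov : Overlap P α) :
    ∃ F : ℕ → Ω → ℝ, Tight μ F ∧ ∀ l ≤ whp μ, (∃ C, ∀ᶠ p in l, F p.1 p.2 ≤ C) →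
      MLERegime μ P Z α αhat l ∧ ORRegime μ P Z m₁ β₁ βhat₁ l ∧ ORRegime μ P Z m₀ β₀ βhat₀ l ∧
      (calibGap P m₁ α β₁ = 0 → ∃ C, ∀ᶠ p in l, |∑ j ∈ Finset.range p.1, trtInd (Z j p.2) *
        ((tau (cov (Z j p.2)) α)⁻¹ * popU P m₁ β₁ (Z j p.2))| / √(p.1 : ℝ) ≤ C) := by
  have hu₁ := memLp_popU hm₁sq
  have hg := hov.memLp_weight_mul hu₁
  have t1 := tight_scoreSize hiid hX hscore
  have t2 := hiid.tight_sum hu₁ (integral_popU hm₁sq)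
  have t3 := hiid.tight_sum (memLp_popU hm₀sq) (integral_popU hm₀sq)
  -- Subtracting the gap centres the summands in all cases; the uncentred sum is bounded only when
  -- the gap vanishes.
  have t4 := hiid.tight_sum (hg.sub (memLp_const (calibGap P m₁ α β₁))) (by
    simp only [Pi.sub_apply]
    rw [integral_sub (hg.integrable (by norm_num)) (integrable_const _), ← calibGap_eq]
    simp)
  refine ⟨_, ((t1.add t2).add (t3.add t4)).add (Tight.add (f := fun n ω =>
    √(n : ℝ) * ‖βhat₁ n ω - β₁‖) (g := fun n ω => √(n : ℝ) * ‖βhat₀ n ω - β₀‖) hβ₁ hβ₀), ?_⟩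
  rintro l hl ⟨C, hC⟩
  -- All summands of the tight sequence are nonnegative, so a bound on the sum bounds each of them.
  have n1 : ∀ p : ℕ × Ω, 0 ≤ scoreSize (fun j => Z j p.2) α p.1 := fun p => scoreSize_nonneg _ _ _
  have n2 : ∀ (p : ℕ × Ω) (g : Obs d → ℝ),
      0 ≤ |∑ j ∈ Finset.range p.1, g (Z j p.2)| / √(p.1 : ℝ) := fun p g => by positivity
  have n3 : ∀ (p : ℕ × Ω), 0 ≤ √(p.1 : ℝ) * ‖βhat₁ p.1 p.2 - β₁‖ := fun p => by positivity
  have n4 : ∀ (p : ℕ × Ω), 0 ≤ √(p.1 : ℝ) * ‖βhat₀ p.1 p.2 - β₀‖ := fun p => by positivity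
  have n5 := fun p => n2 p (popU P m₁ β₁)
  have n6 := fun p => n2 p (popU P m₀ β₀)
  have n7 := fun p => n2 p ((fun z => trtInd z * ((tau (cov z) α)⁻¹ * popU P m₁ β₁ z)) -
    fun _ => calibGap P m₁ α β₁)
  have htr : P {z | trt z = true} ≠ 0 := by
    have h1 := hS.measure_treated_ne_zero hpos MeasurableSet.univ (by simp)
    simpa using h1
  refine ⟨⟨hiid, hl, hX, hov, htr, exists_mle_rate hiid hX hov hα hl (C := C) ?_⟩,
    ⟨hiid, hl, hm₁ _, hm₁sq, hm₁var, hm₁grad, ⟨C, ?_⟩, ⟨C, ?_⟩⟩,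
    ⟨hiid, hl, hm₀ _, hm₀sq, hm₀var, hm₀grad, ⟨C, ?_⟩, ⟨C, ?_⟩⟩, fun hgap => ⟨C, ?_⟩⟩
  · filter_upwards [hC] with p hp
    linarith [n3 p, n4 p, n5 p, n6 p, n7 p]
  · filter_upwards [hC] with p hp
    linarith [n1 p, n4 p, n5 p, n6 p, n7 p]
  · filter_upwards [hC] with p hp
    linarith [n1 p, n3 p, n4 p, n6 p, n7 p]
  · filter_upwards [hC] with p hp
    linarith [n1 p, n3 p, n5 p, n6 p, n7 p]
  · filter_upwards [hC] with p hp
    linarith [n1 p, n3 p, n4 p, n5 p, n7 p]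
  · filter_upwards [hC] with p hp
    simp only [hgap, Pi.sub_apply, sub_zero] at hp
    linarith [n1 p, n3 p, n4 p, n5 p, n6 p]

/-- Under a correct propensity score model the weighted integral is the unweighted one. -/
theorem SITA.integral_weight_mul (hS : SITA P) (hPS : PSCorrect P α) (hov : Overlap P α)
    {f : EuclideanSpace ℝ (Fin d) × ℝ × ℝ → ℝ} (hf : Measurable f)
    (hi : Integrable (fun z : Obs d => f (covOut z)) P) :
    ∫ z, trtInd z * ((tau (cov z) α)⁻¹ * f (covOut z)) ∂P = ∫ z, f (covOut z) ∂P := by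
  obtain ⟨b, -, hbz⟩ := hov.exists_bound
  have hτm : Measurable fun x : EuclideanSpace ℝ (Fin d) => (tau x α)⁻¹ := (measurable_tau α).inv
  have hi2 : Integrable (fun z : Obs d => (tau (cov z) α)⁻¹ * f (covOut z)) P := by
    refine hi.bdd_mul (c := b) (hτm.comp measurable_cov).aestronglyMeasurable ?_
    filter_upwards [hbz] with z hz
    rw [Real.norm_of_nonneg (inv_pos.2 (tau_pos _ _)).le]
    exact hz
  refine (hS.integral_trtInd_mul (f := fun w => (tau w.1 α)⁻¹ * f w)
    ((hτm.comp measurable_fst).mul hf) hi2).trans (integral_congr_ae ?_)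
  filter_upwards [hPS] with z hz
  change trueScore P z * ((tau (cov z) α)⁻¹ * f (covOut z)) = f (covOut z)
  rw [hz, mul_inv_cancel_left₀ (tau_pos _ _).ne']

theorem ipwMean_y1_of_psCorrect (hS : SITA P) (hPS : PSCorrect P α) (hov : Overlap P α)
    (hY : Integrable (y1 : Obs d → ℝ) P) : ipwMean P α y1 = ∫ z, y1 z ∂P := by
  have h1 : ipwMass P α = 1 := by
    have h := hS.integral_weight_mul hPS hov (f := fun _ => 1) measurable_const
      (integrable_const _)
    simpa [ipwMass] using h
  rw [ipwMean, h1, div_one]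
  exact hS.integral_weight_mul hPS hov (f := fun w => w.2.1) measurable_snd.fst hY

theorem calibGap_of_psCorrect (hS : SITA P) (hPS : PSCorrect P α) (hov : Overlap P α)
    (hm : Measurable fun x => m₁ x β₁) (hfit : MemLp (fit m₁ β₁ : Obs d → ℝ) 2 P) :
    calibGap P m₁ α β₁ = 0 := by
  rw [calibGap_eq, ← integral_popU hfit]
  exact hS.integral_weight_mul hPS hov (f := fun w => m₁ w.1 β₁ - ∫ z', fit m₁ β₁ z' ∂P)
    ((hm.comp measurable_fst).sub_const _) ((memLp_popU hfit).integrable (by norm_num))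

/-- Split `Y₁` into residual, centred regression and constant. The first has weighted mean zero by
the regression model, the second by the vanishing gap. -/
theorem ipwMean_y1_of_orCorrect (hS : SITA P) (hov : Overlap P α)
    (hY : MemLp (y1 : Obs d → ℝ) 2 P) (hm : Measurable fun x => m₁ x β₁)
    (hfit : MemLp (fit m₁ β₁ : Obs d → ℝ) 2 P) (hOR : ORCorrect P m₁ β₁)
    (hmass : 0 < ipwMass P α) (hgap : calibGap P m₁ α β₁ = 0) :
    ipwMean P α y1 = ∫ z, y1 z ∂P := by
  obtain ⟨h1, h2⟩ := ipwMean_resid_mul hS hov hY hfit hm hOR (g := fun _ => 1) measurable_const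
    (K := 1) (by simp)
  rw [ipwMean, div_eq_zero_iff, or_iff_left hmass.ne'] at h2
  rw [ipwMean, integral_y1_eq_of_orCorrect hOR, div_eq_iff hmass.ne']
  have h3 := hov.integrable_weight_mul h1
  have h4 := hov.integrable_weight_mul ((memLp_popU hfit).integrable (q := 2) (by norm_num))
  have h5 := hov.integrable_weight_mul (integrable_const (μ := P) (∫ z, fit m₁ β₁ z ∂P))
  have h6 : ∀ z : Obs d, trtInd z * ((tau (cov z) α)⁻¹ * y1 z) =
      trtInd z * ((tau (cov z) α)⁻¹ * (resid m₁ β₁ z * 1)) +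
      trtInd z * ((tau (cov z) α)⁻¹ * popU P m₁ β₁ z) +
      trtInd z * ((tau (cov z) α)⁻¹ * ∫ z, fit m₁ β₁ z ∂P) := fun z => by
    unfold resid popU
    ring
  simp only [h6]
  have h7 := integral_add (h3.add h4) h5
  simp only [Pi.add_apply] at h7
  rw [h7, integral_add h3 h4, h2, ← calibGap_eq, hgap]
  simp only [← mul_assoc]
  rw [integral_mul_const, ipwMass]
  ring

/-- Consistency under a correct outcome regression model, along a filter. -/
theorem tendsto_muHat_of_orCorrect (hS : SITA P) (hpos : Positivity P)
    (hY : MemLp (y1 : Obs d → ℝ) 2 P) (hOR : ORCorrect P m₁ β₁)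
    (hgrad : GradientDominated P m₁ β₁ 2) (hreg : CalibrationRegular μ P Z m₁ α β₁)
    (R : MLERegime μ P Z α αhat l) (R₁ : ORRegime μ P Z m₁ β₁ βhat₁ l)
    (hcal : ∀ᶠ p in l, ∃ lam, IsCalibrated m₁ (fun j => Z j p.2) p.1 (αhat p.1 p.2)
      (βhat₁ p.1 p.2) (phat₁ p.1 p.2) lam)
    (hC : calibGap P m₁ α β₁ = 0 → ∃ C, ∀ᶠ p in l, |∑ j ∈ Finset.range p.1, trtInd (Z j p.2) *
      ((tau (cov (Z j p.2)) α)⁻¹ * popU P m₁ β₁ (Z j p.2))| / √(p.1 : ℝ) ≤ C) :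
    Tendsto (fun p : ℕ × Ω => muHat (fun j => Z j p.2) p.1 (phat₁ p.1 p.2)) l
      (𝓝 (∫ z, y1 z ∂P)) := by
  rcases eq_or_ne (calibGap P m₁ α β₁) 0 with hgap | hgap
  · obtain ⟨C, hC⟩ := hC hgap
    rw [← ipwMean_y1_of_orCorrect hS R.overlap hY R₁.meas R₁.fitSq hOR R.ipwMass_pos hgap]
    exact (expansion_of_calibrated hS hpos hY R R₁ hcal hC).2
  -- The sign makes the weighted mean of `s u` negative, so that calibration tilts the weights
  -- towards large `s u`.
  obtain ⟨s, hs, hc, hext⟩ : ∃ s : ℝ, |s| = 1 ∧ s * calibGap P m₁ α β₁ < 0 ∧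
      ((∃ lam, PopMultiplier P m₁ α β₁ lam) ∨ SmallExtremeResiduals μ P Z m₁ β₁ s) := by
    rcases hgap.lt_or_gt with h | h
    · exact ⟨1, abs_one, by linarith, hreg.imp_right fun h' => h'.2 h⟩
    · exact ⟨-1, by simp, by linarith, hreg.imp_right fun h' => h'.1 h⟩
  refine tendsto_muHat_of_tiltControl hS hpos hY hOR hgrad R R₁ hcal hs fun ε hε => ?_
  rcases hext with ⟨lam, hlam⟩ | h
  · exact hlam.tiltControl hgrad R R₁ hs hc hε
  · exact h.tiltControl hS hpos hY hgrad R R₁ hs hc hε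

end Limits

end PELCausal

/-! ### The two parts of the theorem -/

theorem mainTheorem4 {Ω : Type*} [MeasurableSpace Ω] (μ : Measure Ω) [IsProbabilityMeasure μ]
    {d q₁ q₀ : ℕ}
    -- the population, and an i.i.d. sample from it
    (P : Measure (Obs d)) [IsProbabilityMeasure P]
    (Z : ℕ → Ω → Obs d) (hZm : ∀ j, Measurable (Z j)) (hZlaw : ∀ j, μ.map (Z j) = P)
    (hZindep : iIndepFun Z μ)
    (hA1 : SITA P) (hA2 : Positivity P)
    -- finite second moments of the outcome and of the covariates
    (hY : MemLp (y1 : Obs d → ℝ) 2 P)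
    (hX : MemLp (cov : Obs d → EuclideanSpace ℝ (Fin d)) 2 P)
    -- the working outcome regression models, and the limits of their parameter estimators
    (m₁ : EuclideanSpace ℝ (Fin d) → EuclideanSpace ℝ (Fin q₁) → ℝ)
    (m₀ : EuclideanSpace ℝ (Fin d) → EuclideanSpace ℝ (Fin q₀) → ℝ)
    (hm₁ : ∀ b, Measurable fun x => m₁ x b) (hm₀ : ∀ b, Measurable fun x => m₀ x b)
    (β₁ : EuclideanSpace ℝ (Fin q₁)) (β₀ : EuclideanSpace ℝ (Fin q₀))
    (hm₁sq : MemLp (fit m₁ β₁ : Obs d → ℝ) 2 P) (hm₀sq : MemLp (fit m₀ β₀ : Obs d → ℝ) 2 P)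
    (hm₁var : 0 < variance (fit m₁ β₁ : Obs d → ℝ) P)
    (hm₀var : 0 < variance (fit m₀ β₀ : Obs d → ℝ) P)
    (hm₁grad : GradientDominated P m₁ β₁ 1) (hm₀grad : GradientDominated P m₀ β₀ 1)
    (βhat₁ : ℕ → Ω → EuclideanSpace ℝ (Fin q₁)) (βhat₀ : ℕ → Ω → EuclideanSpace ℝ (Fin q₀))
    (hβ₁ : RootNConsistent μ βhat₁ β₁) (hβ₀ : RootNConsistent μ βhat₀ β₀)
    -- the maximum likelihood estimator of the propensity score parameters
    (αhat : ℕ → Ω → EuclideanSpace ℝ (Fin (d + 1)))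
    (hα : ∀ n ω, (∃ a, IsMLE (fun j => Z j ω) n a) → IsMLE (fun j => Z j ω) n (αhat n ω))
    -- the constrained maximizer of the pseudo-empirical likelihood
    (phat₁ phat₀ : ℕ → Ω → ℕ → ℝ)
    (hp : ∀ n ω,
      (∃ r₁ r₀, IsMaxPEL m₁ m₀ (fun j => Z j ω) n (αhat n ω) (βhat₁ n ω) (βhat₀ n ω) r₁ r₀) →
      IsMaxPEL m₁ m₀ (fun j => Z j ω) n (αhat n ω) (βhat₁ n ω) (βhat₀ n ω)
        (phat₁ n ω) (phat₀ n ω)) :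
    -- correct propensity score model: consistency and asymptotic expansion
    (∀ α₀ : EuclideanSpace ℝ (Fin (d + 1)), PSCorrect P α₀ → Overlap P α₀ →
      TendstoInMeasure μ (fun n ω => muHat (fun j => Z j ω) n (phat₁ n ω)) atTop
        (fun _ => ∫ z, y1 z ∂P) ∧
      SmallOpRootN μ (fun n ω => muHat (fun j => Z j ω) n (phat₁ n ω) -
        leadingTerm m₁ (fun j => Z j ω) n (αhat n ω) (βhat₁ n ω))) ∧
    -- correct outcome regression model: consistency
    (ORCorrect P m₁ β₁ → GradientDominated P m₁ β₁ 2 →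
      ∀ αstar : EuclideanSpace ℝ (Fin (d + 1)),
        IsPseudoTrue P αstar → Overlap P αstar → CalibrationRegular μ P Z m₁ αstar β₁ →
      TendstoInMeasure μ (fun n ω => muHat (fun j => Z j ω) n (phat₁ n ω)) atTop
        (fun _ => ∫ z, y1 z ∂P)) := by
  have hiid : IsIIDSample μ P Z := ⟨hZm, hZlaw, hZindep⟩
  refine ⟨fun α₀ hPS hov => ?_, fun hOR hgrad αstar hstar hov hreg => ?_⟩
  · obtain ⟨F, hF, hreg⟩ := exists_tight_regime hiid hA1 hA2 hX hm₁ hm₀ hm₁sq hm₀sq hm₁var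
      hm₀var hm₁grad hm₀grad hβ₁ hβ₀ hα (scoreZero_of_psCorrect hX hA1 hPS) hov
    have hgap := calibGap_of_psCorrect hA1 hPS hov (hm₁ β₁) hm₁sq
    rw [← ipwMean_y1_of_psCorrect hA1 hPS hov (hY.integrable (by norm_num))]
    constructor
    · refine tendsto_whp_iff.1 (tendsto_whp_of_tight hF fun l hl hC => ?_)
      obtain ⟨R, R₁, R₀, h⟩ := hreg l hl hC
      obtain ⟨C, hC⟩ := h hgap
      exact (expansion_of_calibrated hA1 hA2 hY R R₁
        (exists_isCalibrated hA1 hA2 R₁ R₀ hp) hC).2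
    · refine tendsto_whp_iff.1 (tendsto_whp_of_tight hF fun l hl hC => ?_)
      obtain ⟨R, R₁, R₀, h⟩ := hreg l hl hC
      obtain ⟨C, hC⟩ := h hgap
      exact (expansion_of_calibrated hA1 hA2 hY R R₁
        (exists_isCalibrated hA1 hA2 R₁ R₀ hp) hC).1
  · obtain ⟨F, hF, h⟩ := exists_tight_regime hiid hA1 hA2 hX hm₁ hm₀ hm₁sq hm₀sq hm₁var
      hm₀var hm₁grad hm₀grad hβ₁ hβ₀ hα (scoreZero_of_isPseudoTrue hX hstar) hov
    refine tendsto_whp_iff.1 (tendsto_whp_of_tight hF fun l hl hC => ?_)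
    obtain ⟨R, R₁, R₀, hC⟩ := h l hl hC
    exact tendsto_muHat_of_orCorrect hA1 hA2 hY hOR hgrad hreg R R₁
      (exists_isCalibrated hA1 hA2 R₁ R₀ hp) hC
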